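/- Let $M$ be a smooth manifold (Hausdorff, $\sigma$-compact) of dimension $n+d$ with $d\ge 1$, and let $i:I\hookrightarrow M$ be a closed embedded submanifold of dimension $n$. Write $\mathcal D'(\Omega)$ for the continuous dual of $\mathcal D(\Omega)=C^\infty_c(\Omega;\mathbb C)$, and $C=\{(p;\eta)\in T^*M : p\in I,\ \eta\neq 0,\ \eta|_{T_pI}=0\}$ for the conormal bundle of $I$ without its zero section. Fix a smooth positive density $\mu$ on $I$, by which smooth functions on open subsets of $I$ are identified with distributions. Let $\rho$ be an Euler vector field for $I$ on an open neighborhood $U$ of $I$, i.e. a smooth vector field such that $\rho f-f\in\mathcal I(U)^2$ for all $f\in\mathcal I(U)$, where $\mathcal I(U)$ is the ideal of functions in $C^\infty(U;\mathbb R)$ vanishing on $I$. Let $\pi^\rho(p)=\lim_{s\to+\infty}e^{-s\rho}(p)\in I$, defined on the set of points $p\in U$ whose backward flow line $(e^{-s\rho}(p))_{s\ge 0}$ exists in $U$ and converges to a point of $I$. **Theorem.** Let $t\in\mathcal D'(M\setminus I)$ be such that every point $(p;\eta)$, with $p\in I$ and $\eta\ne0$, of the closure of $WF(t)$ in $T^*M$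 lies in $C$. Then there is an open neighborhood $\mathcal V$ of $I$, on which $\pi^\rho$ is defined, with the following property. Let $W\subset M$ be open and let $h=(h^1,\dots,h^d)$ be a system of transverse coordinate functions on $W$: smooth real functions on $W$ vanishing on $I\cap W$, together with commuting smooth vector fields $\partial_{h^1},\dots,\partial_{h^d}$ on $W$ such that $\partial_{h^j}h^k=\delta_{jk}$. (If $h$ is defined near all of $I$, then $W\supset I$.) Let $\alpha\in\mathbb N^d$ and let $\psi\in C^\infty(M;\mathbb C)$ vanish in a neighborhood of $I$, with $\operatorname{supp}\psi\subset\mathcal V$, $\pi^\rho:\operatorname{supp}\psi\to I$ proper and $\pi^\rho(\operatorname{supp}\psi)\subset W$. Then the formula $$\langle\tau,\varphi\rangle=\big\langle t\psi,\ \pi^{\rho*}i^*(\partial_h^\alpha\varphi)\big\rangle=\big\langle t,\ \psi\cdot\big((\partial_h^\alpha\varphi)\circ i\circ\pi^\rho\big)\big\rangle,\qquad \varphi\in\mathcal D(M),$$ defines a distribution $\tau\in\mathcal D'(M)$ (a local counterterm of $t$), and $$WF(\tau)\subset C .$$ Moreover, there is a unique family $(\tau_\beta)_{\beta\in\mathbb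 N^d}$ of distributions $\tau_\beta\in\mathcal D'(I\cap W)$ with locally finite supports such that $$\tau=\sum_\beta\partial_h^\beta(i_*\tau_\beta)\quad\text{on } W,$$ and all $\tau_\beta$ are smooth: $\tau_\beta\in C^\infty(I\cap W)$. Here $\langle i_*S,\varphi\rangle=\langle S,\varphi\circ i\rangle$ and $\langle\partial_{h^j}T,\varphi\rangle=-\langle T,\partial_{h^j}\varphi\rangle$. -/

import Mathlib

open Set Filter Topology MeasureTheory Manifold
open scoped ContDiff

noncomputable section

namespace Counterterms

/-! ### Test functions and distributions on open sets of a manifold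

Manifolds are boundaryless and modelled on a finite dimensional normed space `E`. -/

section Distributions

variable (E : Type*) [NormedAddCommGroup E] [NormedSpace ℝ E]
variable {M : Type*} [TopologicalSpace M] [ChartedSpace E M]

variable {E} in
theorem contMDiffAt_mul {f g : M → ℂ} {x : M} (hf : ContMDiffAt 𝓘(ℝ, E) 𝓘(ℝ, ℂ) ∞ f x)
    (hg : ContMDiffAt 𝓘(ℝ, E) 𝓘(ℝ, ℂ) ∞ g x) :
    ContMDiffAt 𝓘(ℝ, E) 𝓘(ℝ, ℂ) ∞ (fun q => f q * g q) x := by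
  have h : ContDiff ℝ ∞ (fun z : ℂ × ℂ => z.1 * z.2) := contDiff_fst.mul contDiff_snd
  exact (h.contMDiff.contMDiffAt).comp x (hf.prodMk_space hg)

/-- `𝒟(Ω)`: smooth complex functions on `M` with compact support contained in the
open set `Ω`. -/
def TestSpace (Ω : Set M) : Submodule ℂ (M → ℂ) where
  carrier := {φ | ContMDiff 𝓘(ℝ, E) 𝓘(ℝ, ℂ) ∞ φ ∧ HasCompactSupport φ ∧ tsupport φ ⊆ Ω}
  add_mem' := by
    rintro φ ψ ⟨h1, h2, h3⟩ ⟨k1, k2, k3⟩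
    exact ⟨h1.add k1, h2.add k2, (tsupport_add φ ψ).trans (union_subset h3 k3)⟩
  zero_mem' := by
    refine ⟨contMDiff_const, HasCompactSupport.zero, ?_⟩
    simp [tsupport]
  smul_mem' := by
    rintro c φ ⟨h1, h2, h3⟩
    have e : c • φ = fun x => c * φ x := rfl
    refine ⟨?_, ?_, ?_⟩
    · rw [e]; exact fun x => contMDiffAt_mul contMDiffAt_const (h1 x)
    · rw [e]; exact HasCompactSupport.mul_left h2
    · rw [e]; exact (tsupport_mul_subset_right (f := fun _ => c) (g := φ)).trans h3

/-- Continuity of a linear functional on `𝒟(Ω)`: on test functions supported in a fixed compact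
subset of a coordinate domain it is bounded by finitely many derivatives in the coordinates. -/
def IsDistribution {Ω : Set M} (T : TestSpace E Ω →ₗ[ℂ] ℂ) : Prop :=
  ∀ p : M, ∀ K : Set M, IsCompact K → K ⊆ (chartAt E p).source ∩ Ω →
    ∃ (k : ℕ) (C : ℝ), ∀ (φ : TestSpace E Ω) (B : ℝ), tsupport (φ : M → ℂ) ⊆ K →
      (∀ j ≤ k, ∀ q ∈ K,
        ‖iteratedFDeriv ℝ j ((φ : M → ℂ) ∘ (chartAt E p).symm) (chartAt E p q)‖ ≤ B) →
      ‖T φ‖ ≤ C * B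

/-- `𝒟'(Ω)`, the continuous dual of `𝒟(Ω)`. -/
structure Distr (Ω : Set M) where
  toLin : TestSpace E Ω →ₗ[ℂ] ℂ
  isDistribution : IsDistribution E toLin

variable {E}

/-- Product of a test function with a function that is smooth on an open neighbourhood of its
support. -/
def mulOn {Ω : Set M} (χ : TestSpace E Ω) {s : Set M} (hs : IsOpen s)
    (hχ : tsupport (χ : M → ℂ) ⊆ s) (g : M → ℂ) (hg : ContMDiffOn 𝓘(ℝ, E) 𝓘(ℝ, ℂ) ∞ g s) :
    TestSpace E Ω :=
  ⟨fun q => (χ : M → ℂ) q * g q, by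
    obtain ⟨h1, h2, h3⟩ := χ.2
    refine ⟨?_, HasCompactSupport.mul_right h2, tsupport_mul_subset_left.trans h3⟩
    refine contMDiff_of_tsupport fun x hx => ?_
    have hx' : x ∈ s := hχ (tsupport_mul_subset_left hx)
    exact contMDiffAt_mul (h1 x) ((hg x hx').contMDiffAt (hs.mem_nhds hx'))⟩

/-- Inclusion `𝒟(Ω) ⊆ 𝒟(Ω')` for `Ω ⊆ Ω'`. -/
def TestSpace.incl {Ω Ω' : Set M} (h : Ω ⊆ Ω') : TestSpace E Ω →ₗ[ℂ] TestSpace E Ω' :=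
  Submodule.inclusion fun _ hφ => ⟨hφ.1, hφ.2.1, hφ.2.2.trans h⟩

end Distributions

/-! ### The cotangent bundle and wave front sets -/

section WaveFront

variable (E : Type*) [NormedAddCommGroup E] [NormedSpace ℝ E]
variable {M : Type*} [TopologicalSpace M] [ChartedSpace E M] [IsManifold 𝓘(ℝ, E) ∞ M]

variable (M) in
/-- The total space of the cotangent bundle `T^* M`, with its vector bundle topology. -/
abbrev Cotangent : Type _ :=
  Bundle.TotalSpace (E →L[ℝ] ℝ)
    (fun p : M => TangentSpace 𝓘(ℝ, E) p →L[ℝ] Bundle.Trivial M ℝ p)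

/-- The coordinates of a covector at `p` in the chart `chartAt E p`. -/
def coordCovector (x : Cotangent E M) : E →L[ℝ] ℝ :=
  ContinuousLinearMap.comp (x.2 : TangentSpace 𝓘(ℝ, E) x.proj →L[ℝ] ℝ)
    (mfderiv 𝓘(ℝ, E) 𝓘(ℝ, E) (chartAt E x.proj).symm (chartAt E x.proj x.proj))

variable {E}

/-- The test function `q ↦ χ(q) exp(-i s ζ(x(q)))`, where `x = chartAt E p` and `χ` is supported in
the domain of this chart. -/
def oscTest {Ω : Set M} (p : M) (χ : TestSpace E Ω)
    (hχ : tsupport (χ : M → ℂ) ⊆ (chartAt E p).source) (ζ : E →L[ℝ] ℝ) (s : ℝ) :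
    TestSpace E Ω :=
  mulOn χ (chartAt E p).open_source hχ
    (fun q => Complex.exp (-Complex.I * ((s * ζ (chartAt E p q) : ℝ) : ℂ))) (by
      have h1 : ContMDiffOn 𝓘(ℝ, E) 𝓘(ℝ, E) ∞ (chartAt E p) (chartAt E p).source :=
        contMDiffOn_chart
      have h2 : ContDiff ℝ ∞
          (fun v : E => Complex.exp (-Complex.I * ((s * ζ v : ℝ) : ℂ))) := by
        have : ContDiff ℝ ∞ (fun v : E => ((s * ζ v : ℝ) : ℂ)) :=
          Complex.ofRealCLM.contDiff.comp (contDiff_const.mul ζ.contDiff)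
        exact (contDiff_const.mul this).cexp
      exact h2.contMDiff.comp_contMDiffOn h1)

/-- `(p; η)` is not in the wave front set: for some cutoff `χ` with `χ(p) ≠ 0`, the Fourier
transform of `χ T` in the chart at `p` is rapidly decreasing in a conic neighbourhood of `η`. -/
def MicrolocallySmoothAt {Ω : Set M} (T : Distr E Ω) (x : Cotangent E M) : Prop :=
  ∃ (χ : TestSpace E Ω) (hχ : tsupport (χ : M → ℂ) ⊆ (chartAt E x.proj).source),
    (χ : M → ℂ) x.proj ≠ 0 ∧
    ∃ Z ∈ 𝓝 (coordCovector E x), ∀ N : ℕ, ∃ C : ℝ, ∀ ζ ∈ Z, ∀ s : ℝ, 1 ≤ s →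
      s ^ N * ‖T.toLin (oscTest x.proj χ hχ ζ s)‖ ≤ C

/-- The wave front set of `T ∈ 𝒟'(Ω)`, a set of nonzero covectors over `Ω`. -/
def WF {Ω : Set M} (T : Distr E Ω) : Set (Cotangent E M) :=
  {x | x.proj ∈ Ω ∧ x.2 ≠ 0 ∧ ¬ MicrolocallySmoothAt T x}

end WaveFront

/-! ### Submanifold, conormal bundle, Euler fields -/

section Geometry

variable {E : Type*} [NormedAddCommGroup E] [NormedSpace ℝ E]
variable {M : Type*} [TopologicalSpace M] [ChartedSpace E M]
variable {E' : Type*} [NormedAddCommGroup E'] [NormedSpace ℝ E']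
variable {Y : Type*} [TopologicalSpace Y] [ChartedSpace E' Y]

/-- `ι : Y → M` is the inclusion of a closed embedded submanifold (namely `I = range ι ≅ Y`). -/
structure IsClosedSubmanifold (ι : Y → M) : Prop where
  embedding : IsSmoothEmbedding 𝓘(ℝ, E') 𝓘(ℝ, E) ∞ ι
  closed : IsClosed (range ι)

/-- `C`: the conormal bundle of `I = range ι` without its zero section. -/
def conormal [IsManifold 𝓘(ℝ, E) ∞ M] (ι : Y → M) : Set (Cotangent E M) :=
  {x | ∃ (y : Y) (η : TangentSpace 𝓘(ℝ, E) (ι y) →L[ℝ] ℝ),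
    η ≠ 0 ∧ (∀ v : TangentSpace 𝓘(ℝ, E') y, η (mfderiv 𝓘(ℝ, E') 𝓘(ℝ, E) ι y v) = 0) ∧
    x = ⟨ι y, η⟩}

/-- `f ∈ 𝓘(U)`: `f` is smooth on `U` and vanishes on `I ∩ U`. -/
def VanishesOn (E : Type*) [NormedAddCommGroup E] [NormedSpace ℝ E] [ChartedSpace E M]
    (I U : Set M) (f : M → ℝ) : Prop :=
  ContMDiffOn 𝓘(ℝ, E) 𝓘(ℝ, ℝ) ∞ f U ∧ ∀ p ∈ I ∩ U, f p = 0

/-- Membership of `f|_U` in the square of the ideal `𝓘(U)`: on `U`, `f` is a finite sum of products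
of two elements of `𝓘(U)`. -/
def InIdealSq (E : Type*) [NormedAddCommGroup E] [NormedSpace ℝ E] [ChartedSpace E M]
    (I U : Set M) (f : M → ℝ) : Prop :=
  ∃ (N : ℕ) (a b : Fin N → M → ℝ), (∀ i, VanishesOn E I U (a i)) ∧ (∀ i, VanishesOn E I U (b i)) ∧
    ∀ p ∈ U, f p = ∑ i, a i p * b i p

/-- The derivative `X f` of a real function along a vector field. -/
def realDeriv (X : ∀ p : M, TangentSpace 𝓘(ℝ, E) p) (f : M → ℝ) : M → ℝ :=
  fun p => mfderiv 𝓘(ℝ, E) 𝓘(ℝ, ℝ) f p (X p)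

/-- Smoothness on `U` of a vector field. -/
def SmoothField (U : Set M) [IsManifold 𝓘(ℝ, E) ∞ M]
    (X : ∀ p : M, TangentSpace 𝓘(ℝ, E) p) : Prop :=
  ContMDiffOn 𝓘(ℝ, E) (𝓘(ℝ, E)).tangent ∞
    (fun p => (⟨p, X p⟩ : TangentBundle 𝓘(ℝ, E) M)) U

/-- `ρ` is a (smooth) Euler vector field for `I` on the open set `U`:
`ρ f - f ∈ 𝓘²(U)` for all `f ∈ 𝓘(U)`. -/
def IsEuler [IsManifold 𝓘(ℝ, E) ∞ M] (I U : Set M)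
    (ρ : ∀ p : M, TangentSpace 𝓘(ℝ, E) p) : Prop :=
  SmoothField U ρ ∧ ∀ f : M → ℝ, VanishesOn E I U f →
    InIdealSq E I U (fun p => realDeriv ρ f p - f p)

/-- `e^{-sρ}(p)` stays in `U` for all `s ≥ 0` and tends to `z` as `s → ∞`. -/
def FlowsTo (U : Set M) (ρ : ∀ p : M, TangentSpace 𝓘(ℝ, E) p) (p z : M) : Prop :=
  ∃ γ : ℝ → M, γ 0 = p ∧ (∀ s, 0 ≤ s → γ s ∈ U) ∧
    IsMIntegralCurveOn γ (fun q => -ρ q) (Ici 0) ∧ Tendsto γ atTop (𝓝 z)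

/-- The points whose backward `ρ`-flow line in `U` ends at a point of `I`. -/
def basin (I U : Set M) (ρ : ∀ p : M, TangentSpace 𝓘(ℝ, E) p) : Set M :=
  {p | ∃ z ∈ I, FlowsTo U ρ p z}

open Classical in
/-- `i ∘ π^ρ`, where `π^ρ(p) = lim_{s → ∞} e^{-sρ}(p) ∈ I` for `p` in the basin of `I`
(outside of the basin the value is irrelevant). -/
def eulerProj (I U : Set M) (ρ : ∀ p : M, TangentSpace 𝓘(ℝ, E) p) (p : M) : M :=
  if h : ∃ z ∈ I, FlowsTo U ρ p z then h.choose else p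

/-- A system of transverse coordinate functions `h^1, …, h^d` on the open set `W`: smooth functions
vanishing on `I ∩ W`, with the transverse coordinate vector fields `∂_{h^j}`, which commute and
satisfy `∂_{h^j} h^k = δ_{jk}`. -/
structure TransverseSystem (E : Type*) [NormedAddCommGroup E] [NormedSpace ℝ E]
    [ChartedSpace E M] [IsManifold 𝓘(ℝ, E) ∞ M] (I W : Set M) (d : ℕ) where
  isOpen : IsOpen W
  h : Fin d → M → ℝ
  field : Fin d → ∀ p : M, TangentSpace 𝓘(ℝ, E) p
  h_mem : ∀ j, VanishesOn E I W (h j)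
  field_smooth : ∀ j, SmoothField W (field j)
  dual : ∀ p ∈ W, ∀ j k, realDeriv (field j) (h k) p = if j = k then 1 else 0
  comm : ∀ p ∈ W, ∀ j k, VectorField.mlieBracket 𝓘(ℝ, E) (field j) (field k) p = 0

/-- The derivative `X f` of a complex function along a vector field. -/
def dirDeriv (X : ∀ p : M, TangentSpace 𝓘(ℝ, E) p) (f : M → ℂ) : M → ℂ :=
  fun p => mfderiv 𝓘(ℝ, E) 𝓘(ℝ, ℂ) f p (X p)

/-- `∂_1^{α_1} ⋯ ∂_d^{α_d}`, for operators `∂_j` on a space `A`. -/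
def multiIter {A : Type*} {d : ℕ} (D : Fin d → A → A) (α : Fin d → ℕ) (a : A) : A :=
  (List.finRange d).foldr (fun j b => (D j)^[α j] b) a

/-- The vector field `X`, smooth on the open set `W`, acts on `𝒟(W)`. -/
def derivTest [IsManifold 𝓘(ℝ, E) ∞ M] {W : Set M} (hW : IsOpen W)
    (X : ∀ p : M, TangentSpace 𝓘(ℝ, E) p) (hX : SmoothField W X) :
    TestSpace E W →ₗ[ℂ] TestSpace E W where
  toFun φ := ⟨dirDeriv X φ, by
    obtain ⟨φ, h1, h2, h3⟩ := φ
    have hsupp : tsupport (dirDeriv X φ) ⊆ tsupport φ := by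
      refine closure_minimal (fun p hp => ?_) (isClosed_tsupport φ)
      by_contra hn
      refine hp ?_
      have h0 : φ =ᶠ[𝓝 p] fun _ => (0 : ℂ) := notMem_tsupport_iff_eventuallyEq.1 hn
      simp only [dirDeriv]
      rw [h0.mfderiv_eq, mfderiv_const]
      rfl
    refine ⟨?_, h2.mono' ((subset_tsupport _).trans hsupp), hsupp.trans h3⟩
    refine contMDiff_of_tsupport fun x hx => ?_
    have hxW : x ∈ W := h3 (hsupp hx)
    have k1 : ContMDiff (𝓘(ℝ, E)).tangent (𝓘(ℝ, ℂ)).tangent ∞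
        (tangentMap 𝓘(ℝ, E) 𝓘(ℝ, ℂ) φ) := h1.contMDiff_tangentMap (by simp)
    have k2 := k1.comp_contMDiffOn hX
    have k3 := contMDiff_snd_tangentBundle_modelSpace ℂ 𝓘(ℝ, ℂ) (n := ∞)
    have k4 := k3.comp_contMDiffOn k2
    exact (k4 x hxW).contMDiffAt (hW.mem_nhds hxW)⟩
  map_add' φ ψ := by
    ext p
    have a : MDifferentiableAt 𝓘(ℝ, E) 𝓘(ℝ, ℂ) (φ : M → ℂ) p :=
      φ.2.1.mdifferentiableAt (by simp)
    have b : MDifferentiableAt 𝓘(ℝ, E) 𝓘(ℝ, ℂ) (ψ : M → ℂ) p :=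
      ψ.2.1.mdifferentiableAt (by simp)
    have := mfderiv_add a b
    simp only [dirDeriv, Submodule.coe_add, Pi.add_apply]
    rw [this]
    rfl
  map_smul' c φ := by
    ext p
    have a : MDifferentiableAt 𝓘(ℝ, E) 𝓘(ℝ, ℂ) (φ : M → ℂ) p :=
      φ.2.1.mdifferentiableAt (by simp)
    have hL : HasMFDerivAt 𝓘(ℝ, ℂ) 𝓘(ℝ, ℂ) (fun z : ℂ => c * z) ((φ : M → ℂ) p)
        (ContinuousLinearMap.mul ℝ ℂ c) :=
      (ContinuousLinearMap.mul ℝ ℂ c).hasFDerivAt.hasMFDerivAt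
    have := (hL.comp p a.hasMFDerivAt).mfderiv
    have e : ((c • φ : TestSpace E W) : M → ℂ) = (fun z : ℂ => c * z) ∘ (φ : M → ℂ) := rfl
    simp only [dirDeriv]
    rw [e, this]
    rfl

/-- `∂_{h^j}` on (functionals on) `𝒟(W)`: `⟨∂_{h^j} T, φ⟩ = -⟨T, ∂_{h^j} φ⟩`. -/
def TransverseSystem.derivDistr [IsManifold 𝓘(ℝ, E) ∞ M] {I W : Set M} {d : ℕ}
    (H : TransverseSystem E I W d) (j : Fin d) (T : TestSpace E W →ₗ[ℂ] ℂ) :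
    TestSpace E W →ₗ[ℂ] ℂ :=
  -(T ∘ₗ derivTest H.isOpen (H.field j) (H.field_smooth j))

/-- Restriction `φ ↦ φ ∘ ι` of test functions to the submanifold. -/
def pullTest {ι : Y → M} (hι : IsClosedSubmanifold (E := E) (E' := E') ι) (W : Set M) :
    TestSpace E W →ₗ[ℂ] TestSpace E' (ι ⁻¹' W) where
  toFun φ := ⟨(φ : M → ℂ) ∘ ι, by
    obtain ⟨φ, h1, h2, h3⟩ := φ
    have hc : IsClosedEmbedding ι := ⟨hι.embedding.isEmbedding, hι.closed⟩
    refine ⟨h1.comp hι.embedding.contMDiff, h2.comp_isClosedEmbedding hc, ?_⟩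
    exact (tsupport_comp_subset_preimage φ hc.continuous).trans (preimage_mono h3)⟩
  map_add' _ _ := rfl
  map_smul' _ _ := rfl

/-- Push-forward `⟨ι_* S, φ⟩ = ⟨S, φ ∘ ι⟩`. -/
def pushDistr {ι : Y → M} (hι : IsClosedSubmanifold (E := E) (E' := E') ι) (W : Set M)
    (S : Distr E' (ι ⁻¹' W)) : TestSpace E W →ₗ[ℂ] ℂ :=
  S.toLin ∘ₗ pullTest hι W

/-- The supports of the distributions `S_α ∈ 𝒟'(Ω)` form a locally finite family in `Ω`. -/
def LocallyFiniteSupports {Ω : Set Y} {A : Type*} (S : A → Distr E' Ω) : Prop :=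
  ∀ y ∈ Ω, ∃ N ∈ 𝓝 y,
    {α | ∃ θ : TestSpace E' Ω, tsupport (θ : Y → ℂ) ⊆ N ∧ (S α).toLin θ ≠ 0}.Finite

/-- `τ = ∑_α ∂_h^α (ι_* S_α)` on `W`, for a family `S` with locally finite supports (for every test
function only finitely many terms are nonzero). -/
def IsTransverseExpansion [IsManifold 𝓘(ℝ, E) ∞ M] {ι : Y → M}
    (hι : IsClosedSubmanifold (E := E) (E' := E') ι)
    {W : Set M} {d : ℕ} (H : TransverseSystem E (range ι) W d) (τ : Distr E (univ : Set M))
    (S : (Fin d → ℕ) → Distr E' (ι ⁻¹' W)) : Prop :=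
  LocallyFiniteSupports S ∧ ∀ φ : TestSpace E W,
    τ.toLin (TestSpace.incl (subset_univ W) φ) =
      ∑ᶠ α : Fin d → ℕ, multiIter H.derivDistr α (pushDistr hι W (S α)) φ

end Geometry

/-- `μ` is a smooth positive density on `Y`: in each chart it has a smooth positive density with
respect to Lebesgue measure. -/
def IsSmoothPositiveDensity (n : ℕ) {Y : Type*} [TopologicalSpace Y]
    [ChartedSpace (EuclideanSpace ℝ (Fin n)) Y] [MeasurableSpace Y] (μ : Measure Y) : Prop :=
  ∀ y : Y, ∃ w : EuclideanSpace ℝ (Fin n) → ℝ,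
    ContDiffOn ℝ ∞ w (chartAt (EuclideanSpace ℝ (Fin n)) y).target ∧
    (∀ x ∈ (chartAt (EuclideanSpace ℝ (Fin n)) y).target, 0 < w x) ∧
    Measure.map (chartAt (EuclideanSpace ℝ (Fin n)) y)
        (μ.restrict (chartAt (EuclideanSpace ℝ (Fin n)) y).source) =
      (volume.restrict (chartAt (EuclideanSpace ℝ (Fin n)) y).target).withDensity
        (fun x => ENNReal.ofReal (w x))

/-- `S ∈ 𝒟'(Ω)` is a smooth function: `⟨S, θ⟩ = ∫ f θ dμ` for some `f ∈ C^∞(Ω)`. -/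
def IsSmoothDistr {E : Type*} [NormedAddCommGroup E] [NormedSpace ℝ E] {Y : Type*}
    [TopologicalSpace Y] [ChartedSpace E Y] [MeasurableSpace Y] (μ : Measure Y) {Ω : Set Y}
    (S : Distr E Ω) : Prop :=
  ∃ f : Y → ℂ, ContMDiffOn 𝓘(ℝ, E) 𝓘(ℝ, ℂ) ∞ f Ω ∧
    ∀ θ : TestSpace E Ω, S.toLin θ = ∫ y, f y * (θ : Y → ℂ) y ∂μ

end Counterterms

end

open Counterterms

/-!
The counterterm is the transverse derivative of a smooth density on the submanifold `I = range ι`,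
and all its properties follow from this. With `P` the projection `π^ρ`, regarded as a map to the
abstract manifold `Y`, and `κ` a cutoff equal to `1` on `P (supp ψ)`,
`⟨τ, φ⟩ = ⟨P_* (t ψ), κ · (∂_h^α φ) ∘ ι⟩`, where the push-forward `P_* (t ψ)` is a distribution
on `Y`. It is smooth, because a covector `ζ ∘ dP_p`, `ζ ≠ 0`, is not in the wave front set of `t`
when `p` is close to `I`. So `⟨τ, φ⟩ = ∫ f · (∂_h^α φ) ∘ ι dμ` with `f` smooth.

*The projection* (`IsEuler.exists_smooth_projection`). In coordinates `(x, h)` with `I = {h = 0}`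
the Euler condition for the functions `h^j` and `x^i h^j` shows that
`ρ = A(x,h)h ∂_x + (h + B(x,h)hh) ∂_h` (`IsEuler.exists_normal_form`). Substituting `h = λ k` with
`λ = e^{-s}` turns the backward flow into the regular equation `x' = A(x,λk)k`, `k' = B(x,λk)kk` on
`0 ≤ λ ≤ 1`, and `P` is its solution at `λ = 0`. Smooth dependence on the initial value is obtained
from the inverse function theorem in `C([0,1])` (`exists_smooth_solutions`), where the linearized
operator is invertible because it differs from the identity by an operator of square zero.

*The push-forward* (`exists_smooth_density_pullMul`). If `t` is localized to a chart, its Fourier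
transform decays rapidly in the directions near `ζ ∘ dP_p`; Fourier inversion and nonstationary
phase transfer this decay to `⟨t, g e^{-is ζ ∘ P}⟩`, uniformly in the unit covector `ζ`. This bounds
the Fourier transform of the push-forward, which is therefore smooth. The covectors `ζ ∘ dP_p` are
not conormal to `I` at points `p` of `I`, as `P ∘ ι = id`; by compactness of the unit sphere and
closedness of the closure of the wave front set they avoid it on a neighbourhood of `I`
(`exists_nhds_microlocallySmoothAt`), which is the set `V` of the theorem.

*The wave front set and the expansion* (`exists_layer_distr`). The density `φ ↦ ∫ g (φ ∘ ι) dμ` has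
wave front set in the conormal bundle by nonstationary phase on `Y`, and a vector field does not
enlarge the wave front set. The transverse expansion of `τ` has the single layer
`(-1)^|α| f`. Uniqueness of the layers (`IsTransverseExpansion.unique`) follows by testing
with `h^γ · (θ ∘ P)` times a cutoff, by downward induction on `|γ|`.
-/

set_option linter.unusedSectionVars false

noncomputable section

namespace Counterterms

/-! ### Cutoff functions and extension of smooth functions -/

section Cutoff

variable {E : Type*} [NormedAddCommGroup E] [NormedSpace ℝ E] [FiniteDimensional ℝ E]
variable {M : Type*} [TopologicalSpace M] [T2Space M] [SigmaCompactSpace M] [ChartedSpace E M]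
  [IsManifold 𝓘(ℝ, E) ∞ M]

theorem exists_smooth_cutoff {K O : Set M} (hK : IsCompact K) (hO : IsOpen O) (hKO : K ⊆ O) :
    ∃ χ : M → ℝ, ContMDiff 𝓘(ℝ, E) 𝓘(ℝ, ℝ) ∞ χ ∧ HasCompactSupport χ ∧ tsupport χ ⊆ O ∧
      ∀ᶠ x in 𝓝ˢ K, χ x = 1 := by
  have : LocallyCompactSpace M := ChartedSpace.locallyCompactSpace E M
  obtain ⟨L, hL, hKL, hLO⟩ := exists_compact_between hK hO hKO
  obtain ⟨χ, h1, h2, -⟩ := exists_contMDiffMap_one_nhds_of_subset_interior (n := ⊤) 𝓘(ℝ, E)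
    hK.isClosed hKL
  have hsub : tsupport χ ⊆ L := closure_minimal
    (fun x hx => by by_contra hn; exact hx (h2 x hn)) hL.isClosed
  exact ⟨χ, χ.contMDiff, hL.of_isClosed_subset (isClosed_tsupport _) hsub, hsub.trans hLO, h1⟩

end Cutoff

section Extension

variable {E : Type*} [NormedAddCommGroup E] [NormedSpace ℝ E] [FiniteDimensional ℝ E]
variable {F : Type*} [NormedAddCommGroup F] [NormedSpace ℝ F]

theorem exists_contDiff_cutoff {K O : Set E} (hK : IsCompact K) (hO : IsOpen O) (hKO : K ⊆ O) :
    ∃ χ : E → ℝ, ContDiff ℝ ∞ χ ∧ HasCompactSupport χ ∧ tsupport χ ⊆ O ∧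
      ∀ᶠ x in 𝓝ˢ K, χ x = 1 := by
  obtain ⟨χ, h1, h2⟩ := exists_smooth_cutoff (E := E) hK hO hKO
  exact ⟨χ, h1.contDiff, h2⟩

/-- A product with a factor supported where the other one is smooth is smooth. -/
theorem contDiff_smul_of_tsupport {χ : E → ℝ} {f : E → F} {O : Set E} (hO : IsOpen O)
    (hχ : ContDiff ℝ ∞ χ) (hs : tsupport χ ⊆ O) (hf : ContDiffOn ℝ ∞ f O) :
    ContDiff ℝ ∞ fun x => χ x • f x := by
  rw [← contMDiff_iff_contDiff]
  refine contMDiff_of_tsupport fun x hx => ContDiffAt.contMDiffAt ?_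
  have hx' : x ∈ O := hs (tsupport_smul_subset_left χ f hx)
  exact hχ.contDiffAt.smul (hf.contDiffAt (hO.mem_nhds hx'))

theorem exists_contDiff_extension {f : E → F} {K O : Set E} (hK : IsCompact K) (hO : IsOpen O)
    (hKO : K ⊆ O) (hf : ContDiffOn ℝ ∞ f O) :
    ∃ g : E → F, ContDiff ℝ ∞ g ∧ ∀ᶠ x in 𝓝ˢ K, g x = f x := by
  obtain ⟨χ, h1, -, h3, h4⟩ := exists_contDiff_cutoff hK hO hKO
  refine ⟨fun x => χ x • f x, contDiff_smul_of_tsupport hO h1 h3 hf, ?_⟩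
  filter_upwards [h4] with x hx
  rw [hx, one_smul]

end Extension

/-! ### Nonstationary phase with parameters -/

section NonstationaryPhase

variable {P : Type*} [NormedAddCommGroup P] [NormedSpace ℝ P] [FiniteDimensional ℝ P]
variable {E : Type*} [NormedAddCommGroup E] [NormedSpace ℝ E] [FiniteDimensional ℝ E]
  [MeasurableSpace E] [BorelSpace E]

/-- Coordinates of a vector field of unit speed along the phase gradient, jointly smooth in the
parameter and the variable. -/
theorem exists_unit_speed_field {f : P × E → ℝ} (hf : ContDiff ℝ ∞ f) {Kp : Set P} {S : Set E}
    (hKp : IsCompact Kp) (hS : IsCompact S)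
    (hd : ∀ p ∈ Kp, ∀ x ∈ S, ∃ v : E, fderiv ℝ f (p, x) (0, v) ≠ 0) :
    ∃ b : Fin (Module.finrank ℝ E) → P × E → ℝ, (∀ j, ContDiff ℝ ∞ (b j)) ∧
      ∀ p ∈ Kp, ∀ x ∈ S,
        ∑ j, b j (p, x) * fderiv ℝ f (p, x) (0, Module.finBasis ℝ E j) = 1 := by
  set e := Module.finBasis ℝ E
  let c : Fin (Module.finrank ℝ E) → P × E → ℝ := fun j z => fderiv ℝ f z (0, e j)
  have hc : ∀ j, ContDiff ℝ ∞ (c j) := fun j =>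
    (hf.fderiv_right (by simp)).clm_apply contDiff_const
  -- The field `c / |c|²`, where `c` is the gradient of the phase in the basis `e`.
  let q : P × E → ℝ := fun z => ∑ i, c i z ^ 2
  have hq : ContDiff ℝ ∞ q := ContDiff.sum fun i _ => (hc i).pow 2
  have hqpos : ∀ z ∈ Kp ×ˢ S, q z ≠ 0 := by
    rintro ⟨p, x⟩ ⟨hp, hx⟩ h0
    obtain ⟨v, hv⟩ := hd p hp x hx
    have h0' := (Finset.sum_eq_zero_iff_of_nonneg (fun i _ => sq_nonneg (c i (p, x)))).1 h0
    apply hv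
    have : ((0, v) : P × E) = ∑ i, e.repr v i • ((0, e i) : P × E) := by
      have h := e.sum_repr v
      refine Prod.ext ?_ ?_
      · simp [Prod.fst_sum]
      · simp [Prod.snd_sum, h]
    rw [this, map_sum]
    refine Finset.sum_eq_zero fun i _ => ?_
    rw [map_smul, show fderiv ℝ f (p, x) (0, e i) = 0 from pow_eq_zero_iff (two_ne_zero) |>.1
      (h0' i (Finset.mem_univ i)), smul_zero]
  have hO : IsOpen {z | q z ≠ 0} := isOpen_ne_fun hq.continuous continuous_const
  have key : ∀ j, ∃ g : P × E → ℝ, ContDiff ℝ ∞ g ∧ ∀ᶠ z in 𝓝ˢ (Kp ×ˢ S), g z = c j z / q z :=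
    fun j => exists_contDiff_extension (hKp.prod hS) hO hqpos
      ((hc j).contDiffOn.div hq.contDiffOn fun z hz => hz)
  choose b hb1 hb2 using key
  refine ⟨b, hb1, fun p hp x hx => ?_⟩
  have hz : (p, x) ∈ Kp ×ˢ S := ⟨hp, hx⟩
  have : ∀ j, b j (p, x) * fderiv ℝ f (p, x) (0, e j) = c j (p, x) ^ 2 / q (p, x) := fun j => by
    rw [(hb2 j).self_of_nhdsSet _ hz]
    change c j (p, x) / q (p, x) * c j (p, x) = _
    ring
  rw [Finset.sum_congr rfl fun j _ => this j, ← Finset.sum_div]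
  exact div_self (hqpos _ hz)

theorem hasFDerivAt_slice {G : Type*} [NormedAddCommGroup G] [NormedSpace ℝ G] {f : P × E → G}
    (hf : ContDiff ℝ ∞ f) (p : P) (x : E) :
    HasFDerivAt (fun y => f (p, y)) ((fderiv ℝ f (p, x)).comp (ContinuousLinearMap.inr ℝ P E)) x :=
  ((hf.differentiable (by simp)) (p, x)).hasFDerivAt.comp x (hasFDerivAt_prodMk_right p x)

theorem integrable_of_contDiff_of_eq_zero {G : Type*} [NormedAddCommGroup G] {μ : Measure E}
    [IsFiniteMeasureOnCompacts μ] {S : Set E} (hS : IsCompact S) {g : E → G} (hg : Continuous g)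
    (h0 : ∀ x, x ∉ S → g x = 0) : Integrable g μ :=
  hg.integrable_of_hasCompactSupport (HasCompactSupport.intro hS h0)

/-- Oscillatory integrals with a phase that is nowhere stationary on the support of the amplitude
decrease rapidly, uniformly in the parameter: one integrates by parts along a vector field of unit
speed for the phase, which maps amplitudes to amplitudes. -/
theorem nonstationary_phase (μ : Measure E) [μ.IsAddHaarMeasure] {f : P × E → ℝ}
    (hf : ContDiff ℝ ∞ f) {Kp : Set P} {S : Set E} (hKp : IsCompact Kp) (hS : IsCompact S)
    (hd : ∀ p ∈ Kp, ∀ x ∈ S, ∃ v : E, fderiv ℝ f (p, x) (0, v) ≠ 0) (K : ℕ) :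
    ∀ a : P × E → ℂ, ContDiff ℝ ∞ a → (∀ p x, x ∉ S → a (p, x) = 0) →
      ∃ C : ℝ, ∀ p ∈ Kp, ∀ r : ℝ, 0 < r →
        r ^ K * ‖∫ x, a (p, x) * Complex.exp (-Complex.I * ((r * f (p, x) : ℝ) : ℂ)) ∂μ‖ ≤ C := by
  obtain ⟨b, hb, hb1⟩ := exists_unit_speed_field hf hKp hS hd
  set e := Module.finBasis ℝ E
  have hexp : ∀ z : ℝ, ‖Complex.exp (-Complex.I * (z : ℂ))‖ = 1 := fun z => by
    rw [show -Complex.I * (z : ℂ) = ((-z : ℝ) : ℂ) * Complex.I by push_cast; ring]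
    exact Complex.norm_exp_ofReal_mul_I _
  induction K with
  | zero =>
    intro a ha h0
    obtain ⟨A, hA⟩ := (hKp.prod hS).exists_bound_of_continuousOn ha.continuous.continuousOn
    refine ⟨A * μ.real S, fun p hp r hr => ?_⟩
    rw [pow_zero, one_mul, ← setIntegral_eq_integral_of_forall_compl_eq_zero (s := S)
      (fun x hx => by rw [h0 p x hx, zero_mul])]
    refine norm_setIntegral_le_of_norm_le_const hS.measure_lt_top fun x hx => ?_
    rw [norm_mul, hexp, mul_one]
    exact hA (p, x) ⟨hp, hx⟩
  | succ K ih =>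
    intro a ha h0
    -- With `a' = ∑ ∂_j (b_j a)` one has `i r ∫ a e^{-irf} = ∫ a' e^{-irf}`.
    let g : Fin (Module.finrank ℝ E) → P × E → ℂ := fun j z => a z * (b j z : ℂ)
    have hg : ∀ j, ContDiff ℝ ∞ (g j) := fun j =>
      ha.mul (Complex.ofRealCLM.contDiff.comp (hb j))
    have hg0 : ∀ j p x, x ∉ S → g j (p, x) = 0 := fun j p x hx => by
      simp only [g, h0 p x hx, zero_mul]
    let a' : P × E → ℂ := fun z => ∑ j, fderiv ℝ (g j) z (0, e j)
    have hdg : ∀ j, ContDiff ℝ ∞ (fun z => fderiv ℝ (g j) z (0, e j)) := fun j =>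
      ((hg j).fderiv_right (by simp)).clm_apply contDiff_const
    have hdg0 : ∀ j p x, x ∉ S → fderiv ℝ (g j) (p, x) (0, e j) = 0 := fun j p x hx => by
      have : g j =ᶠ[𝓝 (p, x)] fun _ => 0 := by
        have hO : IsOpen {z : P × E | z.2 ∉ S} := hS.isClosed.isOpen_compl.preimage continuous_snd
        filter_upwards [hO.mem_nhds hx] with z hz using hg0 j z.1 z.2 hz
      rw [this.fderiv_eq]
      simp
    have ha' : ContDiff ℝ ∞ a' := ContDiff.sum fun j _ => hdg j
    have ha'0 : ∀ p x, x ∉ S → a' (p, x) = 0 := fun p x hx =>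
      Finset.sum_eq_zero fun j _ => hdg0 j p x hx
    obtain ⟨C, hC⟩ := ih a' ha' ha'0
    refine ⟨C, fun p hp r hr => ?_⟩
    let h : E → ℂ := fun x => Complex.exp (-Complex.I * ((r * f (p, x) : ℝ) : ℂ))
    have hfp : ContDiff ℝ ∞ (fun x => f (p, x)) := hf.comp (contDiff_prodMk_right p)
    have hh : ContDiff ℝ ∞ h :=
      (contDiff_const.mul (Complex.ofRealCLM.contDiff.comp (contDiff_const.mul hfp))).cexp
    have hgp : ∀ j, ContDiff ℝ ∞ (fun x => g j (p, x)) := fun j =>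
      (hg j).comp (contDiff_prodMk_right p)
    have hdh : ∀ x v, fderiv ℝ h x v = -Complex.I * r * (fderiv ℝ f (p, x) (0, v) : ℂ) * h x := by
      intro x v
      have h1 := (hasFDerivAt_slice hf p x).const_mul r
      have h2 := (Complex.ofRealCLM.hasFDerivAt.comp x h1).const_mul (-Complex.I)
      have h3 := h2.cexp
      rw [show fderiv ℝ h x = _ from h3.fderiv]
      simp [h]
      ring
    have hdgp : ∀ j x, fderiv ℝ (fun x => g j (p, x)) x (e j) = fderiv ℝ (g j) (p, x) (0, e j) :=
      fun j x => by rw [(hasFDerivAt_slice (hg j) p x).fderiv]; simp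
    have hint1 : ∀ j, Integrable (fun x => g j (p, x) * fderiv ℝ h x (e j)) μ := fun j =>
      integrable_of_contDiff_of_eq_zero hS ((hgp j).continuous.mul
        ((hh.continuous_fderiv (by simp)).clm_apply continuous_const))
        fun x hx => by rw [hg0 j p x hx, zero_mul]
    have hint2 : ∀ j, Integrable (fun x => fderiv ℝ (g j) (p, x) (0, e j) * h x) μ := fun j =>
      integrable_of_contDiff_of_eq_zero hS
        (((hdg j).continuous.comp (Continuous.prodMk_right p)).mul hh.continuous)
        fun x hx => by rw [hdg0 j p x hx, zero_mul]
    have hparts : ∀ j, ∫ x, g j (p, x) * fderiv ℝ h x (e j) ∂μ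
        = - ∫ x, fderiv ℝ (g j) (p, x) (0, e j) * h x ∂μ := fun j => by
      rw [integral_mul_fderiv_eq_neg_fderiv_mul_of_integrable (μ := μ)
        (f := fun x => g j (p, x)) (g := h) (v := e j)
        (by simpa only [hdgp] using hint2 j) (hint1 j)
        (integrable_of_contDiff_of_eq_zero hS ((hgp j).continuous.mul hh.continuous)
          fun x hx => by rw [hg0 j p x hx, zero_mul])
        (fun x _ => (hgp j).differentiable (by simp) x) (fun x _ => hh.differentiable (by simp) x)]
      simp only [hdgp]
    have hkey : (Complex.I * r) * ∫ x, a (p, x) * h x ∂μ = ∫ x, a' (p, x) * h x ∂μ := by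
      have e1 : ∫ x, a' (p, x) * h x ∂μ = ∑ j, ∫ x, fderiv ℝ (g j) (p, x) (0, e j) * h x ∂μ := by
        rw [← integral_finsetSum _ fun j _ => hint2 j]
        simp only [a', Finset.sum_mul]
      have e2 : ∀ x, -(Complex.I * r) * (a (p, x) * h x)
          = ∑ j, g j (p, x) * fderiv ℝ h x (e j) := by
        intro x
        by_cases hx : x ∈ S
        · have hone := congrArg (fun y : ℝ => (y : ℂ)) (hb1 p hp x hx)
          push_cast at hone
          simp only [hdh, g]
          calc -(Complex.I * r) * (a (p, x) * h x)
              = -(Complex.I * r) * (a (p, x) * h x) *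
                ∑ j, (b j (p, x) : ℂ) * (fderiv ℝ f (p, x) (0, e j) : ℂ) := by rw [hone, mul_one]
            _ = _ := by
                rw [Finset.mul_sum]
                refine Finset.sum_congr rfl fun j _ => ?_
                ring
        · simp [g, h0 p x hx]
      have e3 : -(Complex.I * r) * ∫ x, a (p, x) * h x ∂μ
          = - ∫ x, a' (p, x) * h x ∂μ := by
        rw [← integral_const_mul, integral_congr_ae (ae_of_all _ e2),
          integral_finsetSum _ fun j _ => hint1 j, Finset.sum_congr rfl fun j _ => hparts j,
          Finset.sum_neg_distrib, e1]
      linear_combination -e3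
    have hnorm : r * ‖∫ x, a (p, x) * h x ∂μ‖ = ‖∫ x, a' (p, x) * h x ∂μ‖ := by
      rw [← hkey, norm_mul, norm_mul, Complex.norm_I, one_mul, Complex.norm_real,
        Real.norm_of_nonneg hr.le]
    calc r ^ (K + 1) * ‖∫ x, a (p, x) * h x ∂μ‖
        = r ^ K * (r * ‖∫ x, a (p, x) * h x ∂μ‖) := by ring
      _ = r ^ K * ‖∫ x, a' (p, x) * h x ∂μ‖ := by rw [hnorm]
      _ ≤ C := hC p hp r hr

end NonstationaryPhase

/-! ### Compactly supported distributions on a vector space and their Fourier representation -/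

section CompactSupport

variable {E : Type*} [NormedAddCommGroup E] [NormedSpace ℝ E]

variable (E) in
/-- The space `C^∞(E; ℂ)`. -/
def SmoothFn : Submodule ℂ (E → ℂ) where
  carrier := {φ | ContDiff ℝ ∞ φ}
  add_mem' := fun {f g} (h1 : ContDiff ℝ ∞ f) (h2 : ContDiff ℝ ∞ g) => h1.add h2
  zero_mem' := (contDiff_const : ContDiff ℝ ∞ fun _ : E => (0 : ℂ))
  smul_mem' := fun c f (h : ContDiff ℝ ∞ f) => h.const_smul c

theorem SmoothFn.contDiff (φ : SmoothFn E) : ContDiff ℝ ∞ (φ : E → ℂ) := φ.2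

/-- A functional on `C^∞(E; ℂ)` is a distribution of compact support if it is bounded by finitely
many derivatives on a compact set. -/
def IsCompactDistr (L : SmoothFn E →ₗ[ℂ] ℂ) : Prop :=
  ∃ (K : Set E) (k : ℕ) (C : ℝ), IsCompact K ∧ ∀ (φ : SmoothFn E) (B : ℝ),
    (∀ j ≤ k, ∀ x ∈ K, ‖iteratedFDeriv ℝ j (φ : E → ℂ) x‖ ≤ B) → ‖L φ‖ ≤ C * B

/-- The plane wave `x ↦ exp(-i ζ(x))`. -/
def planeWave (ζ : E →L[ℝ] ℝ) : SmoothFn E :=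
  ⟨fun x => Complex.exp (-Complex.I * ((ζ x : ℝ) : ℂ)), by
    have : ContDiff ℝ ∞ (fun x : E => ((ζ x : ℝ) : ℂ)) := Complex.ofRealCLM.contDiff.comp ζ.contDiff
    exact (contDiff_const.mul this).cexp⟩

variable (E) in
/-- The Banach space of families `(u_j)`, `j ≤ k`, of continuous functions on the compact set `K`,
where `u_j` has values in the `j`-linear forms. -/
def JetSpace (K : Set E) (k : ℕ) : Type _ := (j : Fin (k + 1)) → C(K, E [×(j : ℕ)]→L[ℝ] ℂ)

instance (K : Set E) [CompactSpace K] (k : ℕ) : NormedAddCommGroup (JetSpace E K k) :=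
  inferInstanceAs (NormedAddCommGroup ((j : Fin (k + 1)) → C(K, E [×(j : ℕ)]→L[ℝ] ℂ)))

instance (K : Set E) [CompactSpace K] (k : ℕ) : NormedSpace ℂ (JetSpace E K k) :=
  inferInstanceAs (NormedSpace ℂ ((j : Fin (k + 1)) → C(K, E [×(j : ℕ)]→L[ℝ] ℂ)))

instance (K : Set E) [CompactSpace K] (k : ℕ) : CompleteSpace (JetSpace E K k) :=
  inferInstanceAs (CompleteSpace ((j : Fin (k + 1)) → C(K, E [×(j : ℕ)]→L[ℝ] ℂ)))

/-- The value at `x` of the component of order `j` of a jet. -/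
def JetSpace.eval {K : Set E} [CompactSpace K] {k : ℕ} (j : Fin (k + 1)) (x : K) :
    JetSpace E K k →L[ℝ] (E [×(j : ℕ)]→L[ℝ] ℂ) :=
  LinearMap.mkContinuous
    { toFun := fun u => u j x
      map_add' := fun _ _ => rfl
      map_smul' := fun _ _ => rfl } 1 fun u => by
        rw [one_mul]
        exact ((u j).norm_coe_le_norm x).trans
          (norm_le_pi_norm (G := fun j : Fin (k + 1) => C(K, E [×(j : ℕ)]→L[ℝ] ℂ)) u j)

/-- The restriction to a compact set of the derivatives of order at most `k`. -/
def jet (K : Set E) [CompactSpace K] (k : ℕ) : SmoothFn E →ₗ[ℂ] JetSpace E K k where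
  toFun φ := fun j : Fin (k + 1) => ⟨fun x => iteratedFDeriv ℝ j (φ : E → ℂ) x,
    ((SmoothFn.contDiff φ).continuous_iteratedFDeriv (m := (j : ℕ)) (by exact_mod_cast le_top)).comp
      continuous_subtype_val⟩
  map_add' φ ψ := by
    refine funext fun j => ContinuousMap.ext fun x => ?_
    exact iteratedFDeriv_add_apply
      ((SmoothFn.contDiff φ).contDiffAt.of_le (by exact_mod_cast le_top))
      ((SmoothFn.contDiff ψ).contDiffAt.of_le (by exact_mod_cast le_top))
  map_smul' c φ := by
    refine funext fun j => ContinuousMap.ext fun x => ?_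
    exact iteratedFDeriv_const_smul_apply
      ((SmoothFn.contDiff φ).contDiffAt.of_le (by exact_mod_cast le_top))

theorem norm_jet_le {K : Set E} [CompactSpace K] {k : ℕ} {φ : SmoothFn E} {B : ℝ} (hB : 0 ≤ B)
    (h : ∀ j ≤ k, ∀ x ∈ K, ‖iteratedFDeriv ℝ j (φ : E → ℂ) x‖ ≤ B) : ‖jet K k φ‖ ≤ B :=
  (pi_norm_le_iff_of_nonneg hB).2 fun j => (ContinuousMap.norm_le _ hB).2 fun x =>
    h j (Nat.le_of_lt_succ j.2) x x.2

theorem norm_le_norm_jet {K : Set E} [CompactSpace K] {k : ℕ} (φ : SmoothFn E) {j : ℕ}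
    (hj : j ≤ k) {x : E} (hx : x ∈ K) : ‖iteratedFDeriv ℝ j (φ : E → ℂ) x‖ ≤ ‖jet K k φ‖ := by
  have h := (JetSpace.eval (K := K) (⟨j, Nat.lt_succ_of_le hj⟩ : Fin (k + 1))
    ⟨x, hx⟩).le_of_opNorm_le
    (LinearMap.mkContinuous_norm_le _ zero_le_one _) (jet K k φ)
  rwa [one_mul] at h

/-- Hahn-Banach: a distribution of compact support extends to the Banach space of jets. -/
theorem IsCompactDistr.exists_extension {L : SmoothFn E →ₗ[ℂ] ℂ} (hL : IsCompactDistr L) :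
    ∃ (K : Set E) (_ : CompactSpace K) (k : ℕ) (l : StrongDual ℂ (JetSpace E K k)),
      ∀ φ, L φ = l (jet K k φ) := by
  obtain ⟨K, k, C, hK, hb⟩ := hL
  have hc : CompactSpace K := isCompact_iff_compactSpace.1 hK
  refine ⟨K, hc, k, ?_⟩
  have hbound : ∀ φ, ‖L φ‖ ≤ C * ‖jet K k φ‖ := fun φ =>
    hb φ _ fun j hj x hx => norm_le_norm_jet φ hj hx
  -- The functional factors through the jets and is bounded on their range.
  have hker : LinearMap.ker (jet K k) ≤ LinearMap.ker L := fun φ hφ => by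
    rw [LinearMap.mem_ker] at hφ ⊢
    have := hbound φ
    rw [hφ, norm_zero, mul_zero] at this
    exact norm_le_zero_iff.1 this
  let f₀ : LinearMap.range (jet K k) →ₗ[ℂ] ℂ :=
    ((LinearMap.ker (jet K k)).liftQ L hker) ∘ₗ (jet K k).quotKerEquivRange.symm.toLinearMap
  have hf₀ : ∀ φ, f₀ ⟨jet K k φ, LinearMap.mem_range_self _ φ⟩ = L φ := fun φ => by
    have : (jet K k).quotKerEquivRange.symm ⟨jet K k φ, LinearMap.mem_range_self _ φ⟩
        = (LinearMap.ker (jet K k)).mkQ φ := by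
      rw [LinearEquiv.symm_apply_eq]
      rfl
    simp only [f₀, LinearMap.comp_apply, LinearEquiv.coe_coe, this]
    exact Submodule.liftQ_apply _ _ _
  obtain ⟨l, hl, -⟩ := exists_extension_norm_eq (LinearMap.range (jet K k))
    (f₀.mkContinuous C (by rintro ⟨_, φ, rfl⟩; rw [hf₀]; exact hbound φ))
  refine ⟨l, fun φ => ?_⟩
  rw [← hf₀ φ]
  exact (hl ⟨jet K k φ, LinearMap.mem_range_self _ φ⟩).symm

end CompactSupport

section Fourier

open VectorFourier Real
open scoped FourierTransform RealInnerProductSpace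

variable {E : Type*} [NormedAddCommGroup E] [InnerProductSpace ℝ E] [FiniteDimensional ℝ E]
  [MeasurableSpace E] [BorelSpace E]

theorem contDiff_cexp_const_mul (c : ℂ) : ContDiff ℝ ∞ fun z : ℝ => Complex.exp (c * z) :=
  (contDiff_const.mul Complex.ofRealCLM.contDiff).cexp

theorem iteratedDeriv_real_cexp_const_mul (c : ℂ) (n : ℕ) :
    iteratedDeriv n (fun z : ℝ => Complex.exp (c * z)) =
      fun z : ℝ => c ^ n * Complex.exp (c * z) := by
  induction n with
  | zero => simp
  | succ n ih =>
    rw [iteratedDeriv_succ, ih]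
    ext z
    have h : HasDerivAt (fun z : ℝ => c * (z : ℂ)) c z := by
      simpa using (Complex.ofRealCLM.hasDerivAt (x := z)).const_mul c
    rw [(h.cexp.const_mul (c ^ n)).deriv]
    ring

/-- The plane wave with frequency `ξ`, in the normalization of Mathlib's Fourier transform. -/
def fourierWave (ξ : E) : SmoothFn E := planeWave ((2 * π) • innerSL ℝ ξ)

theorem iteratedFDeriv_fourierWave (ξ x : E) (n : ℕ) :
    iteratedFDeriv ℝ n (fourierWave ξ : E → ℂ) x =
      (𝐞 (-⟪ξ, x⟫)) • fourierPowSMulRight (innerSL ℝ) (fun _ : E => (1 : ℂ)) ξ n := by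
  have h : (fourierWave ξ : E → ℂ) =
      (fun z : ℝ => Complex.exp ((-(2 * π * Complex.I)) * z)) ∘ (innerSL ℝ ξ) := by
    ext y
    simp only [fourierWave, planeWave, Function.comp]
    congr 1
    simp
    ring
  rw [h, ContinuousLinearMap.iteratedFDeriv_comp_right _ (contDiff_cexp_const_mul _) _
    (i := n) (by exact_mod_cast le_top)]
  ext m
  rw [ContinuousMultilinearMap.compContinuousLinearMap_apply,
    iteratedFDeriv_apply_eq_iteratedDeriv_mul_prod, iteratedDeriv_real_cexp_const_mul]
  rw [Circle.smul_def, _root_.smul_apply, fourierPowSMulRight_apply,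
    Real.fourierChar_apply]
  simp only [innerSL_apply_apply, smul_eq_mul, Complex.real_smul]
  have : Complex.exp (-(2 * π * Complex.I) * (⟪ξ, x⟫ : ℝ))
      = Complex.exp ((2 * π * (-⟪ξ, x⟫ : ℝ) : ℝ) * Complex.I) := by
    congr 1; push_cast; ring
  rw [this, show (∏ i, innerSL ℝ ξ (m i)) = ∏ i, ⟪ξ, m i⟫ from rfl]
  ring

theorem norm_iteratedFDeriv_fourierWave_le (ξ x : E) (n : ℕ) :
    ‖iteratedFDeriv ℝ n (fourierWave ξ : E → ℂ) x‖ ≤ (2 * π) ^ n * ‖ξ‖ ^ n := by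
  rw [iteratedFDeriv_fourierWave, Circle.smul_def, norm_smul, Circle.norm_coe, one_mul]
  refine (norm_fourierPowSMulRight_le (innerSL ℝ) _ ξ n).trans ?_
  have h1 : ‖innerSL ℝ (E := E)‖ ≤ 1 := norm_innerSL_le ℝ
  rw [norm_one, mul_one]
  have h2 : 2 * π * ‖innerSL ℝ (E := E)‖ ≤ 2 * π :=
    mul_le_of_le_one_right (by have := Real.pi_pos; positivity) h1
  exact mul_le_mul_of_nonneg_right
    (pow_le_pow_left₀ (by have := Real.pi_pos; positivity) h2 n) (by positivity)

theorem norm_jet_fourierWave_le (K : Set E) [CompactSpace K] (k : ℕ) (ξ : E) :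
    ‖jet K k (fourierWave ξ)‖ ≤ (2 * π) ^ k * (1 + ‖ξ‖) ^ k := by
  have h1 : 1 ≤ 2 * π := by nlinarith [Real.pi_gt_three]
  refine norm_jet_le (by positivity) fun j hj x _ =>
    (norm_iteratedFDeriv_fourierWave_le ξ x j).trans ?_
  calc (2 * π) ^ j * ‖ξ‖ ^ j ≤ (2 * π) ^ k * (1 + ‖ξ‖) ^ j := by
        gcongr
        · linarith [norm_nonneg ξ]
    _ ≤ _ := by
        gcongr
        linarith [norm_nonneg ξ]

theorem continuous_jet_fourierWave (K : Set E) [CompactSpace K] (k : ℕ) :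
    Continuous fun ξ : E => jet K k (fourierWave ξ) := by
  change Continuous fun (ξ : E) (j : Fin (k + 1)) =>
    (jet K k (fourierWave ξ) : (j : Fin (k + 1)) → C(K, E [×(j : ℕ)]→L[ℝ] ℂ)) j
  refine continuous_pi fun j => ContinuousMap.continuous_of_continuous_uncurry _ ?_
  have h : (Function.uncurry fun (ξ : E) (x : K) =>
      (jet K k (fourierWave ξ) : (j : Fin (k + 1)) → C(K, E [×(j : ℕ)]→L[ℝ] ℂ)) j x) =
      fun z : E × K => ((𝐞 (-⟪z.1, (z.2 : E)⟫) : Circle) : ℂ) •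
        fourierPowSMulRight (innerSL ℝ) (fun _ : E => (1 : ℂ)) z.1 (j : ℕ) := by
    ext1 z
    exact iteratedFDeriv_fourierWave z.1 z.2 j
  rw [h]
  have h2 : Continuous fun z : E × K => -⟪z.1, (z.2 : E)⟫ := by fun_prop
  have h3 : Continuous fun z : E × K => ((𝐞 (-⟪z.1, (z.2 : E)⟫) : Circle) : ℂ) :=
    continuous_subtype_val.comp (Real.continuous_fourierChar.comp h2)
  exact h3.smul ((Continuous.fourierPowSMulRight (innerSL ℝ) (continuous_const) _).comp
    continuous_fst)

/-- The Fourier transform of a distribution of compact support is continuous, of polynomial growth,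
and represents the distribution on test functions. -/
theorem IsCompactDistr.fourier_representation {L : SmoothFn E →ₗ[ℂ] ℂ} (hL : IsCompactDistr L) :
    Continuous (fun ξ => L (fourierWave ξ)) ∧
    (∃ (k : ℕ) (C : ℝ), 0 ≤ C ∧ ∀ ξ, ‖L (fourierWave ξ)‖ ≤ C * (1 + ‖ξ‖) ^ k) ∧
    ∀ g : SmoothFn E, HasCompactSupport (g : E → ℂ) →
      L g = ∫ ξ, 𝓕⁻ (g : E → ℂ) ξ * L (fourierWave ξ) := by
  obtain ⟨K, hK, k, l, hl⟩ := hL.exists_extension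
  have hpi := Real.pi_pos
  refine ⟨?_, ⟨k, ‖l‖ * (2 * π) ^ k, by positivity, fun ξ => ?_⟩, fun g hg => ?_⟩
  · simp only [hl]
    exact l.continuous.comp (continuous_jet_fourierWave K k)
  · rw [hl, mul_assoc]
    exact (l.le_opNorm _).trans (by gcongr; exact norm_jet_fourierWave_le K k ξ)
  · let gs : SchwartzMap E ℂ := hg.toSchwartzMap g.2
    let G : SchwartzMap E ℂ := 𝓕⁻ gs
    have hG : (G : E → ℂ) = 𝓕⁻ (g : E → ℂ) := SchwartzMap.fourierInv_coe gs
    have hgG : 𝓕 (G : E → ℂ) = g := by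
      rw [← SchwartzMap.fourier_coe]
      have : 𝓕 G = gs := FourierTransform.fourier_fourierInv_eq gs
      rw [this]
      rfl
    have hGint : ∀ n : ℕ, Integrable (fun ξ => ‖ξ‖ ^ n * ‖G ξ‖) := G.integrable_pow_mul volume
    have hint : Integrable fun ξ => G ξ • jet K k (fourierWave ξ) := by
      have hdom : Integrable fun ξ => (2 * π) ^ k * (2 ^ k * ‖G ξ‖ + 2 ^ k * (‖ξ‖ ^ k * ‖G ξ‖)) :=
        (((by simpa using hGint 0 : Integrable fun ξ => ‖G ξ‖).const_mul _).add
          ((hGint k).const_mul _)).const_mul _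
      refine hdom.mono' (G.continuous.smul (continuous_jet_fourierWave K k)).aestronglyMeasurable
        (ae_of_all _ fun ξ => ?_)
      rw [norm_smul]
      have h2 : (1 + ‖ξ‖) ^ k ≤ 2 ^ k * 1 + 2 ^ k * ‖ξ‖ ^ k := by
        rcases le_total ‖ξ‖ 1 with h | h
        · calc (1 + ‖ξ‖) ^ k ≤ 2 ^ k := by gcongr; linarith
            _ ≤ _ := by nlinarith [pow_nonneg (norm_nonneg ξ) k, pow_pos (two_pos (α := ℝ)) k]
        · calc (1 + ‖ξ‖) ^ k ≤ (2 * ‖ξ‖) ^ k := by gcongr; linarith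
            _ ≤ _ := by rw [mul_pow]; nlinarith [pow_pos (two_pos (α := ℝ)) k]
      calc ‖G ξ‖ * ‖jet K k (fourierWave ξ)‖
          ≤ ‖G ξ‖ * ((2 * π) ^ k * (1 + ‖ξ‖) ^ k) := by
            gcongr; exact norm_jet_fourierWave_le K k ξ
        _ ≤ ‖G ξ‖ * ((2 * π) ^ k * (2 ^ k * 1 + 2 ^ k * ‖ξ‖ ^ k)) := by gcongr
        _ = _ := by ring
    -- Fourier inversion for all derivatives of order at most `k` on `K` at once.
    have hjet : ∫ ξ, G ξ • jet K k (fourierWave ξ) = jet K k g := by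
      refine funext fun j => ContinuousMap.ext fun x => ?_
      have h1 : JetSpace.eval j x (∫ ξ, G ξ • jet K k (fourierWave ξ))
          = ∫ ξ, JetSpace.eval j x (G ξ • jet K k (fourierWave ξ)) :=
        ((JetSpace.eval j x).integral_comp_comm hint).symm
      have h2 : JetSpace.eval j x (jet K k g) = iteratedFDeriv ℝ j (g : E → ℂ) x := rfl
      change JetSpace.eval j x (∫ ξ, G ξ • jet K k (fourierWave ξ)) = JetSpace.eval j x (jet K k g)
      rw [h1, h2, ← hgG, Real.iteratedFDeriv_fourier (N := ⊤) (fun n _ => hGint n)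
        G.continuous.aestronglyMeasurable le_top, Real.fourier_eq]
      refine integral_congr_ae (ae_of_all _ fun ξ => ?_)
      change G ξ • iteratedFDeriv ℝ j (fourierWave ξ : E → ℂ) x = _
      rw [iteratedFDeriv_fourierWave]
      ext m
      simp only [Circle.smul_def, _root_.smul_apply, fourierPowSMulRight_apply,
        smul_eq_mul, Complex.real_smul]
      ring
    rw [hl g, ← hjet, ← l.integral_comp_comm hint]
    refine integral_congr_ae (ae_of_all _ fun ξ => ?_)
    simp only [map_smul, hl, smul_eq_mul, hG]

end Fourier

/-! ### Rapid decrease of a distribution along oscillating test functions -/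

section RapidDecrease

open Real
open scoped FourierTransform RealInnerProductSpace

variable {E : Type*} [NormedAddCommGroup E] [InnerProductSpace ℝ E] [FiniteDimensional ℝ E]
  [MeasurableSpace E] [BorelSpace E]

/-- The oscillating function `a exp(-i s f)`. -/
def oscFn {a : E → ℂ} (ha : ContDiff ℝ ∞ a) {f : E → ℝ} (hf : ContDiff ℝ ∞ f) (s : ℝ) :
    SmoothFn E :=
  ⟨fun x => a x * Complex.exp (-Complex.I * ((s * f x : ℝ) : ℂ)),
    ha.mul (contDiff_const.mul (Complex.ofRealCLM.contDiff.comp (contDiff_const.mul hf))).cexp⟩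

theorem fourierInv_oscFn {a : E → ℂ} (ha : ContDiff ℝ ∞ a) {f : E → ℝ} (hf : ContDiff ℝ ∞ f)
    (s : ℝ) (ξ : E) : 𝓕⁻ (oscFn ha hf s : E → ℂ) ξ =
      ∫ x, a x * Complex.exp (-Complex.I * ((s * f x - 2 * π * ⟪ξ, x⟫ : ℝ) : ℂ)) := by
  rw [Real.fourierInv_eq']
  refine integral_congr_ae (ae_of_all _ fun x => ?_)
  simp only [oscFn, smul_eq_mul]
  rw [mul_left_comm, ← Complex.exp_add, real_inner_comm]
  congr 2
  push_cast
  ring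

/-- The amplitudes `𝓕⁻ (a exp(-i s f_p)) (ξ)` decrease rapidly as `s + |ξ| → ∞` for `ξ` outside of
the cone of frequencies close to `η`, when the phase gradients are close to `η`. -/
theorem fourierInv_oscFn_le {P : Type*} [NormedAddCommGroup P] [NormedSpace ℝ P]
    [FiniteDimensional ℝ P] {Kp : Set P} (hKp : IsCompact Kp) {f : P × E → ℝ}
    (hf : ContDiff ℝ ∞ f) {a : E → ℂ} (ha : ContDiff ℝ ∞ a) (hac : HasCompactSupport a)
    {η : E →L[ℝ] ℝ} {R : ℝ} (hR : 0 < R)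
    (hd : ∀ p ∈ Kp, ∀ x ∈ tsupport a,
      ‖(fderiv ℝ f (p, x)).comp (ContinuousLinearMap.inr ℝ P E) - η‖ ≤ R / 2) (M : ℕ) :
    ∃ C : ℝ, ∀ p ∈ Kp, ∀ s : ℝ, 1 ≤ s → ∀ ξ : E,
      R * s ≤ ‖(2 * π) • innerSL ℝ ξ - s • η‖ →
      (s + ‖ξ‖) ^ M *
        ‖𝓕⁻ (oscFn ha (hf.comp (contDiff_prodMk_right p)) s : E → ℂ) ξ‖ ≤ C := by
  -- After rescaling by `s + |ξ|` the parameters `(ξ, s)` range over a compact set, on which the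
  -- phase `s f - 2π⟨ξ, x⟩` is nonstationary; `s + |ξ|` is the large parameter.
  let T : Set (E × ℝ) := {w | ‖w.1‖ + w.2 = 1 ∧ 0 ≤ w.2 ∧
    R * w.2 ≤ ‖(2 * π) • innerSL ℝ w.1 - w.2 • η‖}
  have hT : IsCompact T := by
    refine Metric.isCompact_of_isClosed_isBounded ?_ ?_
    · have h : Continuous fun w : E × ℝ => innerSL ℝ w.1 :=
        (innerSL ℝ).continuous.comp continuous_fst
      have h' : Continuous fun w : E × ℝ => ‖(2 * π) • innerSL ℝ w.1 - w.2 • η‖ := by fun_prop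
      exact IsClosed.inter
        (isClosed_eq (f := fun w : E × ℝ => ‖w.1‖ + w.2) (by fun_prop) continuous_const)
        (IsClosed.inter (isClosed_le continuous_const continuous_snd)
          (isClosed_le (f := fun w : E × ℝ => R * w.2) (by fun_prop) h'))
    · refine (Metric.isBounded_closedBall (x := (0 : E × ℝ)) (r := 1)).subset ?_
      rintro ⟨w, σ⟩ ⟨h1, h2, -⟩
      simp only [Metric.mem_closedBall, dist_zero_right, Prod.norm_def, sup_le_iff,
        Real.norm_eq_abs]
      simp only at h1 h2
      exact ⟨by linarith, by rw [abs_of_nonneg h2]; linarith [norm_nonneg w]⟩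
  let f' : (P × (E × ℝ)) × E → ℝ := fun z => z.1.2.2 * f (z.1.1, z.2) - 2 * π * ⟪z.1.2.1, z.2⟫
  have hf' : ContDiff ℝ ∞ f' := by
    have h1 : ContDiff ℝ ∞ fun z : (P × (E × ℝ)) × E => f (z.1.1, z.2) :=
      hf.comp (by fun_prop)
    have h2 : ContDiff ℝ ∞ fun z : (P × (E × ℝ)) × E => ⟪z.1.2.1, z.2⟫ :=
      ContDiff.inner ℝ (by fun_prop) (by fun_prop)
    have h3 : ContDiff ℝ ∞ fun z : (P × (E × ℝ)) × E => z.1.2.2 := by fun_prop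
    exact (h3.mul h1).sub (contDiff_const.mul h2)
  have hdf' : ∀ p w σ x v, fderiv ℝ f' ((p, (w, σ)), x) (0, v)
      = σ * fderiv ℝ f (p, x) (0, v) - 2 * π * ⟪w, v⟫ := by
    intro p w σ x v
    have h1 := (hasFDerivAt_slice hf' (p, (w, σ)) x)
    have h2 := ((hasFDerivAt_slice hf p x).const_mul σ).sub
      (((innerSL ℝ w).hasFDerivAt (x := x)).const_mul (2 * π))
    have h3 := congrArg (fun A => A v) (h1.unique h2)
    simpa using h3
  obtain ⟨C, hC⟩ := nonstationary_phase (volume : Measure E) hf' (hKp.prod hT) hac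
    (fun q hq x hx => by
      obtain ⟨p, w, σ⟩ := q
      obtain ⟨hp, h1, h2, h3⟩ := hq
      simp only at h1 h2 h3 hp
      by_contra hn
      push Not at hn
      have hz : (2 * π) • innerSL ℝ w =
          σ • ((fderiv ℝ f (p, x)).comp (ContinuousLinearMap.inr ℝ P E)) := by
        ext v
        have := hn v
        rw [hdf'] at this
        simp
        linarith
      have h4 := hd p hp x hx
      rw [hz, ← smul_sub, norm_smul, Real.norm_of_nonneg h2] at h3
      have hσ : σ = 0 := by
        by_contra hne
        have hpos : 0 < σ := lt_of_le_of_ne h2 (Ne.symm hne)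
        nlinarith
      rw [hσ, zero_smul] at hz
      have hw : ‖(2 * π) • innerSL ℝ w‖ = 0 := by rw [hz, norm_zero]
      rw [norm_smul, innerSL_apply_norm] at hw
      have hpi : ‖2 * π‖ ≠ 0 := by
        rw [norm_ne_zero_iff]; exact (by positivity : (0 : ℝ) < 2 * π).ne'
      rcases mul_eq_zero.1 hw with h | h
      · exact hpi h
      · rw [h, hσ] at h1; norm_num at h1) M
    (fun z => a z.2) (ha.comp contDiff_snd) (fun p x hx => image_eq_zero_of_notMem_tsupport hx)
  refine ⟨C, fun p hp s hs ξ hξ => ?_⟩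
  have hl : 0 < s + ‖ξ‖ := by linarith [norm_nonneg ξ]
  have hmem : (p, ((s + ‖ξ‖)⁻¹ • ξ, (s + ‖ξ‖)⁻¹ * s)) ∈ Kp ×ˢ T := by
    refine ⟨hp, ?_, by positivity, ?_⟩
    · simp only
      rw [norm_smul, norm_inv, Real.norm_of_nonneg hl.le]
      field_simp
      ring
    · simp only [map_smul]
      rw [smul_comm (2 * π), mul_smul _ s η, ← smul_sub, norm_smul, norm_inv,
        Real.norm_of_nonneg hl.le, mul_left_comm]
      gcongr
  refine le_trans (le_of_eq ?_) (hC _ hmem _ hl)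
  rw [fourierInv_oscFn]
  congr 2
  refine integral_congr_ae (ae_of_all _ fun x => ?_)
  simp only [f', Function.comp]
  congr 4
  rw [real_inner_smul_left]
  field_simp

/-- A distribution whose Fourier transform decreases rapidly in a conic neighbourhood of `η` is
rapidly decreasing along oscillating functions whose phase gradients are close to `η`: split the
frequencies in the Fourier representation into the conic neighbourhood and its complement, where
the amplitudes decrease rapidly. -/
theorem IsCompactDistr.rapid_decrease {L : SmoothFn E →ₗ[ℂ] ℂ} (hL : IsCompactDistr L)
    {η : E →L[ℝ] ℝ} {Z : Set (E →L[ℝ] ℝ)} (hZ : Z ∈ 𝓝 η)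
    (hdec : ∀ N : ℕ, ∃ C : ℝ, ∀ ζ ∈ Z, ∀ s : ℝ, 1 ≤ s → s ^ N * ‖L (planeWave (s • ζ))‖ ≤ C) :
    ∃ r : ℝ, 0 < r ∧ ∀ {P : Type} [NormedAddCommGroup P] [NormedSpace ℝ P]
      [FiniteDimensional ℝ P] {Kp : Set P} (_ : IsCompact Kp) {f : P × E → ℝ}
      (hf : ContDiff ℝ ∞ f) {a : E → ℂ} (ha : ContDiff ℝ ∞ a) (_ : HasCompactSupport a)
      (_ : ∀ p ∈ Kp, ∀ x ∈ tsupport a,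
        ‖(fderiv ℝ f (p, x)).comp (ContinuousLinearMap.inr ℝ P E) - η‖ ≤ r) (N : ℕ),
      ∃ C : ℝ, ∀ p ∈ Kp, ∀ s : ℝ, 1 ≤ s →
        s ^ N * ‖L (oscFn ha (hf.comp (contDiff_prodMk_right p)) s)‖ ≤ C := by
  obtain ⟨R, hR, hball⟩ := Metric.mem_nhds_iff.1 hZ
  obtain ⟨-, ⟨k, C₀, hC₀, hgrow⟩, hrep⟩ := hL.fourier_representation
  refine ⟨R / 2, by positivity, ?_⟩
  intro P _ _ _ Kp hKp f hf a ha hac hd N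
  set n := Module.finrank ℝ E
  -- The extra `n + 1` powers make the bound integrable in `ξ`.
  obtain ⟨C₁, hC₁⟩ := hdec (N + (n + 1))
  obtain ⟨C₂, hC₂⟩ := fourierInv_oscFn_le hKp hf ha hac hR hd (N + k + (n + 1))
  let D : ℝ := 1 + ‖η‖ + R
  have hD : 1 ≤ D := by simp only [D]; linarith [norm_nonneg η]
  let A : ℝ := ∫ x, ‖a x‖
  have hA : 0 ≤ A := integral_nonneg fun x => norm_nonneg _
  let B : ℝ := A * |C₁| * D ^ (n + 1) + |C₂| * C₀
  have hpoint : ∀ p ∈ Kp, ∀ s : ℝ, 1 ≤ s → ∀ ξ : E,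
      s ^ N * ‖𝓕⁻ (oscFn ha (hf.comp (contDiff_prodMk_right p)) s : E → ℂ) ξ * L (fourierWave ξ)‖
        ≤ B * (1 + ‖ξ‖) ^ (-((n : ℝ) + 1)) := by
    intro p hp s hs ξ
    have hx1 : 0 < 1 + ‖ξ‖ := by linarith [norm_nonneg ξ]
    rw [Real.rpow_neg hx1.le, show ((n : ℝ) + 1) = ((n + 1 : ℕ) : ℝ) by push_cast; ring,
      Real.rpow_natCast, ← div_eq_mul_inv, le_div_iff₀ (by positivity), norm_mul]
    set u := ‖𝓕⁻ (oscFn ha (hf.comp (contDiff_prodMk_right p)) s : E → ℂ) ξ‖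
    set v := ‖L (fourierWave ξ)‖
    have hs0 : 0 < s := by linarith
    rcases lt_or_ge ‖(2 * π) • innerSL ℝ ξ - s • η‖ (R * s) with h | h
    · -- In the cone, `L` decreases rapidly and `ξ` is comparable to `s`.
      have hu : u ≤ A := by
        simp only [u]
        rw [fourierInv_oscFn]
        refine (norm_integral_le_integral_norm _).trans (le_of_eq ?_)
        refine integral_congr_ae (ae_of_all _ fun x => ?_)
        simp only [norm_mul]
        rw [show ∀ z : ℝ, -Complex.I * (z : ℂ) = ((-z : ℝ) : ℂ) * Complex.I by
          intro z; push_cast; ring, Complex.norm_exp_ofReal_mul_I, mul_one]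
      have hζ : s⁻¹ • ((2 * π) • innerSL ℝ ξ) ∈ Z := by
        refine hball ?_
        rw [Metric.mem_ball, dist_eq_norm]
        have : s⁻¹ • ((2 * π) • innerSL ℝ ξ) - η = s⁻¹ • ((2 * π) • innerSL ℝ ξ - s • η) := by
          rw [smul_sub, smul_smul s⁻¹ s, inv_mul_cancel₀ hs0.ne', one_smul]
        rw [this, norm_smul, norm_inv, Real.norm_of_nonneg hs0.le, inv_mul_lt_iff₀ hs0]
        linarith
      have hv := hC₁ _ hζ s hs
      rw [smul_smul s, mul_inv_cancel₀ hs0.ne', one_smul] at hv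
      have hv' : s ^ (N + (n + 1)) * v ≤ |C₁| := hv.trans (le_abs_self _)
      have hξ : 1 + ‖ξ‖ ≤ D * s := by
        have h1 : ‖(2 * π) • innerSL ℝ ξ‖ ≤ R * s + s * ‖η‖ := by
          have := norm_sub_norm_le ((2 * π) • innerSL ℝ ξ) (s • η)
          rw [norm_smul s, Real.norm_of_nonneg hs0.le] at this
          linarith
        rw [norm_smul, innerSL_apply_norm, Real.norm_of_nonneg (by positivity)] at h1
        have h2 : ‖ξ‖ ≤ 2 * π * ‖ξ‖ :=
          le_mul_of_one_le_left (norm_nonneg _) (by nlinarith [Real.pi_gt_three])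
        simp only [D]
        nlinarith
      calc s ^ N * (u * v) * (1 + ‖ξ‖) ^ (n + 1)
          ≤ s ^ N * (A * v) * (D * s) ^ (n + 1) := by gcongr
        _ = A * (s ^ (N + (n + 1)) * v) * D ^ (n + 1) := by rw [mul_pow]; ring
        _ ≤ A * |C₁| * D ^ (n + 1) := by gcongr
        _ ≤ B := le_add_of_nonneg_right (by positivity)
    · -- Outside of the cone the amplitude decreases rapidly and `L` grows polynomially.
      have hu : (s + ‖ξ‖) ^ (N + k + (n + 1)) * u ≤ |C₂| :=
        (hC₂ p hp s hs ξ h).trans (le_abs_self _)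
      have hv : v ≤ C₀ * (1 + ‖ξ‖) ^ k := hgrow ξ
      calc s ^ N * (u * v) * (1 + ‖ξ‖) ^ (n + 1)
          ≤ (s + ‖ξ‖) ^ N * (u * (C₀ * (s + ‖ξ‖) ^ k)) * (s + ‖ξ‖) ^ (n + 1) := by
            have h1 : s ≤ s + ‖ξ‖ := by linarith [norm_nonneg ξ]
            have h2 : 1 + ‖ξ‖ ≤ s + ‖ξ‖ := by linarith
            have h3 : v ≤ C₀ * (s + ‖ξ‖) ^ k := hv.trans (by gcongr)
            gcongr
        _ = (s + ‖ξ‖) ^ (N + k + (n + 1)) * u * C₀ := by ring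
        _ ≤ |C₂| * C₀ := by gcongr
        _ ≤ B := le_add_of_nonneg_left (by positivity)
  refine ⟨∫ ξ : E, B * (1 + ‖ξ‖) ^ (-((n : ℝ) + 1)), fun p hp s hs => ?_⟩
  have hs0 : 0 < s := by linarith
  have hcs : HasCompactSupport (oscFn ha (hf.comp (contDiff_prodMk_right p)) s : E → ℂ) :=
    hac.mul_right
  rw [hrep _ hcs, ← Real.norm_of_nonneg (pow_nonneg hs0.le N), ← Complex.norm_real, ← norm_mul,
    ← integral_const_mul]
  refine norm_integral_le_of_norm_le
    ((integrable_one_add_norm (by simp [n])).const_mul B) (ae_of_all _ fun ξ => ?_)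
  rw [norm_mul, Complex.norm_real, Real.norm_of_nonneg (pow_nonneg hs0.le N)]
  exact hpoint p hp s hs ξ

/-- A distribution of compact support with rapidly decreasing Fourier transform is a smooth
function. -/
theorem IsCompactDistr.exists_smooth_density {L : SmoothFn E →ₗ[ℂ] ℂ} (hL : IsCompactDistr L)
    (hdec : ∀ N : ℕ, ∃ C : ℝ, ∀ ζ, ‖ζ‖ ^ N * ‖L (planeWave ζ)‖ ≤ C) :
    ∃ F : E → ℂ, ContDiff ℝ ∞ F ∧ ∀ g : SmoothFn E, HasCompactSupport (g : E → ℂ) →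
      L g = ∫ x, F x * (g : E → ℂ) x := by
  obtain ⟨hcont, -, hrep⟩ := hL.fourier_representation
  set Φ : E → ℂ := fun ξ => L (fourierWave ξ) with hΦ
  have hΦdec : ∀ N : ℕ, ∃ C : ℝ, ∀ ξ, ‖ξ‖ ^ N * ‖Φ ξ‖ ≤ C := fun N => by
    obtain ⟨C, hC⟩ := hdec N
    refine ⟨C, fun ξ => le_trans ?_ (hC ((2 * π) • innerSL ℝ ξ))⟩
    have h2 : ‖ξ‖ ≤ ‖(2 * π) • innerSL ℝ ξ‖ := by
      rw [norm_smul, innerSL_apply_norm, Real.norm_of_nonneg (by positivity)]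
      exact le_mul_of_one_le_left (norm_nonneg _) (by nlinarith [Real.pi_gt_three])
    change ‖ξ‖ ^ N * ‖L (planeWave _)‖ ≤ _
    gcongr
  set n := Module.finrank ℝ E
  have hΦint : ∀ N : ℕ, Integrable fun ξ => ‖ξ‖ ^ N * ‖Φ ξ‖ := fun N => by
    obtain ⟨C₁, h1⟩ := hΦdec N
    obtain ⟨C₂, h2⟩ := hΦdec (N + (n + 1))
    refine ((integrable_one_add_norm (μ := (volume : Measure E)) (r := (n : ℝ) + 1)
      (by simp [n])).const_mul (2 ^ (n + 1) * (|C₁| + |C₂|))).mono'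
      (((continuous_norm.pow N).mul hcont.norm).aestronglyMeasurable) (ae_of_all _ fun ξ => ?_)
    have hx1 : 0 < 1 + ‖ξ‖ := by linarith [norm_nonneg ξ]
    rw [Real.norm_of_nonneg (by positivity), Real.rpow_neg hx1.le,
      show ((n : ℝ) + 1) = ((n + 1 : ℕ) : ℝ) by push_cast; ring,
      Real.rpow_natCast, ← div_eq_mul_inv, le_div_iff₀ (by positivity)]
    have h1' := (h1 ξ).trans (le_abs_self _)
    have h2' := (h2 ξ).trans (le_abs_self _)
    rcases le_total ‖ξ‖ 1 with h | h
    · calc ‖ξ‖ ^ N * ‖Φ ξ‖ * (1 + ‖ξ‖) ^ (n + 1) ≤ |C₁| * 2 ^ (n + 1) := by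
            gcongr; linarith
        _ ≤ _ := by nlinarith [abs_nonneg C₂, pow_pos (two_pos (α := ℝ)) (n + 1)]
    · calc ‖ξ‖ ^ N * ‖Φ ξ‖ * (1 + ‖ξ‖) ^ (n + 1)
          ≤ ‖ξ‖ ^ N * ‖Φ ξ‖ * (2 * ‖ξ‖) ^ (n + 1) := by gcongr; linarith
        _ = 2 ^ (n + 1) * (‖ξ‖ ^ (N + (n + 1)) * ‖Φ ξ‖) := by rw [mul_pow]; ring
        _ ≤ 2 ^ (n + 1) * |C₂| := by gcongr
        _ ≤ _ := by nlinarith [abs_nonneg C₁, pow_pos (two_pos (α := ℝ)) (n + 1)]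
  have hΨint : ∀ N : ℕ, Integrable fun ξ => ‖ξ‖ ^ N * ‖Φ (-ξ)‖ := fun N => by
    simpa using (hΦint N).comp_neg
  have hΨ : Integrable fun ξ => Φ (-ξ) := by
    have := hΨint 0
    simp only [pow_zero, one_mul] at this
    exact (integrable_norm_iff (hcont.comp continuous_neg).aestronglyMeasurable).1 this
  refine ⟨𝓕 (fun ξ => Φ (-ξ)), Real.contDiff_fourier (N := ⊤) fun m _ => hΨint m, fun g hg => ?_⟩
  have hgint : Integrable (g : E → ℂ) :=
    (SmoothFn.contDiff g).continuous.integrable_of_hasCompactSupport hg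
  rw [hrep g hg, ← integral_neg_eq_self]
  have h := VectorFourier.integral_fourierIntegral_smul_eq_flip (e := 𝐞) (L := innerₗ E)
    (μ := (volume : Measure E)) (ν := (volume : Measure E)) Real.continuous_fourierChar
    (by simpa using continuous_inner) hgint hΨ
  rw [flip_innerₗ] at h
  calc ∫ ξ, 𝓕⁻ (g : E → ℂ) (-ξ) * L (fourierWave (-ξ))
      = ∫ ξ, VectorFourier.fourierIntegral 𝐞 volume (innerₗ E) (g : E → ℂ) ξ • Φ (-ξ) := by
        refine integral_congr_ae (ae_of_all _ fun ξ => ?_)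
        simp only [Real.fourierInv_eq_fourier_neg, neg_neg, smul_eq_mul]
        rfl
    _ = _ := h
    _ = _ := by
        refine integral_congr_ae (ae_of_all _ fun x => ?_)
        simp only [smul_eq_mul]
        rw [mul_comm]
        rfl

end RapidDecrease

/-! ### Localization of distributions on manifolds -/

section Localization

variable {E : Type*} [NormedAddCommGroup E] [NormedSpace ℝ E] [FiniteDimensional ℝ E]
variable {M : Type*} [TopologicalSpace M] [T2Space M] [SigmaCompactSpace M] [ChartedSpace E M]
  [IsManifold 𝓘(ℝ, E) ∞ M]
variable {H : Type*} [NormedAddCommGroup H] [NormedSpace ℝ H]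

theorem TestSpace.ext {Ω : Set M} {φ ψ : TestSpace E Ω} (h : ∀ q, (φ : M → ℂ) q = (ψ : M → ℂ) q) :
    φ = ψ := Subtype.ext (funext h)

theorem TestSpace.eq_zero_of_notMem {Ω : Set M} (φ : TestSpace E Ω) {q : M}
    (hq : q ∉ tsupport (φ : M → ℂ)) : (φ : M → ℂ) q = 0 := image_eq_zero_of_notMem_tsupport hq

/-- A property of test functions that is stable under sums holds for `g` if it holds for test
functions with small support near each point of the support of `g`. -/
theorem TestSpace.induction_on_local {Ω : Set M} (g : TestSpace E Ω) {P : TestSpace E Ω → Prop}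
    (h0 : P 0) (hadd : ∀ a b, P a → P b → P (a + b))
    (hloc : ∀ p ∈ tsupport (g : M → ℂ), ∃ N ∈ 𝓝 p, ∀ c : TestSpace E Ω,
      tsupport (c : M → ℂ) ⊆ N → tsupport (c : M → ℂ) ⊆ tsupport (g : M → ℂ) → P c) : P g := by
  classical
  choose! N hN hP using hloc
  have hK : IsCompact (tsupport (g : M → ℂ)) := g.2.2.1
  obtain ⟨s, hs, hcov⟩ := hK.elim_nhds_subcover (fun p => interior (N p))
    fun p hp => interior_mem_nhds.2 (hN p hp)
  obtain ⟨f, hf⟩ := SmoothPartitionOfUnity.exists_isSubordinate 𝓘(ℝ, E)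
    (isClosed_tsupport (g : M → ℂ)) (fun p : s => interior (N p)) (fun _ => isOpen_interior)
    (hcov.trans (iUnion₂_subset fun p hp =>
      subset_iUnion (fun p : s => interior (N p)) ⟨p, hp⟩))
  have hsm : ∀ i : s, ContMDiffOn 𝓘(ℝ, E) 𝓘(ℝ, ℂ) ∞ (fun q => (f i q : ℂ)) univ := fun i =>
    (Complex.ofRealCLM.contDiff.contMDiff.comp (f i).contMDiff).contMDiffOn
  let c : s → TestSpace E Ω := fun i =>
    mulOn g isOpen_univ (subset_univ _) (fun q => (f i q : ℂ)) (hsm i)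
  have hsum : g = ∑ i, c i := by
    refine TestSpace.ext fun q => ?_
    have h1 : ((∑ i, c i : TestSpace E Ω) : M → ℂ) q = ∑ i, (g : M → ℂ) q * (f i q : ℂ) := by
      rw [Submodule.coe_sum, Finset.sum_apply]
      rfl
    rw [h1, ← Finset.mul_sum]
    by_cases hq : q ∈ tsupport (g : M → ℂ)
    · have h2 := f.sum_eq_one hq
      rw [finsum_eq_sum_of_fintype] at h2
      rw [← Complex.ofReal_sum, h2, Complex.ofReal_one, mul_one]
    · rw [TestSpace.eq_zero_of_notMem g hq, zero_mul]
  have hc : ∀ i, P (c i) := fun i => by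
    refine hP i (hs i i.2) (c i) ?_ tsupport_mul_subset_left
    refine (tsupport_mul_subset_right (f := (g : M → ℂ)) (g := fun q => (f i q : ℂ))).trans ?_
    refine Subset.trans (closure_mono fun q hq => ?_) ((hf i).trans interior_subset)
    intro h
    exact hq (by simp [h])
  rw [hsum]
  exact Finset.sum_induction c P hadd h0 fun i _ => hc i

/-- The map `φ ↦ g · (φ ∘ G)`, where `G` is smooth near the support of the test function `g`. -/
def pullFn {Ω : Set M} (g : TestSpace E Ω) {O : Set M} (hO : IsOpen O)
    (hg : tsupport (g : M → ℂ) ⊆ O) {G : M → H} (hG : ContMDiffOn 𝓘(ℝ, E) 𝓘(ℝ, H) ∞ G O) :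
    SmoothFn H →ₗ[ℂ] TestSpace E Ω where
  toFun φ := mulOn g hO hg (fun q => (φ : H → ℂ) (G q))
    ((SmoothFn.contDiff φ).contMDiff.comp_contMDiffOn hG)
  map_add' _ _ := TestSpace.ext fun _ => mul_add _ _ _
  map_smul' _ _ := TestSpace.ext fun _ => mul_left_comm _ _ _

theorem IsCompactDistr.add {L L' : SmoothFn H →ₗ[ℂ] ℂ} (h : IsCompactDistr L)
    (h' : IsCompactDistr L') : IsCompactDistr (L + L') := by
  obtain ⟨K, k, C, hK, hb⟩ := h
  obtain ⟨K', k', C', hK', hb'⟩ := h'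
  refine ⟨K ∪ K', max k k', C + C', hK.union hK', fun φ B hB => ?_⟩
  have h1 := hb φ B fun j hj x hx => hB j (hj.trans (le_max_left _ _)) x (Or.inl hx)
  have h2 := hb' φ B fun j hj x hx => hB j (hj.trans (le_max_right _ _)) x (Or.inr hx)
  calc ‖(L + L') φ‖ ≤ ‖L φ‖ + ‖L' φ‖ := norm_add_le _ _
    _ ≤ (C + C') * B := by linarith

theorem contDiffOn_comp_chart_symm {O : Set M} {G : M → H}
    (hG : ContMDiffOn 𝓘(ℝ, E) 𝓘(ℝ, H) ∞ G O) (p : M) :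
    ContDiffOn ℝ ∞ (G ∘ (chartAt E p).symm)
      ((chartAt E p).target ∩ (chartAt E p).symm ⁻¹' O) := by
  rw [← contMDiffOn_iff_contDiffOn]
  exact hG.comp ((contMDiffOn_chart_symm (x := p)).mono inter_subset_left) fun x hx => hx.2

theorem isOpen_chart_target_inter {O : Set M} (hO : IsOpen O) (p : M) :
    IsOpen ((chartAt E p).target ∩ (chartAt E p).symm ⁻¹' O) :=
  (chartAt E p).isOpen_inter_preimage_symm hO

theorem exists_bound_iteratedFDeriv {u : E → H} (hu : ContDiff ℝ ∞ u) {K : Set E}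
    (hK : IsCompact K) (k : ℕ) :
    ∃ A : ℝ, 1 ≤ A ∧ ∀ j ≤ k, ∀ x ∈ K, ‖iteratedFDeriv ℝ j u x‖ ≤ A := by
  have : ∀ j : ℕ, ∃ A, ∀ x ∈ K, ‖iteratedFDeriv ℝ j u x‖ ≤ A := fun j =>
    hK.exists_bound_of_continuousOn
      (hu.continuous_iteratedFDeriv (m := j) (by exact_mod_cast le_top)).continuousOn
  choose A hA using this
  refine ⟨1 + ∑ j ∈ Finset.range (k + 1), |A j|,
    le_add_of_nonneg_right (Finset.sum_nonneg fun _ _ => abs_nonneg _), fun j hj x hx => ?_⟩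
  have h1 : |A j| ≤ ∑ j ∈ Finset.range (k + 1), |A j| :=
    Finset.single_le_sum (f := fun j => |A j|) (fun _ _ => abs_nonneg _)
      (Finset.mem_range.2 (Nat.lt_succ_of_le hj))
  linarith [(hA j x hx).trans (le_abs_self _)]

/-- Uniform bounds for the derivatives of `a · (φ ∘ G)` by those of `φ`. -/
theorem exists_bound_iteratedFDeriv_mul_comp {a : E → ℂ} (ha : ContDiff ℝ ∞ a) {G : E → H}
    (hG : ContDiff ℝ ∞ G) {K : Set E} (hK : IsCompact K) (k : ℕ) :
    ∃ C : ℝ, ∀ (φ : E → ℂ) (ψ : H → ℂ) (B : ℝ), ContDiff ℝ ∞ ψ → ∀ x ∈ K,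
      φ =ᶠ[𝓝 x] (fun y => a y * ψ (G y)) →
      (∀ j ≤ k, ‖iteratedFDeriv ℝ j ψ (G x)‖ ≤ B) →
      ∀ j ≤ k, ‖iteratedFDeriv ℝ j φ x‖ ≤ C * B := by
  obtain ⟨A, hA1, hA⟩ := exists_bound_iteratedFDeriv ha hK k
  obtain ⟨D, hD1, hD⟩ := exists_bound_iteratedFDeriv hG hK k
  refine ⟨2 ^ k * (A * (k.factorial * D ^ k)), fun φ ψ B hψ x hx he hB j hj => ?_⟩
  have hB0 : 0 ≤ B := (norm_nonneg _).trans (hB 0 (Nat.zero_le _))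
  have hcomp : ∀ m ≤ k, ‖iteratedFDeriv ℝ m (fun y => ψ (G y)) x‖ ≤ k.factorial * B * D ^ k := by
    intro m hm
    have h1 := norm_iteratedFDeriv_comp_le hψ hG (n := m) (by exact_mod_cast le_top) x (C := B)
      (D := D) (fun i hi => hB i (hi.trans hm)) fun i hi1 hi2 =>
        (hD i (hi2.trans hm) x hx).trans (le_self_pow₀ hD1 (by omega))
    refine h1.trans ?_
    have h2 : (m.factorial : ℝ) ≤ k.factorial := by exact_mod_cast Nat.factorial_le hm
    gcongr
  rw [(Filter.EventuallyEq.iteratedFDeriv ℝ he j).self_of_nhds]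
  refine (norm_iteratedFDeriv_mul_le ha (hψ.comp hG) x (n := j) (by exact_mod_cast le_top)).trans ?_
  calc ∑ i ∈ Finset.range (j + 1), (j.choose i : ℝ) * ‖iteratedFDeriv ℝ i a x‖ *
        ‖iteratedFDeriv ℝ (j - i) (fun y => ψ (G y)) x‖
      ≤ ∑ i ∈ Finset.range (j + 1), (j.choose i : ℝ) * A * (k.factorial * B * D ^ k) := by
        refine Finset.sum_le_sum fun i hi => ?_
        have hi' : i ≤ j := Nat.le_of_lt_succ (Finset.mem_range.1 hi)
        gcongr
        · exact hA i (hi'.trans hj) x hx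
        · exact hcomp _ ((Nat.sub_le _ _).trans hj)
    _ = 2 ^ j * (A * (k.factorial * B * D ^ k)) := by
        rw [← Finset.sum_mul, ← Finset.sum_mul, ← Nat.cast_sum, Nat.sum_range_choose]
        push_cast
        ring
    _ ≤ 2 ^ k * (A * (k.factorial * B * D ^ k)) := by
        gcongr
        norm_num
    _ = _ := by ring

/-- `φ ↦ ⟨t, g · (φ ∘ G)⟩` is a distribution of compact support. -/
theorem isCompactDistr_pullFn {Ω : Set M} {t : TestSpace E Ω →ₗ[ℂ] ℂ} (ht : IsDistribution E t)
    (g : TestSpace E Ω) {O : Set M} (hO : IsOpen O) (hg : tsupport (g : M → ℂ) ⊆ O) {G : M → H}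
    (hG : ContMDiffOn 𝓘(ℝ, E) 𝓘(ℝ, H) ∞ G O) :
    IsCompactDistr (t ∘ₗ pullFn g hO hg hG) := by
  suffices h : ∃ hg : tsupport (g : M → ℂ) ⊆ O, IsCompactDistr (t ∘ₗ pullFn g hO hg hG) from h.2
  refine TestSpace.induction_on_local g (P := fun g => ∃ hg : tsupport (g : M → ℂ) ⊆ O,
    IsCompactDistr (t ∘ₗ pullFn g hO hg hG)) ?_ ?_ ?_
  · refine ⟨by simp [tsupport], ∅, 0, 0, isCompact_empty, fun φ B _ => ?_⟩
    have : pullFn (0 : TestSpace E Ω) hO (by simp [tsupport]) hG φ = 0 :=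
      TestSpace.ext fun q => zero_mul _
    rw [LinearMap.comp_apply, this, map_zero, norm_zero, zero_mul]
  · rintro a b ⟨ha, ha'⟩ ⟨hb, hb'⟩
    refine ⟨(tsupport_add (a : M → ℂ) b).trans (union_subset ha hb), ?_⟩
    convert ha'.add hb' using 1
    ext φ
    simp only [LinearMap.comp_apply, LinearMap.add_apply]
    rw [← map_add]
    congr 1
    exact TestSpace.ext fun q => add_mul _ _ _
  · intro p hp
    refine ⟨(chartAt E p).source ∩ O, ((chartAt E p).open_source.inter hO).mem_nhds
      ⟨mem_chart_source E p, hg hp⟩, fun c hc _ => ⟨hc.trans inter_subset_right, ?_⟩⟩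
    set x := chartAt E p
    set K := tsupport (c : M → ℂ)
    have hK : IsCompact K := c.2.2.1
    have hcs : K ⊆ x.source := hc.trans inter_subset_left
    have hcO : K ⊆ O := hc.trans inter_subset_right
    obtain ⟨k, C, hC⟩ := ht p K hK (subset_inter hcs c.2.2.2)
    have hxK : IsCompact (x '' K) := hK.image_of_continuousOn (x.continuousOn.mono hcs)
    have hsub : x '' K ⊆ x.target ∩ x.symm ⁻¹' O := by
      rintro _ ⟨q, hq, rfl⟩
      exact ⟨x.map_source (hcs hq), by rw [mem_preimage, x.left_inv (hcs hq)]; exact hcO hq⟩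
    obtain ⟨G', hG', heG⟩ := exists_contDiff_extension hxK (isOpen_chart_target_inter hO p) hsub
      (contDiffOn_comp_chart_symm hG p)
    obtain ⟨a, ha, hea⟩ := exists_contDiff_extension hxK (isOpen_chart_target_inter hO p) hsub
      (contDiffOn_comp_chart_symm c.2.1.contMDiffOn p)
    obtain ⟨C', hC'⟩ := exists_bound_iteratedFDeriv_mul_comp ha hG' hxK k
    refine ⟨G '' K, k, C * C', hK.image_of_continuousOn (hG.continuousOn.mono hcO),
      fun φ B hB => ?_⟩
    rw [mul_assoc]
    refine hC _ _ tsupport_mul_subset_left fun j hj q hq => ?_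
    have hq' : x q ∈ x '' K := mem_image_of_mem x hq
    have heq : G' (x q) = G q := by
      rw [heG.self_of_nhdsSet _ hq', Function.comp_apply, x.left_inv (hcs hq)]
    refine hC' _ φ B (SmoothFn.contDiff φ) _ hq' ?_
      (fun j hj => by rw [heq]; exact hB j hj _ (mem_image_of_mem G hq)) j hj
    have h1 := (nhds_le_nhdsSet hq') heG
    have h2 := (nhds_le_nhdsSet hq') hea
    filter_upwards [h1, h2] with y hy1 hy2
    rw [hy1, hy2]
    rfl

end Localization

/-! ### Microlocal smoothness and nonlinear phases -/

section ChartFn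

variable {E : Type*} [NormedAddCommGroup E] [NormedSpace ℝ E] [FiniteDimensional ℝ E]
variable {M : Type*} [TopologicalSpace M] [T2Space M] [SigmaCompactSpace M] [ChartedSpace E M]
  [IsManifold 𝓘(ℝ, E) ∞ M]

/-- A function on `M` read in the chart at `p` and extended by zero. -/
def chartFn (p : M) (g : M → ℂ) : E → ℂ :=
  (chartAt E p).target.indicator (g ∘ (chartAt E p).symm)

theorem chartFn_apply {p q : M} (g : M → ℂ) (hq : q ∈ (chartAt E p).source) :
    chartFn p g (chartAt E p q) = g q := by
  rw [chartFn, indicator_of_mem ((chartAt E p).map_source hq), Function.comp_apply,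
    (chartAt E p).left_inv hq]

theorem support_chartFn_subset (p : M) (g : M → ℂ) :
    Function.support (chartFn (E := E) p g) ⊆
      chartAt E p '' ((chartAt E p).source ∩ tsupport g) := by
  intro v hv
  have hvt : v ∈ (chartAt E p).target := by
    by_contra hn
    exact hv (indicator_of_notMem hn _)
  refine ⟨(chartAt E p).symm v, ⟨(chartAt E p).map_target hvt, subset_tsupport _ fun h => hv ?_⟩,
    (chartAt E p).right_inv hvt⟩
  rw [chartFn, indicator_of_mem hvt, Function.comp_apply, h]

theorem isCompact_chart_image {p : M} {K : Set M} (hK : IsCompact K)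
    (hs : K ⊆ (chartAt E p).source) : IsCompact (chartAt E p '' K) :=
  hK.image_of_continuousOn ((chartAt E p).continuousOn.mono hs)

theorem tsupport_chartFn_subset {p : M} {g : M → ℂ} (hg : HasCompactSupport g)
    (hs : tsupport g ⊆ (chartAt E p).source) :
    tsupport (chartFn (E := E) p g) ⊆ chartAt E p '' (tsupport g) :=
  closure_minimal ((support_chartFn_subset p g).trans (image_mono inter_subset_right))
    (isCompact_chart_image hg hs).isClosed

theorem hasCompactSupport_chartFn {p : M} {g : M → ℂ} (hg : HasCompactSupport g)
    (hs : tsupport g ⊆ (chartAt E p).source) : HasCompactSupport (chartFn (E := E) p g) :=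
  (isCompact_chart_image hg hs).of_isClosed_subset (isClosed_tsupport _)
    (tsupport_chartFn_subset hg hs)

theorem contDiff_chartFn {p : M} {g : M → ℂ} (hsm : ContMDiff 𝓘(ℝ, E) 𝓘(ℝ, ℂ) ∞ g)
    (hg : HasCompactSupport g) (hs : tsupport g ⊆ (chartAt E p).source) :
    ContDiff ℝ ∞ (chartFn (E := E) p g) := by
  rw [← contMDiff_iff_contDiff]
  refine contMDiff_of_tsupport fun v hv => ContDiffAt.contMDiffAt ?_
  obtain ⟨q, hq, rfl⟩ := tsupport_chartFn_subset hg hs hv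
  have hvt : chartAt E p q ∈ (chartAt E p).target := (chartAt E p).map_source (hs hq)
  have h1 := (contDiffOn_comp_chart_symm (hsm.contMDiffOn (s := univ)) p).contDiffAt
    ((isOpen_chart_target_inter isOpen_univ p).mem_nhds ⟨hvt, trivial⟩)
  refine h1.congr_of_eventuallyEq ?_
  filter_upwards [(chartAt E p).open_target.mem_nhds hvt] with w hw
  exact indicator_of_mem hw _

end ChartFn

section Microlocal

variable {E : Type*} [NormedAddCommGroup E] [InnerProductSpace ℝ E] [FiniteDimensional ℝ E]
  [MeasurableSpace E] [BorelSpace E]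
variable {M : Type*} [TopologicalSpace M] [T2Space M] [SigmaCompactSpace M] [ChartedSpace E M]
  [IsManifold 𝓘(ℝ, E) ∞ M]

/-- The covector `ζ ∘ dG_p`. -/
def pullCovector (E : Type*) [NormedAddCommGroup E] [NormedSpace ℝ E] {M : Type*}
    [TopologicalSpace M] [ChartedSpace E M] [IsManifold 𝓘(ℝ, E) ∞ M]
    {H : Type*} [NormedAddCommGroup H] [NormedSpace ℝ H] (G : M → H) (p : M)
    (ζ : H →L[ℝ] ℝ) : Cotangent E M :=
  ⟨p, (ζ.comp (mfderiv 𝓘(ℝ, E) 𝓘(ℝ, H) G p : E →L[ℝ] H) : E →L[ℝ] ℝ)⟩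

theorem coordCovector_pullCovector {H : Type*} [NormedAddCommGroup H] [NormedSpace ℝ H] {G : M → H}
    {p : M} (hG : MDifferentiableAt 𝓘(ℝ, E) 𝓘(ℝ, H) G p) (ζ : H →L[ℝ] ℝ) :
    coordCovector E (pullCovector E G p ζ) =
      ζ.comp (fderiv ℝ (G ∘ (chartAt E p).symm) (chartAt E p p)) := by
  have hp := mem_chart_source E p
  have hinv := (chartAt E p).left_inv hp
  have h1 : HasMFDerivAt 𝓘(ℝ, E) 𝓘(ℝ, H) G ((chartAt E p).symm (chartAt E p p))
      (mfderiv 𝓘(ℝ, E) 𝓘(ℝ, H) G p : E →L[ℝ] H) := by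
    rw [hinv]; exact hG.hasMFDerivAt
  have h2 : MDifferentiableAt 𝓘(ℝ, E) 𝓘(ℝ, E) (chartAt E p).symm (chartAt E p p) :=
    ((contMDiffOn_chart_symm (n := ∞) (I := 𝓘(ℝ, E)) (x := p)).contMDiffAt
      ((chartAt E p).open_target.mem_nhds ((chartAt E p).map_source hp))).mdifferentiableAt
        (by simp)
  have h3 := (h1.comp _ h2.hasMFDerivAt).mfderiv
  rw [mfderiv_eq_fderiv] at h3
  change (ζ.comp (mfderiv 𝓘(ℝ, E) 𝓘(ℝ, H) G p : E →L[ℝ] H)).comp _ = _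
  rw [h3]
  rfl

theorem oscTest_eq_pullFn {Ω : Set M} (p : M) (χ : TestSpace E Ω)
    (hχ : tsupport (χ : M → ℂ) ⊆ (chartAt E p).source) (ζ : E →L[ℝ] ℝ) (s : ℝ) :
    oscTest p χ hχ ζ s = pullFn χ (chartAt E p).open_source hχ (contMDiffOn_chart (I := 𝓘(ℝ, E)))
      (planeWave (s • ζ)) := rfl

/-- If `ζ₀ ∘ dG_p` is a direction of microlocal smoothness of `t`, then `t` is rapidly decreasing on
`g exp(-i s ζ ∘ G)` for `ζ` close to `ζ₀` and `g` supported close to `p`. -/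
theorem MicrolocallySmoothAt.exists_nhds {H : Type} [NormedAddCommGroup H] [NormedSpace ℝ H]
    [FiniteDimensional ℝ H] {Ω : Set M} {t : Distr E Ω} {p : M} {O : Set M} (hO : IsOpen O)
    (hpO : p ∈ O) {G : M → H} (hG : ContMDiffOn 𝓘(ℝ, E) 𝓘(ℝ, H) ∞ G O) {ζ₀ : H →L[ℝ] ℝ}
    (h : MicrolocallySmoothAt t (pullCovector E G p ζ₀)) :
    ∃ (N : Set M) (_ : N ∈ 𝓝 p) (hNO : N ⊆ O), ∃ Z ∈ 𝓝 ζ₀, ∀ (g : TestSpace E Ω)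
      (hg : tsupport (g : M → ℂ) ⊆ N) (K : ℕ), ∃ C : ℝ, ∀ ζ ∈ Z, ∀ s : ℝ, 1 ≤ s →
        s ^ K * ‖t.toLin (pullFn g hO (hg.trans hNO) hG (planeWave (s • ζ)))‖ ≤ C := by
  obtain ⟨χ, hχ, hχp, Z₀, hZ₀, hdec⟩ := h
  change tsupport (χ : M → ℂ) ⊆ (chartAt E p).source at hχ
  change (χ : M → ℂ) p ≠ 0 at hχp
  rw [coordCovector_pullCovector ((hG p hpO).contMDiffAt (hO.mem_nhds hpO)
    |>.mdifferentiableAt (by simp))] at hZ₀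
  set x := chartAt E p
  have hps : p ∈ x.source := mem_chart_source E p
  have hL := isCompactDistr_pullFn t.isDistribution χ x.open_source hχ
    (contMDiffOn_chart (I := 𝓘(ℝ, E)))
  obtain ⟨r, hr, hrap⟩ := hL.rapid_decrease hZ₀ hdec
  obtain ⟨G', hG', heG⟩ := exists_contDiff_extension (isCompact_singleton (x := x p))
    (isOpen_chart_target_inter hO p) (singleton_subset_iff.2
      ⟨x.map_source hps, by rw [mem_preimage, x.left_inv hps]; exact hpO⟩)
    (contDiffOn_comp_chart_symm hG p)
  rw [nhdsSet_singleton] at heG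
  let f : (H →L[ℝ] ℝ) × E → ℝ := fun z => z.1 (G' z.2)
  have hf : ContDiff ℝ ∞ f := contDiff_fst.clm_apply (hG'.comp contDiff_snd)
  have hdf : ∀ ζ v, (fderiv ℝ f (ζ, v)).comp (ContinuousLinearMap.inr ℝ _ E) =
      ζ.comp (fderiv ℝ G' v) := fun ζ v =>
    (hasFDerivAt_slice hf ζ v).unique
      (ζ.hasFDerivAt.comp v (hG'.differentiable (by simp) v).hasFDerivAt)
  have hcont : Continuous fun z : (H →L[ℝ] ℝ) × E => z.1.comp (fderiv ℝ G' z.2) :=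
    continuous_fst.clm_comp ((hG'.continuous_fderiv (by simp)).comp continuous_snd)
  have hball : ∀ᶠ z in 𝓝 (ζ₀, x p), ‖z.1.comp (fderiv ℝ G' z.2) -
      ζ₀.comp (fderiv ℝ (G ∘ x.symm) (x p))‖ ≤ r := by
    have h1 : ζ₀.comp (fderiv ℝ G' (x p)) = ζ₀.comp (fderiv ℝ (G ∘ x.symm) (x p)) := by
      rw [Filter.EventuallyEq.fderiv_eq (show G' =ᶠ[𝓝 (x p)] G ∘ x.symm from heG)]
    have h2 : Continuous fun z : (H →L[ℝ] ℝ) × E => ‖z.1.comp (fderiv ℝ G' z.2) -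
        ζ₀.comp (fderiv ℝ (G ∘ x.symm) (x p))‖ := (hcont.sub continuous_const).norm
    have h3 := h2.continuousAt (x := (ζ₀, x p)) |>.eventually_lt (continuousAt_const (y := r))
      (by rw [h1, sub_self, norm_zero]; exact hr)
    exact h3.mono fun z hz => hz.le
  rw [nhds_prod_eq] at hball
  obtain ⟨Z, hZ, N', hN', hZN⟩ := Filter.eventually_prod_iff.1 hball
  obtain ⟨ε, hε, hεZ⟩ := Metric.nhds_basis_closedBall.eventually_iff.1 hZ
  have hxp : Tendsto x (𝓝 p) (𝓝 (x p)) := (x.continuousAt hps)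
  have hNmem : {q | q ∈ x.source ∧ q ∈ O ∧ (χ : M → ℂ) q ≠ 0 ∧ N' (x q) ∧
      G' (x q) = (G ∘ x.symm) (x q)} ∈ 𝓝 p := by
    filter_upwards [x.open_source.mem_nhds hps, hO.mem_nhds hpO,
      χ.2.1.continuous.continuousAt.eventually_ne hχp, hxp hN', hxp heG] with q h1 h2 h3 h4 h5
      using ⟨h1, h2, h3, h4, h5⟩
  refine ⟨_, hNmem, fun q hq => hq.2.1, Metric.closedBall ζ₀ ε, Metric.closedBall_mem_nhds _ hε,
    fun g hg K => ?_⟩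
  have hgs : tsupport (g : M → ℂ) ⊆ x.source := fun q hq => (hg hq).1
  have hχo : IsOpen {q | (χ : M → ℂ) q ≠ 0} := isOpen_ne_fun χ.2.1.continuous continuous_const
  let g' : TestSpace E Ω := mulOn g hχo (fun q hq => (hg hq).2.2.1)
    (fun q => ((χ : M → ℂ) q)⁻¹) (by
      intro q hq
      have h1 : ContDiffAt ℝ ∞ (fun z : ℂ => z⁻¹) ((χ : M → ℂ) q) := contDiffAt_inv ℝ hq
      exact (h1.contMDiffAt.comp q (χ.2.1 q)).contMDiffWithinAt)
  have hg's : tsupport (g' : M → ℂ) ⊆ tsupport (g : M → ℂ) := tsupport_mul_subset_left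
  have ha : ContDiff ℝ ∞ (chartFn (E := E) p (g' : M → ℂ)) :=
    contDiff_chartFn g'.2.1 g'.2.2.1 (hg's.trans hgs)
  obtain ⟨C, hC⟩ := hrap (isCompact_closedBall ζ₀ ε) hf ha
    (hasCompactSupport_chartFn g'.2.2.1 (hg's.trans hgs)) (fun ζ hζ v hv => by
      obtain ⟨q, hq, rfl⟩ := tsupport_chartFn_subset g'.2.2.1 (hg's.trans hgs) hv
      rw [hdf]
      exact hZN (hεZ hζ) (hg (hg's hq)).2.2.2.1) K
  refine ⟨C, fun ζ hζ s hs => ?_⟩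
  convert hC ζ hζ s hs using 3
  rw [LinearMap.comp_apply]
  congr 1
  refine TestSpace.ext fun q => ?_
  change (g : M → ℂ) q * Complex.exp (-Complex.I * ((s * ζ (G q) : ℝ) : ℂ)) = (χ : M → ℂ) q *
    (chartFn p (g' : M → ℂ) (x q) * Complex.exp (-Complex.I * ((s * ζ (G' (x q)) : ℝ) : ℂ)))
  by_cases hq : q ∈ tsupport (g : M → ℂ)
  · have h1 := (hg hq).2.2.2.2
    rw [Function.comp_apply, x.left_inv (hgs hq)] at h1
    rw [chartFn_apply _ (hgs hq), h1, ← mul_assoc]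
    congr 1
    change _ = (χ : M → ℂ) q * ((g : M → ℂ) q * ((χ : M → ℂ) q)⁻¹)
    rw [mul_left_comm, mul_inv_cancel₀ (hg hq).2.2.1, mul_one]
  · rw [TestSpace.eq_zero_of_notMem g hq, zero_mul]
    by_cases hqs : q ∈ x.source
    · rw [chartFn_apply _ hqs, TestSpace.eq_zero_of_notMem g' fun h => hq (hg's h), zero_mul,
        mul_zero]
    · rw [TestSpace.eq_zero_of_notMem χ fun h => hqs (hχ h), zero_mul]

theorem IsCompactDistr.exists_growth {L : SmoothFn E →ₗ[ℂ] ℂ} (hL : IsCompactDistr L) :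
    ∃ (k : ℕ) (C : ℝ), 0 ≤ C ∧ ∀ ζ, ‖L (planeWave ζ)‖ ≤ C * (1 + ‖ζ‖) ^ k := by
  obtain ⟨-, ⟨k, C, hC, h⟩, -⟩ := hL.fourier_representation
  refine ⟨k, C, hC, fun ζ => ?_⟩
  have hpi := Real.pi_pos
  set ξ : E := (2 * Real.pi)⁻¹ • (InnerProductSpace.toDual ℝ E).symm ζ with hξ
  have h1 : fourierWave ξ = planeWave ζ := by
    rw [fourierWave, hξ, map_smul, smul_smul, mul_inv_cancel₀ (by positivity), one_smul]
    congr 1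
    exact (InnerProductSpace.toDual ℝ E).apply_symm_apply ζ
  have h2 : ‖ξ‖ ≤ ‖ζ‖ := by
    rw [hξ, norm_smul, LinearIsometryEquiv.norm_map, norm_inv, Real.norm_of_nonneg (by positivity)]
    exact mul_le_of_le_one_left (norm_nonneg _) (inv_le_one_of_one_le₀
      (by nlinarith [Real.pi_gt_three]))
  rw [← h1]
  refine (h ξ).trans ?_
  gcongr

/-- The set of directions of microlocal smoothness is a cone. -/
theorem MicrolocallySmoothAt.smul {Ω : Set M} {t : Distr E Ω} {p : M} {η : E →L[ℝ] ℝ}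
    (h : MicrolocallySmoothAt t (⟨p, η⟩ : Cotangent E M)) {c : ℝ} (hc : 0 < c) :
    MicrolocallySmoothAt t (⟨p, (c • η : E →L[ℝ] ℝ)⟩ : Cotangent E M) := by
  obtain ⟨χ, hχ, hχp, Z₀, hZ₀, hdec⟩ := h
  obtain ⟨k, A, hA, hgrow⟩ := (isCompactDistr_pullFn t.isDistribution χ
    (chartAt E p).open_source hχ (contMDiffOn_chart (I := 𝓘(ℝ, E)))).exists_growth
  set η' := coordCovector E (⟨p, η⟩ : Cotangent E M)
  have hη' : coordCovector E (⟨p, (c • η : E →L[ℝ] ℝ)⟩ : Cotangent E M) = c • η' := rfl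
  obtain ⟨R, hR, hball⟩ := Metric.mem_nhds_iff.1 hZ₀
  refine ⟨χ, hχ, hχp, {ζ | c⁻¹ • ζ ∈ Metric.ball η' R}, ?_, fun N => ?_⟩
  · rw [hη']
    refine (Metric.isOpen_ball.preimage (continuous_const_smul c⁻¹)).mem_nhds ?_
    rw [mem_preimage, smul_smul, inv_mul_cancel₀ hc.ne', one_smul]
    exact Metric.mem_ball_self hR
  · obtain ⟨C, hC⟩ := hdec N
    refine ⟨c⁻¹ ^ N * |C| + c⁻¹ ^ N * (A * (1 + (‖η'‖ + R)) ^ k), fun ζ hζ s hs => ?_⟩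
    have hs0 : 0 < s := by linarith
    set ζ' := c⁻¹ • ζ with hζ'
    have hsζ : s • ζ = (c * s) • ζ' := by
      rw [hζ', smul_smul, mul_assoc, mul_left_comm, mul_inv_cancel₀ hc.ne', mul_one]
    have hosc : oscTest p χ hχ ζ s = oscTest p χ hχ ζ' (c * s) := by
      rw [oscTest_eq_pullFn, oscTest_eq_pullFn, hsζ]
    have hsN : s ^ N = c⁻¹ ^ N * (c * s) ^ N := by
      rw [← mul_pow, ← mul_assoc, inv_mul_cancel₀ hc.ne', one_mul]
    change s ^ N * ‖t.toLin (oscTest p χ hχ ζ s)‖ ≤ _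
    rw [hosc, hsN, mul_assoc]
    have hcinv : 0 ≤ c⁻¹ ^ N := by positivity
    rcases le_total 1 (c * s) with h1 | h1
    · have h2 := (hC ζ' (hball hζ) (c * s) h1).trans (le_abs_self C)
      refine le_add_of_le_of_nonneg (mul_le_mul_of_nonneg_left h2 hcinv) ?_
      positivity
    · refine le_add_of_nonneg_of_le (by positivity) (mul_le_mul_of_nonneg_left ?_ hcinv)
      have h3 : ‖ζ'‖ ≤ ‖η'‖ + R := by
        have := norm_sub_norm_le ζ' η'
        have h4 : ‖ζ' - η'‖ < R := by simpa [dist_eq_norm] using hζ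
        linarith
      calc (c * s) ^ N * ‖t.toLin (oscTest p χ hχ ζ' (c * s))‖
          ≤ 1 * (A * (1 + ‖(c * s) • ζ'‖) ^ k) := by
            refine mul_le_mul (pow_le_one₀ (by positivity) h1) ?_ (norm_nonneg _) zero_le_one
            exact hgrow ((c * s) • ζ')
        _ ≤ A * (1 + (‖η'‖ + R)) ^ k := by
            rw [one_mul, norm_smul, Real.norm_of_nonneg (by positivity)]
            have : c * s * ‖ζ'‖ ≤ ‖η'‖ + R :=
              (mul_le_of_le_one_left (norm_nonneg _) h1).trans h3
            gcongr

/-- If `t` is microlocally smooth in all directions `ζ ∘ dG_p`, `ζ ≠ 0`, over the support of `g`,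
then the push-forward of `g t` by `G` is a smooth function. -/
theorem exists_smooth_density_pullFn {H : Type} [NormedAddCommGroup H] [InnerProductSpace ℝ H]
    [FiniteDimensional ℝ H] [MeasurableSpace H] [BorelSpace H] {Ω : Set M} {t : Distr E Ω}
    (g : TestSpace E Ω) {O : Set M} (hO : IsOpen O) (hg : tsupport (g : M → ℂ) ⊆ O) {G : M → H}
    (hG : ContMDiffOn 𝓘(ℝ, E) 𝓘(ℝ, H) ∞ G O)
    (hms : ∀ p ∈ tsupport (g : M → ℂ), ∀ ζ : H →L[ℝ] ℝ, ‖ζ‖ = 1 →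
      MicrolocallySmoothAt t (pullCovector E G p ζ)) :
    ∃ F : H → ℂ, ContDiff ℝ ∞ F ∧ ∀ φ : SmoothFn H, HasCompactSupport (φ : H → ℂ) →
      t.toLin (pullFn g hO hg hG φ) = ∫ x, F x * (φ : H → ℂ) x := by
  have hL := isCompactDistr_pullFn t.isDistribution g hO hg hG
  have key : ∀ ζ₀ : H →L[ℝ] ℝ, ‖ζ₀‖ = 1 → ∃ hg : tsupport (g : M → ℂ) ⊆ O, ∃ Z ∈ 𝓝 ζ₀,
      ∀ K : ℕ, ∃ C : ℝ, ∀ ζ ∈ Z, ∀ s : ℝ, 1 ≤ s →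
        s ^ K * ‖t.toLin (pullFn g hO hg hG (planeWave (s • ζ)))‖ ≤ C := by
    intro ζ₀ hζ₀
    refine TestSpace.induction_on_local g (P := fun g => ∃ hg : tsupport (g : M → ℂ) ⊆ O,
      ∃ Z ∈ 𝓝 ζ₀, ∀ K : ℕ, ∃ C : ℝ, ∀ ζ ∈ Z, ∀ s : ℝ, 1 ≤ s →
        s ^ K * ‖t.toLin (pullFn g hO hg hG (planeWave (s • ζ)))‖ ≤ C) ?_ ?_ ?_
    · refine ⟨by simp [tsupport], univ, univ_mem, fun K => ⟨0, fun ζ _ s _ => le_of_eq ?_⟩⟩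
      have : pullFn (0 : TestSpace E Ω) hO (by simp [tsupport]) hG (planeWave (s • ζ)) = 0 :=
        TestSpace.ext fun q => zero_mul _
      rw [this, map_zero, norm_zero, mul_zero]
    · rintro a b ⟨ha, Z, hZ, ha'⟩ ⟨hb, Z', hZ', hb'⟩
      refine ⟨(tsupport_add (a : M → ℂ) b).trans (union_subset ha hb), Z ∩ Z', inter_mem hZ hZ',
        fun K => ?_⟩
      obtain ⟨C, hC⟩ := ha' K
      obtain ⟨C', hC'⟩ := hb' K
      refine ⟨C + C', fun ζ hζ s hs => ?_⟩
      have h1 : pullFn (a + b) hO ((tsupport_add (a : M → ℂ) b).trans (union_subset ha hb)) hG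
          (planeWave (s • ζ)) = pullFn a hO ha hG (planeWave (s • ζ)) +
            pullFn b hO hb hG (planeWave (s • ζ)) := TestSpace.ext fun q => add_mul _ _ _
      rw [h1, map_add]
      calc _ ≤ s ^ K * (_ + _) :=
            mul_le_mul_of_nonneg_left (norm_add_le _ _) (pow_nonneg (by linarith) K)
        _ ≤ C + C' := by
            rw [mul_add]
            exact add_le_add (hC ζ hζ.1 s hs) (hC' ζ hζ.2 s hs)
    · intro p hp
      obtain ⟨N, hN, hNO, Z, hZ, h⟩ := (hms p hp ζ₀ hζ₀).exists_nhds hO (hg hp) hG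
      exact ⟨N, hN, fun c hc _ => ⟨hc.trans hNO, Z, hZ, fun K => h c hc K⟩⟩
  have hdec : ∀ K : ℕ, ∃ C : ℝ, ∀ ζ ∈ Metric.sphere (0 : H →L[ℝ] ℝ) 1, ∀ s : ℝ, 1 ≤ s →
      s ^ K * ‖t.toLin (pullFn g hO hg hG (planeWave (s • ζ)))‖ ≤ C := by
    intro K
    refine (isCompact_sphere (0 : H →L[ℝ] ℝ) 1).induction_on
      (p := fun S => ∃ C : ℝ, ∀ ζ ∈ S, ∀ s : ℝ, 1 ≤ s →
        s ^ K * ‖t.toLin (pullFn g hO hg hG (planeWave (s • ζ)))‖ ≤ C)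
      ⟨0, fun ζ h => h.elim⟩ (fun S S' hS ⟨C, hC⟩ => ⟨C, fun ζ hζ => hC ζ (hS hζ)⟩)
      (fun S S' ⟨C, hC⟩ ⟨C', hC'⟩ => ⟨max C C', fun ζ hζ s hs => ?_⟩) fun ζ₀ hζ₀ => ?_
    · rcases hζ with h | h
      · exact (hC ζ h s hs).trans (le_max_left _ _)
      · exact (hC' ζ h s hs).trans (le_max_right _ _)
    · obtain ⟨_, Z, hZ, h⟩ := key ζ₀ (by simpa using hζ₀)
      exact ⟨Z, mem_nhdsWithin_of_mem_nhds hZ, h K⟩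
  obtain ⟨k, A, hA, hgrow⟩ := hL.exists_growth
  refine hL.exists_smooth_density fun N => ?_
  obtain ⟨C, hC⟩ := hdec N
  refine ⟨|C| + A * 2 ^ k, fun ζ => ?_⟩
  rcases le_total ‖ζ‖ 1 with h | h
  · refine le_add_of_nonneg_of_le (abs_nonneg C) ?_
    calc ‖ζ‖ ^ N * ‖(t.toLin ∘ₗ pullFn g hO hg hG) (planeWave ζ)‖ ≤ 1 * (A * (1 + ‖ζ‖) ^ k) :=
          mul_le_mul (pow_le_one₀ (norm_nonneg _) h) (hgrow ζ) (norm_nonneg _) zero_le_one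
      _ ≤ A * 2 ^ k := by rw [one_mul]; gcongr; linarith
  · refine le_add_of_le_of_nonneg ((le_trans ?_ (hC (‖ζ‖⁻¹ • ζ) ?_ ‖ζ‖ h)).trans
      (le_abs_self C)) (by positivity)
    · rw [smul_smul, mul_inv_cancel₀ (by linarith), one_smul]
      exact le_rfl
    · rw [mem_sphere_zero_iff_norm, norm_smul, norm_inv, norm_norm, inv_mul_cancel₀ (by linarith)]

end Microlocal

/-! ### Smooth densities and push-forward to a manifold -/

section Density

variable {n : ℕ} {Y : Type*} [TopologicalSpace Y] [T2Space Y]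
  [ChartedSpace (EuclideanSpace ℝ (Fin n)) Y] [MeasurableSpace Y] [BorelSpace Y] {μ : Measure Y}

theorem aemeasurable_chart (y : Y) : AEMeasurable (chartAt (EuclideanSpace ℝ (Fin n)) y)
    (μ.restrict (chartAt (EuclideanSpace ℝ (Fin n)) y).source) :=
  (chartAt (EuclideanSpace ℝ (Fin n)) y).continuousOn.aemeasurable
    (chartAt (EuclideanSpace ℝ (Fin n)) y).open_source.measurableSet

theorem IsSmoothPositiveDensity.isLocallyFiniteMeasure (hμ : IsSmoothPositiveDensity n μ) :
    IsLocallyFiniteMeasure μ := by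
  have : LocallyCompactSpace Y := ChartedSpace.locallyCompactSpace (EuclideanSpace ℝ (Fin n)) Y
  refine ⟨fun y => ?_⟩
  obtain ⟨w, hw, hpos, hmap⟩ := hμ y
  set x := chartAt (EuclideanSpace ℝ (Fin n)) y
  obtain ⟨K, hK, hyK, hKs⟩ := exists_compact_subset x.open_source
    (mem_chart_source (EuclideanSpace ℝ (Fin n)) y)
  refine ⟨K, mem_interior_iff_mem_nhds.1 hyK, ?_⟩
  have hxK : IsCompact (x '' K) := hK.image_of_continuousOn (x.continuousOn.mono hKs)
  have hxt : x '' K ⊆ x.target := by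
    rintro _ ⟨q, hq, rfl⟩
    exact x.map_source (hKs hq)
  obtain ⟨A, hA⟩ := hxK.exists_bound_of_continuousOn (hw.continuousOn.mono hxt)
  calc μ K = μ.restrict x.source K := by
        rw [Measure.restrict_apply hK.measurableSet, inter_eq_self_of_subset_left hKs]
    _ ≤ μ.restrict x.source (x ⁻¹' (x '' K)) := measure_mono (subset_preimage_image _ _)
    _ = Measure.map x (μ.restrict x.source) (x '' K) :=
        (Measure.map_apply_of_aemeasurable (aemeasurable_chart y) hxK.measurableSet).symm
    _ = ∫⁻ v in x '' K, ENNReal.ofReal (w v) ∂(volume.restrict x.target) := by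
        rw [hmap, withDensity_apply _ hxK.measurableSet]
    _ ≤ ∫⁻ v in x '' K, ENNReal.ofReal A ∂(volume.restrict x.target) := by
        refine setLIntegral_mono' hxK.measurableSet fun v hv => ENNReal.ofReal_le_ofReal ?_
        exact (le_abs_self _).trans (hA v hv)
    _ < ⊤ := by
        rw [setLIntegral_const]
        refine ENNReal.mul_lt_top ENNReal.ofReal_lt_top ?_
        exact (Measure.restrict_apply_le _ _).trans_lt hxK.measure_lt_top

theorem setIntegral_chart_source {y : Y} {w : EuclideanSpace ℝ (Fin n) → ℝ}
    (hw : ContinuousOn w (chartAt (EuclideanSpace ℝ (Fin n)) y).target)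
    (hpos : ∀ x ∈ (chartAt (EuclideanSpace ℝ (Fin n)) y).target, 0 < w x)
    (hmap : Measure.map (chartAt (EuclideanSpace ℝ (Fin n)) y)
        (μ.restrict (chartAt (EuclideanSpace ℝ (Fin n)) y).source) =
      (volume.restrict (chartAt (EuclideanSpace ℝ (Fin n)) y).target).withDensity
        (fun x => ENNReal.ofReal (w x)))
    {H : EuclideanSpace ℝ (Fin n) → ℂ}
    (hH : ContinuousOn H (chartAt (EuclideanSpace ℝ (Fin n)) y).target) :
    ∫ q in (chartAt (EuclideanSpace ℝ (Fin n)) y).source,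
        H (chartAt (EuclideanSpace ℝ (Fin n)) y q) ∂μ =
      ∫ x in (chartAt (EuclideanSpace ℝ (Fin n)) y).target, (w x : ℂ) * H x := by
  set x := chartAt (EuclideanSpace ℝ (Fin n)) y
  have hms := x.open_target.measurableSet
  have hH1 : AEStronglyMeasurable H (volume.restrict x.target) := hH.aestronglyMeasurable hms
  have hw1 : AEMeasurable w (volume.restrict x.target) := hw.aemeasurable hms
  rw [← integral_map (aemeasurable_chart y) (by
    rw [hmap]; exact hH1.mono_ac (withDensity_absolutelyContinuous _ _)), hmap,
    integral_withDensity_eq_integral_toReal_smul₀ hw1.ennreal_ofReal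
      (ae_of_all _ fun _ => ENNReal.ofReal_lt_top)]
  refine setIntegral_congr_fun hms fun v hv => ?_
  simp only [ENNReal.toReal_ofReal (hpos v hv).le, Complex.real_smul]

end Density

section Pushforward

variable {E : Type*} [NormedAddCommGroup E] [InnerProductSpace ℝ E] [FiniteDimensional ℝ E]
  [MeasurableSpace E] [BorelSpace E]
variable {M : Type*} [TopologicalSpace M] [T2Space M] [SigmaCompactSpace M] [ChartedSpace E M]
  [IsManifold 𝓘(ℝ, E) ∞ M]
variable {E' : Type*} [NormedAddCommGroup E'] [NormedSpace ℝ E'] [FiniteDimensional ℝ E']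
variable {Y : Type*} [TopologicalSpace Y] [T2Space Y] [SigmaCompactSpace Y] [ChartedSpace E' Y]
  [IsManifold 𝓘(ℝ, E') ∞ Y]

theorem tsupport_mul_comp_subset {ψ : M → ℂ} {F : M → Y} {V : Set M} (hV : IsOpen V)
    (hF : ContinuousOn F V) (hψ : tsupport ψ ⊆ V) (θ : Y → ℂ) :
    tsupport (fun q => ψ q * θ (F q)) ⊆ tsupport ψ ∩ F ⁻¹' tsupport θ := by
  refine fun q hq => ?_
  have hq1 : q ∈ tsupport ψ := tsupport_mul_subset_left hq
  refine ⟨hq1, ?_⟩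
  by_contra hn
  have h0 : θ =ᶠ[𝓝 (F q)] 0 := notMem_tsupport_iff_eventuallyEq.1 hn
  have hc : ContinuousAt F q := hF.continuousAt (hV.mem_nhds (hψ hq1))
  refine notMem_tsupport_iff_eventuallyEq.2 ?_ hq
  filter_upwards [hc h0] with q' hq'
  have : θ (F q') = 0 := hq'
  simp [this]

/-- The map `θ ↦ ψ · (θ ∘ F)` on test functions, where `F` is smooth near the support of `ψ` and
proper on it. -/
def pullMul {Ω : Set M} {ψ : M → ℂ} (hψ : ContMDiff 𝓘(ℝ, E) 𝓘(ℝ, ℂ) ∞ ψ) {F : M → Y} {V : Set M}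
    (hV : IsOpen V) (hF : ContMDiffOn 𝓘(ℝ, E) 𝓘(ℝ, E') ∞ F V) (hψV : tsupport ψ ⊆ V)
    (hψΩ : tsupport ψ ⊆ Ω) (hprop : ∀ K : Set Y, IsCompact K → IsCompact (tsupport ψ ∩ F ⁻¹' K)) :
    TestSpace E' (univ : Set Y) →ₗ[ℂ] TestSpace E Ω where
  toFun θ := ⟨fun q => ψ q * (θ : Y → ℂ) (F q), by
    have hsub := tsupport_mul_comp_subset hV hF.continuousOn hψV (θ : Y → ℂ)
    refine ⟨?_, (hprop _ θ.2.2.1).of_isClosed_subset (isClosed_tsupport _) hsub,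
      hsub.trans (inter_subset_left.trans hψΩ)⟩
    refine contMDiff_of_tsupport fun q hq => ?_
    have hqV := hψV (hsub hq).1
    exact contMDiffAt_mul (hψ q) ((θ.2.1 (F q)).comp q ((hF q hqV).contMDiffAt (hV.mem_nhds hqV)))⟩
  map_add' _ _ := TestSpace.ext fun _ => mul_add _ _ _
  map_smul' _ _ := TestSpace.ext fun _ => mul_left_comm _ _ _

theorem exists_testSpace_cutoff {K O Ω : Set M} (hK : IsCompact K) (hO : IsOpen O) (hKO : K ⊆ O)
    (hOΩ : O ⊆ Ω) : ∃ χ : TestSpace E Ω, tsupport (χ : M → ℂ) ⊆ O ∧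
      ∀ᶠ q in 𝓝ˢ K, (χ : M → ℂ) q = 1 := by
  obtain ⟨χ, h1, h2, h3, h4⟩ := exists_smooth_cutoff (E := E) hK hO hKO
  have hsub : tsupport (fun q => (χ q : ℂ)) ⊆ tsupport χ :=
    closure_mono fun q hq h => hq (by simp [h])
  refine ⟨⟨fun q => (χ q : ℂ), Complex.ofRealCLM.contDiff.contMDiff.comp h1,
    h2.of_isClosed_subset (isClosed_tsupport _) hsub, hsub.trans (h3.trans hOΩ)⟩,
    hsub.trans h3, ?_⟩
  filter_upwards [h4] with q hq
  simp [hq]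

end Pushforward

section SmoothPushforward

variable {E : Type*} [NormedAddCommGroup E] [InnerProductSpace ℝ E] [FiniteDimensional ℝ E]
  [MeasurableSpace E] [BorelSpace E]
variable {M : Type*} [TopologicalSpace M] [T2Space M] [SigmaCompactSpace M] [ChartedSpace E M]
  [IsManifold 𝓘(ℝ, E) ∞ M]
variable {n : ℕ} {Y : Type*} [TopologicalSpace Y] [T2Space Y] [SigmaCompactSpace Y]
  [ChartedSpace (EuclideanSpace ℝ (Fin n)) Y] [IsManifold 𝓘(ℝ, EuclideanSpace ℝ (Fin n)) ∞ Y]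
  [MeasurableSpace Y] [BorelSpace Y] {μ : Measure Y}

/-- The push-forward `F_* (ψ t)` is a smooth function if `t` is microlocally smooth in all the
directions that are pulled back by `F` from nonzero covectors. -/
theorem exists_smooth_density_pullMul (hμ : IsSmoothPositiveDensity n μ) {Ω : Set M}
    (t : Distr E Ω) {ψ : M → ℂ} (hψ : ContMDiff 𝓘(ℝ, E) 𝓘(ℝ, ℂ) ∞ ψ) {F : M → Y} {V : Set M}
    (hV : IsOpen V) (hF : ContMDiffOn 𝓘(ℝ, E) 𝓘(ℝ, EuclideanSpace ℝ (Fin n)) ∞ F V)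
    (hψV : tsupport ψ ⊆ V) (hψΩ : tsupport ψ ⊆ Ω)
    (hprop : ∀ K : Set Y, IsCompact K → IsCompact (tsupport ψ ∩ F ⁻¹' K))
    (hms : ∀ y : Y, ∀ p ∈ tsupport ψ, F p ∈ (chartAt (EuclideanSpace ℝ (Fin n)) y).source →
      ∀ ζ : EuclideanSpace ℝ (Fin n) →L[ℝ] ℝ, ‖ζ‖ = 1 → MicrolocallySmoothAt t
        (pullCovector E (fun q => chartAt (EuclideanSpace ℝ (Fin n)) y (F q)) p ζ)) :
    ∃ f : Y → ℂ, ContMDiff 𝓘(ℝ, EuclideanSpace ℝ (Fin n)) 𝓘(ℝ, ℂ) ∞ f ∧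
      ∀ θ : TestSpace (EuclideanSpace ℝ (Fin n)) (univ : Set Y),
        t.toLin (pullMul hψ hV hF hψV hψΩ hprop θ) = ∫ y, f y * (θ : Y → ℂ) y ∂μ := by
  classical
  have hloc : LocallyCompactSpace Y := ChartedSpace.locallyCompactSpace (EuclideanSpace ℝ (Fin n)) Y
  have hfin : IsLocallyFiniteMeasure μ := hμ.isLocallyFiniteMeasure
  set T : TestSpace (EuclideanSpace ℝ (Fin n)) (univ : Set Y) →ₗ[ℂ] ℂ :=
    t.toLin ∘ₗ pullMul hψ hV hF hψV hψΩ hprop with hT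
  let x := fun y : Y => chartAt (EuclideanSpace ℝ (Fin n)) y
  -- The density on a coordinate patch.
  have hpatch : ∀ (y : Y) (χ : TestSpace (EuclideanSpace ℝ (Fin n)) (univ : Set Y)),
      tsupport (χ : Y → ℂ) ⊆ (x y).source → ∃ f : Y → ℂ,
        ContMDiff 𝓘(ℝ, EuclideanSpace ℝ (Fin n)) 𝓘(ℝ, ℂ) ∞ f ∧
        Function.support f ⊆ Function.support (χ : Y → ℂ) ∧
        ∀ θ : TestSpace (EuclideanSpace ℝ (Fin n)) (univ : Set Y),
          T (mulOn χ isOpen_univ (subset_univ _) (θ : Y → ℂ) θ.2.1.contMDiffOn) =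
            ∫ q, f q * (θ : Y → ℂ) q ∂μ := by
    intro y χ hχ
    obtain ⟨w, hw, hpos, hmap⟩ := hμ y
    obtain ⟨χ', hχ's, hχ'1⟩ := exists_testSpace_cutoff (E := EuclideanSpace ℝ (Fin n)) χ.2.2.1
      (x y).open_source hχ (subset_univ _)
    let g : TestSpace E Ω := pullMul hψ hV hF hψV hψΩ hprop χ'
    have hO : IsOpen (V ∩ F ⁻¹' (x y).source) :=
      hF.continuousOn.isOpen_inter_preimage hV (x y).open_source
    have hgs := tsupport_mul_comp_subset hV hF.continuousOn hψV (χ' : Y → ℂ)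
    have hgO : tsupport (g : M → ℂ) ⊆ V ∩ F ⁻¹' (x y).source := fun q hq =>
      ⟨hψV (hgs hq).1, hχ's (hgs hq).2⟩
    have hG : ContMDiffOn 𝓘(ℝ, E) 𝓘(ℝ, EuclideanSpace ℝ (Fin n)) ∞
        (fun q => x y (F q)) (V ∩ F ⁻¹' (x y).source) :=
      (contMDiffOn_chart (I := 𝓘(ℝ, EuclideanSpace ℝ (Fin n)))).comp
        (hF.mono inter_subset_left) fun q hq => hq.2
    obtain ⟨D, hD, hDint⟩ := exists_smooth_density_pullFn g hO hgO hG fun p hp ζ hζ =>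
      hms y p (hgs hp).1 (hχ's (hgs hp).2) ζ hζ
    have hquot : ContMDiffOn 𝓘(ℝ, EuclideanSpace ℝ (Fin n)) 𝓘(ℝ, ℂ) ∞
        (fun q => D (x y q) * ((w (x y q) : ℝ) : ℂ)⁻¹) (x y).source := by
      have h1 : ContDiffOn ℝ ∞ (fun v => D v * ((w v : ℝ) : ℂ)⁻¹) (x y).target :=
        hD.contDiffOn.mul ((Complex.ofRealCLM.contDiff.comp_contDiffOn hw).inv fun v hv => by
          simpa using (hpos v hv).ne')
      exact h1.contMDiffOn.comp (contMDiffOn_chart (I := 𝓘(ℝ, EuclideanSpace ℝ (Fin n))))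
        fun q hq => (x y).map_source hq
    let f : TestSpace (EuclideanSpace ℝ (Fin n)) (univ : Set Y) :=
      mulOn χ (x y).open_source hχ _ hquot
    refine ⟨f, f.2.1, fun q hq h0 => hq ?_, fun θ => ?_⟩
    · change (χ : Y → ℂ) q * _ = 0
      rw [h0, zero_mul]
    · let χθ := mulOn χ isOpen_univ (subset_univ _) (θ : Y → ℂ) θ.2.1.contMDiffOn
      have hχθs : tsupport (χθ : Y → ℂ) ⊆ tsupport (χ : Y → ℂ) := tsupport_mul_subset_left
      have hφc := hasCompactSupport_chartFn χθ.2.2.1 (hχθs.trans hχ)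
      let φ : SmoothFn (EuclideanSpace ℝ (Fin n)) :=
        ⟨chartFn y (χθ : Y → ℂ), contDiff_chartFn χθ.2.1 χθ.2.2.1 (hχθs.trans hχ)⟩
      have h1 : pullMul hψ hV hF hψV hψΩ hprop χθ = pullFn g hO hgO hG φ := by
        refine TestSpace.ext fun q => ?_
        change ψ q * (χθ : Y → ℂ) (F q) = (ψ q * (χ' : Y → ℂ) (F q)) *
          chartFn y (χθ : Y → ℂ) (x y (F q))
        by_cases hq : F q ∈ (x y).source
        · rw [chartFn_apply _ hq, mul_assoc]
          by_cases hq2 : F q ∈ tsupport (χ : Y → ℂ)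
          · rw [hχ'1.self_of_nhdsSet _ hq2, one_mul]
          · rw [TestSpace.eq_zero_of_notMem χθ fun h => hq2 (hχθs h), mul_zero, mul_zero, mul_zero]
        · rw [TestSpace.eq_zero_of_notMem χθ fun h => hq (hχ (hχθs h)),
            TestSpace.eq_zero_of_notMem χ' fun h => hq (hχ's h), mul_zero, zero_mul]
      have h2 : T χθ = ∫ v, D v * chartFn y (χθ : Y → ℂ) v := by
        rw [hT, LinearMap.comp_apply, h1]
        exact hDint φ hφc
      have hH : ContinuousOn (fun v => ((w v : ℝ) : ℂ)⁻¹ * (D v * chartFn y (χθ : Y → ℂ) v))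
          (x y).target := by
        refine ContinuousOn.mul (ContinuousOn.inv₀ ?_ fun v hv => ?_)
          (hD.continuous.mul (SmoothFn.contDiff φ).continuous).continuousOn
        · exact Complex.continuous_ofReal.comp_continuousOn hw.continuousOn
        · simpa using (hpos v hv).ne'
      have h3 := setIntegral_chart_source hw.continuousOn hpos hmap hH
      have h4 : ∀ q, q ∉ (x y).source → (f : Y → ℂ) q * (θ : Y → ℂ) q = 0 := fun q hq => by
        change (χ : Y → ℂ) q * _ * _ = 0
        rw [TestSpace.eq_zero_of_notMem χ fun h => hq (hχ h), zero_mul, zero_mul]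
      have h5 : ∀ v, v ∉ (x y).target → D v * chartFn y (χθ : Y → ℂ) v = 0 := fun v hv => by
        rw [chartFn, indicator_of_notMem hv, mul_zero]
      rw [h2, ← setIntegral_eq_integral_of_forall_compl_eq_zero h4,
        ← setIntegral_eq_integral_of_forall_compl_eq_zero h5]
      calc ∫ v in (x y).target, D v * chartFn y (χθ : Y → ℂ) v
          = ∫ v in (x y).target, (w v : ℂ) *
              (((w v : ℝ) : ℂ)⁻¹ * (D v * chartFn y (χθ : Y → ℂ) v)) := by
            refine setIntegral_congr_fun (x y).open_target.measurableSet fun v hv => ?_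
            have : ((w v : ℝ) : ℂ) ≠ 0 := by simpa using (hpos v hv).ne'
            rw [← mul_assoc, mul_inv_cancel₀ this, one_mul]
        _ = _ := h3.symm
        _ = _ := by
            refine setIntegral_congr_fun (x y).open_source.measurableSet fun q hq => ?_
            rw [chartFn_apply _ hq]
            change _ * (_ * ((χ : Y → ℂ) q * (θ : Y → ℂ) q)) =
              (χ : Y → ℂ) q * (D (x y q) * ((w (x y q) : ℝ) : ℂ)⁻¹) * (θ : Y → ℂ) q
            ring
  -- Globalization by a partition of unity.
  have hnb : ∀ y : Y, ∃ K : Set Y, IsCompact K ∧ y ∈ interior K ∧ K ⊆ (x y).source := fun y =>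
    exists_compact_subset (x y).open_source (mem_chart_source (EuclideanSpace ℝ (Fin n)) y)
  choose K hK hyK hKs using hnb
  obtain ⟨u, hu⟩ := SmoothPartitionOfUnity.exists_isSubordinate 𝓘(ℝ, EuclideanSpace ℝ (Fin n))
    (isClosed_univ (X := Y)) (fun y => interior (K y)) (fun y => isOpen_interior)
    (fun y _ => mem_iUnion.2 ⟨y, hyK y⟩)
  have husupp : ∀ y, tsupport (fun q => (u y q : ℂ)) ⊆ K y := fun y => by
    have h0 : Function.support (fun q => (u y q : ℂ)) ⊆ Function.support (u y) :=
      fun q hq h => hq (by simp [h])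
    exact (closure_mono h0).trans ((hu y).trans interior_subset)
  let χ : Y → TestSpace (EuclideanSpace ℝ (Fin n)) (univ : Set Y) := fun y =>
    ⟨fun q => (u y q : ℂ), Complex.ofRealCLM.contDiff.contMDiff.comp (u y).contMDiff,
      (hK y).of_isClosed_subset (isClosed_tsupport _) (husupp y), subset_univ _⟩
  choose f hf hfs hfint using fun y => hpatch y (χ y) ((husupp y).trans (hKs y))
  have hlf : LocallyFinite fun y => Function.support (f y) :=
    u.locallyFinite.subset fun y q hq h => hfs y hq (by
      have h' : u y q = 0 := h
      simp [χ, h'])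
  refine ⟨fun q => ∑ᶠ y, f y q, contMDiff_finsum hf hlf, fun θ => ?_⟩
  have hfinset := u.locallyFinite.finite_nonempty_inter_compact θ.2.2.1
  set s := hfinset.toFinset with hs
  have huz : ∀ y, y ∉ s → ∀ q ∈ tsupport (θ : Y → ℂ), u y q = 0 := by
    intro y hy q hq
    by_contra hne
    exact hy (hfinset.mem_toFinset.2 ⟨q, hne, hq⟩)
  have hθ : θ = ∑ y ∈ s, mulOn (χ y) isOpen_univ (subset_univ _) (θ : Y → ℂ) θ.2.1.contMDiffOn := by
    refine TestSpace.ext fun q => ?_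
    have h1 : ((∑ y ∈ s, mulOn (χ y) isOpen_univ (subset_univ _) (θ : Y → ℂ) θ.2.1.contMDiffOn :
        TestSpace (EuclideanSpace ℝ (Fin n)) (univ : Set Y)) : Y → ℂ) q =
        ∑ y ∈ s, (u y q : ℂ) * (θ : Y → ℂ) q := by
      rw [Submodule.coe_sum, Finset.sum_apply]
      rfl
    rw [h1, ← Finset.sum_mul]
    by_cases hq : q ∈ tsupport (θ : Y → ℂ)
    · have h2 := u.sum_eq_one (mem_univ q)
      rw [finsum_eq_sum_of_support_subset _ (s := s) (fun y hy => by
        by_contra hn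
        exact hy (huz y hn q hq))] at h2
      rw [← Complex.ofReal_sum, h2, Complex.ofReal_one, one_mul]
    · rw [TestSpace.eq_zero_of_notMem θ hq, mul_zero]
  have hfθ : ∀ q, (∑ᶠ y, f y q) * (θ : Y → ℂ) q = ∑ y ∈ s, f y q * (θ : Y → ℂ) q := by
    intro q
    rw [← Finset.sum_mul]
    by_cases hq : q ∈ tsupport (θ : Y → ℂ)
    · rw [finsum_eq_sum_of_support_subset]
      intro y hy
      by_contra hn
      exact hfs y hy (by simp [χ, huz y hn q hq])
    · rw [TestSpace.eq_zero_of_notMem θ hq, mul_zero, mul_zero]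
  change T θ = _
  simp only [hfθ]
  have hint : ∀ y ∈ s, Integrable (fun q => f y q * (θ : Y → ℂ) q) μ := fun y _ =>
    ((hf y).continuous.mul θ.2.1.continuous).integrable_of_hasCompactSupport θ.2.2.1.mul_left
  rw [integral_finsetSum s hint]
  conv_lhs => rw [hθ]
  rw [map_sum]
  exact Finset.sum_congr rfl fun y _ => hfint y θ

end SmoothPushforward

/-! ### Derivatives of distributions along vector fields -/

section FieldDerivative

variable {E : Type*} [NormedAddCommGroup E] [NormedSpace ℝ E]
variable {M : Type*} [TopologicalSpace M] [ChartedSpace E M] [IsManifold 𝓘(ℝ, E) ∞ M]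

theorem contMDiffOn_mfderiv_apply {F : Type*} [NormedAddCommGroup F] [NormedSpace ℝ F] {G : M → F}
    {O : Set M} (hO : IsOpen O) (hG : ContMDiffOn 𝓘(ℝ, E) 𝓘(ℝ, F) ∞ G O)
    {X : ∀ p : M, TangentSpace 𝓘(ℝ, E) p} (hX : SmoothField O X) :
    ContMDiffOn 𝓘(ℝ, E) 𝓘(ℝ, F) ∞ (fun q => (mfderiv 𝓘(ℝ, E) 𝓘(ℝ, F) G q (X q) : F)) O := by
  have k1 := hG.contMDiffOn_tangentMapWithin (m := ∞) (by simp) hO.uniqueMDiffOn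
  have k2 := k1.comp hX (fun q hq => hq)
  have k3 := contMDiff_snd_tangentBundle_modelSpace F 𝓘(ℝ, F) (n := ∞)
  refine (k3.comp_contMDiffOn k2).congr fun q hq => ?_
  change _ = (mfderivWithin 𝓘(ℝ, E) 𝓘(ℝ, F) G O q (X q) : F)
  rw [mfderivWithin_of_isOpen hO hq]

theorem SmoothField.mono {W W' : Set M} {X : ∀ p : M, TangentSpace 𝓘(ℝ, E) p}
    (h : SmoothField W X) (hW : W' ⊆ W) : SmoothField W' X :=
  ContMDiffOn.mono h hW

/-- The components of the vector field `X` in the chart at `p`. -/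
def fieldCoord (p : M) (X : ∀ p : M, TangentSpace 𝓘(ℝ, E) p) (q : M) : E :=
  mfderiv 𝓘(ℝ, E) 𝓘(ℝ, E) (chartAt E p) q (X q)

theorem contMDiffOn_fieldCoord (p : M) {W : Set M} (hW : IsOpen W)
    {X : ∀ p : M, TangentSpace 𝓘(ℝ, E) p} (hX : SmoothField W X) :
    ContMDiffOn 𝓘(ℝ, E) 𝓘(ℝ, E) ∞ (fieldCoord p X) ((chartAt E p).source ∩ W) :=
  contMDiffOn_mfderiv_apply ((chartAt E p).open_source.inter hW)
    ((contMDiffOn_chart (I := 𝓘(ℝ, E))).mono inter_subset_left) (hX.mono inter_subset_right)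

theorem mdifferentiableAt_chart {p q : M} (hq : q ∈ (chartAt E p).source) :
    MDifferentiableAt 𝓘(ℝ, E) 𝓘(ℝ, E) (chartAt E p) q :=
  ((contMDiffOn_chart (n := ∞) (I := 𝓘(ℝ, E)) (x := p)).contMDiffAt
    ((chartAt E p).open_source.mem_nhds hq)).mdifferentiableAt (by simp)

theorem mfderiv_apply_eq_fderiv_comp_chart {F : Type*} [NormedAddCommGroup F] [NormedSpace ℝ F]
    (p : M) {q : M} (hq : q ∈ (chartAt E p).source) {G : M → F} {u : E → F}
    (hu : DifferentiableAt ℝ u (chartAt E p q)) (hGu : G =ᶠ[𝓝 q] u ∘ chartAt E p)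
    (v : TangentSpace 𝓘(ℝ, E) q) :
    mfderiv 𝓘(ℝ, E) 𝓘(ℝ, F) G q v =
      fderiv ℝ u (chartAt E p q) (mfderiv 𝓘(ℝ, E) 𝓘(ℝ, E) (chartAt E p) q v) := by
  rw [hGu.mfderiv_eq]
  have h1 := (hu.hasFDerivAt.hasMFDerivAt.comp q (mdifferentiableAt_chart hq).hasMFDerivAt).mfderiv
  rw [h1]
  rfl

theorem dirDeriv_congr {X : ∀ p : M, TangentSpace 𝓘(ℝ, E) p} {f g : M → ℂ} {q : M}
    (h : f =ᶠ[𝓝 q] g) : dirDeriv X f q = dirDeriv X g q := by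
  rw [dirDeriv, dirDeriv, h.mfderiv_eq]
  rfl

theorem tsupport_dirDeriv_subset (X : ∀ p : M, TangentSpace 𝓘(ℝ, E) p) (φ : M → ℂ) :
    tsupport (dirDeriv X φ) ⊆ tsupport φ := by
  refine closure_minimal (fun p hp => ?_) (isClosed_tsupport φ)
  by_contra hn
  refine hp ?_
  have h0 : φ =ᶠ[𝓝 p] fun _ => (0 : ℂ) := notMem_tsupport_iff_eventuallyEq.1 hn
  rw [dirDeriv_congr h0, dirDeriv, mfderiv_const]
  rfl

theorem dirDeriv_mul (X : ∀ p : M, TangentSpace 𝓘(ℝ, E) p) {f g : M → ℂ} {q : M}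
    (hf : MDifferentiableAt 𝓘(ℝ, E) 𝓘(ℝ, ℂ) f q) (hg : MDifferentiableAt 𝓘(ℝ, E) 𝓘(ℝ, ℂ) g q) :
    dirDeriv X (fun r => f r * g r) q = f q * dirDeriv X g q + g q * dirDeriv X f q := by
  have := (hf.hasMFDerivAt.mul hg.hasMFDerivAt).mfderiv
  change (mfderiv 𝓘(ℝ, E) 𝓘(ℝ, ℂ) (f * g) q : _) (X q) = _
  rw [this]
  rfl

end FieldDerivative

section DistrDerivative

variable {E : Type} [NormedAddCommGroup E] [InnerProductSpace ℝ E] [FiniteDimensional ℝ E]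
  [MeasurableSpace E] [BorelSpace E]
variable {M : Type*} [TopologicalSpace M] [T2Space M] [SigmaCompactSpace M] [ChartedSpace E M]
  [IsManifold 𝓘(ℝ, E) ∞ M]

/-- Uniform bounds for the derivatives of `y ↦ dφ_y (X y)` by those of `φ`. -/
theorem exists_bound_iteratedFDeriv_fderiv_apply {X : E → E} (hX : ContDiff ℝ ∞ X) {K : Set E}
    (hK : IsCompact K) (k : ℕ) :
    ∃ C : ℝ, ∀ (φ ψ : E → ℂ) (B : ℝ), ContDiff ℝ ∞ ψ → ∀ x ∈ K,
      φ =ᶠ[𝓝 x] (fun y => fderiv ℝ ψ y (X y)) →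
      (∀ j ≤ k + 1, ‖iteratedFDeriv ℝ j ψ x‖ ≤ B) →
      ∀ j ≤ k, ‖iteratedFDeriv ℝ j φ x‖ ≤ C * B := by
  obtain ⟨A, hA1, hA⟩ := exists_bound_iteratedFDeriv hX hK k
  refine ⟨2 ^ k * A, fun φ ψ B hψ x hx he hB j hj => ?_⟩
  have hB0 : 0 ≤ B := (norm_nonneg _).trans (hB 0 (Nat.zero_le _))
  rw [(Filter.EventuallyEq.iteratedFDeriv ℝ he j).self_of_nhds]
  refine (norm_iteratedFDeriv_clm_apply (hψ.fderiv_right (m := ∞) (by simp)) hX x (n := j)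
    (by exact_mod_cast le_top)).trans ?_
  calc ∑ i ∈ Finset.range (j + 1), (j.choose i : ℝ) * ‖iteratedFDeriv ℝ i (fderiv ℝ ψ) x‖ *
        ‖iteratedFDeriv ℝ (j - i) X x‖
      ≤ ∑ i ∈ Finset.range (j + 1), (j.choose i : ℝ) * B * A := by
        refine Finset.sum_le_sum fun i hi => ?_
        have hi' : i ≤ j := Nat.le_of_lt_succ (Finset.mem_range.1 hi)
        rw [norm_iteratedFDeriv_fderiv]
        gcongr
        · exact hB _ (by omega)
        · exact hA _ ((Nat.sub_le _ _).trans hj) x hx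
    _ = 2 ^ j * (B * A) := by
        rw [← Finset.sum_mul, ← Finset.sum_mul, ← Nat.cast_sum, Nat.sum_range_choose]
        push_cast
        ring
    _ ≤ 2 ^ k * (B * A) := by
        gcongr
        norm_num
    _ = _ := by ring

/-- The derivative `⟨X T, φ⟩ = -⟨T, X φ⟩` of a distribution along a vector field. -/
def Distr.deriv {W : Set M} (hW : IsOpen W) {X : ∀ p : M, TangentSpace 𝓘(ℝ, E) p}
    (hX : SmoothField W X) (T : Distr E W) : Distr E W where
  toLin := -(T.toLin ∘ₗ derivTest hW X hX)
  isDistribution := by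
    intro p K hK hKs
    have hKs1 : K ⊆ (chartAt E p).source := hKs.trans inter_subset_left
    obtain ⟨k, C, hC⟩ := T.isDistribution p K hK hKs
    have hxK := isCompact_chart_image hK hKs1
    obtain ⟨X', hX', heX⟩ := exists_contDiff_extension hxK
      (isOpen_chart_target_inter ((chartAt E p).open_source.inter hW) p) (by
        rintro _ ⟨q, hq, rfl⟩
        exact ⟨(chartAt E p).map_source (hKs1 hq), by
          rw [mem_preimage, (chartAt E p).left_inv (hKs1 hq)]; exact hKs hq⟩)
      (contDiffOn_comp_chart_symm (contMDiffOn_fieldCoord p hW hX) p)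
    obtain ⟨C', hC'⟩ := exists_bound_iteratedFDeriv_fderiv_apply hX' hxK k
    refine ⟨k + 1, C * C', fun φ B hφ hB => ?_⟩
    rw [mul_assoc, LinearMap.neg_apply, norm_neg, LinearMap.comp_apply]
    refine hC _ _ ((tsupport_dirDeriv_subset X φ).trans hφ) fun j hj q hq => ?_
    have hqs := hKs1 hq
    have hqt := (chartAt E p).map_source hqs
    have hcd : ContDiff ℝ ∞ (chartFn (E := E) p (φ : M → ℂ)) :=
      contDiff_chartFn φ.2.1 φ.2.2.1 (hφ.trans hKs1)
    have heq : ∀ v ∈ (chartAt E p).target, chartFn (E := E) p (φ : M → ℂ) =ᶠ[𝓝 v]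
        (φ : M → ℂ) ∘ (chartAt E p).symm := fun v hv => by
      filter_upwards [(chartAt E p).open_target.mem_nhds hv] with w hw
      exact indicator_of_mem hw _
    refine hC' _ (chartFn p (φ : M → ℂ)) B hcd _ (mem_image_of_mem _ hq) ?_ (fun j hj => ?_) j hj
    · filter_upwards [(nhds_le_nhdsSet (mem_image_of_mem _ hq)) heX,
        (chartAt E p).open_target.mem_nhds hqt] with v hv hvt
      have hvs := (chartAt E p).map_target hvt
      rw [hv, Function.comp_apply, Function.comp_apply]
      change (mfderiv 𝓘(ℝ, E) 𝓘(ℝ, ℂ) (φ : M → ℂ) ((chartAt E p).symm v) (X _) : ℂ) = _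
      rw [mfderiv_apply_eq_fderiv_comp_chart p hvs (hcd.differentiable (by simp) _),
        (chartAt E p).right_inv hvt]
      · rfl
      · filter_upwards [(chartAt E p).open_source.mem_nhds hvs] with r hr
        exact (chartFn_apply _ hr).symm
    · rw [(Filter.EventuallyEq.iteratedFDeriv ℝ (heq _ hqt) j).self_of_nhds]
      exact hB j hj q hq

theorem pullCovector_chart (x : Cotangent E M) :
    pullCovector E (chartAt E x.proj) x.proj (coordCovector E x) = x := by
  obtain ⟨p, η⟩ := x
  have hp := mem_chart_source E p
  have h1 : MDifferentiableAt 𝓘(ℝ, E) 𝓘(ℝ, E) (chartAt E p).symm (chartAt E p p) :=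
    ((contMDiffOn_chart_symm (n := ∞) (I := 𝓘(ℝ, E)) (x := p)).contMDiffAt
      ((chartAt E p).open_target.mem_nhds ((chartAt E p).map_source hp))).mdifferentiableAt
        (by simp)
  have h2 := (h1.hasMFDerivAt.comp p (mdifferentiableAt_chart hp).hasMFDerivAt).mfderiv
  have h3 : (chartAt E p).symm ∘ chartAt E p =ᶠ[𝓝 p] id := by
    filter_upwards [(chartAt E p).open_source.mem_nhds hp] with q hq
    exact (chartAt E p).left_inv hq
  rw [h3.mfderiv_eq, mfderiv_id] at h2
  have h4 : ((η : E →L[ℝ] ℝ).comp (mfderiv 𝓘(ℝ, E) 𝓘(ℝ, E) (chartAt E p).symm (chartAt E p p) :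
      E →L[ℝ] E)).comp (mfderiv 𝓘(ℝ, E) 𝓘(ℝ, E) (chartAt E p) p : E →L[ℝ] E) = η := by
    ext v
    have := congrArg (fun L : E →L[ℝ] E => (η : E →L[ℝ] ℝ) (L v)) h2
    exact this.symm
  change (⟨p, _⟩ : Cotangent E M) = ⟨p, η⟩
  congr 1

/-- Derivatives along vector fields do not increase the wave front set. -/
theorem MicrolocallySmoothAt.deriv {W : Set M} (hW : IsOpen W)
    {X : ∀ p : M, TangentSpace 𝓘(ℝ, E) p} (hX : SmoothField W X) {T : Distr E W}
    {x : Cotangent E M} (hx : x.proj ∈ W) (h : MicrolocallySmoothAt T x) :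
    MicrolocallySmoothAt (T.deriv hW hX) x := by
  set p := x.proj
  have hp := mem_chart_source E p
  rw [← pullCovector_chart x] at h
  obtain ⟨N, hN, hNs, Z, hZ, hdec⟩ := h.exists_nhds (chartAt E p).open_source hp
    (contMDiffOn_chart (I := 𝓘(ℝ, E)))
  obtain ⟨χ, hχN, hχ1⟩ := exists_testSpace_cutoff (E := E) (isCompact_singleton (x := p))
    (isOpen_interior.inter hW) (singleton_subset_iff.2
      ⟨mem_interior_iff_mem_nhds.2 hN, hx⟩) (inter_subset_right (s := interior N))
  have hχN' : tsupport (χ : M → ℂ) ⊆ N := hχN.trans (inter_subset_left.trans interior_subset)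
  have hχs := hχN'.trans hNs
  let b := Module.finBasis ℝ E
  -- The test functions `X χ` and `χ X^i`, where `X^i` are the components of `X`.
  let g₀ : TestSpace E W := derivTest hW X hX χ
  have hcs : IsOpen ((chartAt E p).source ∩ W) := (chartAt E p).open_source.inter hW
  let g : Fin (Module.finrank ℝ E) → TestSpace E W := fun i =>
    mulOn χ hcs (subset_inter hχs χ.2.2.2) (fun q => ((b.repr (fieldCoord p X q) i : ℝ) : ℂ)) (by
      have h1 : ContDiff ℝ ∞ fun v : E => ((b.repr v i : ℝ) : ℂ) :=
        Complex.ofRealCLM.contDiff.comp (LinearMap.toContinuousLinearMap (b.coord i)).contDiff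
      exact h1.contMDiff.comp_contMDiffOn (contMDiffOn_fieldCoord p hW hX))
  have hg₀ : tsupport (g₀ : M → ℂ) ⊆ N := (tsupport_dirDeriv_subset X χ).trans hχN'
  have hg : ∀ i, tsupport (g i : M → ℂ) ⊆ N := fun i => tsupport_mul_subset_left.trans hχN'
  have hform : ∀ (ζ : E →L[ℝ] ℝ) (s : ℝ), (T.deriv hW hX).toLin (oscTest p χ hχs ζ s) =
      -T.toLin (pullFn g₀ (chartAt E p).open_source (hg₀.trans hNs)
        (contMDiffOn_chart (I := 𝓘(ℝ, E))) (planeWave (s • ζ))) +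
      ∑ i, (Complex.I * (s * ζ (b i) : ℝ)) * T.toLin (pullFn (g i) (chartAt E p).open_source
        ((hg i).trans hNs) (contMDiffOn_chart (I := 𝓘(ℝ, E))) (planeWave (s • ζ))) := by
    intro ζ s
    have h1 : derivTest hW X hX (oscTest p χ hχs ζ s) =
        pullFn g₀ (chartAt E p).open_source (hg₀.trans hNs)
        (contMDiffOn_chart (I := 𝓘(ℝ, E))) (planeWave (s • ζ)) -
      ∑ i, (Complex.I * (s * ζ (b i) : ℝ)) • pullFn (g i) (chartAt E p).open_source
        ((hg i).trans hNs) (contMDiffOn_chart (I := 𝓘(ℝ, E))) (planeWave (s • ζ)) := by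
      refine TestSpace.ext fun q => ?_
      have hR : ((pullFn g₀ (chartAt E p).open_source (hg₀.trans hNs)
        (contMDiffOn_chart (I := 𝓘(ℝ, E))) (planeWave (s • ζ)) -
          ∑ i, (Complex.I * (s * ζ (b i) : ℝ)) • pullFn (g i) (chartAt E p).open_source
        ((hg i).trans hNs) (contMDiffOn_chart (I := 𝓘(ℝ, E))) (planeWave (s • ζ)) :
          TestSpace E W) : M → ℂ) q = dirDeriv X χ q * (planeWave (s • ζ) : E → ℂ) (chartAt E p q) -
          ∑ i, (Complex.I * (s * ζ (b i) : ℝ)) * ((χ : M → ℂ) q *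
            ((b.repr (fieldCoord p X q) i : ℝ) : ℂ) *
              (planeWave (s • ζ) : E → ℂ) (chartAt E p q)) := by
        rw [Submodule.coe_sub, Submodule.coe_sum, Pi.sub_apply, Finset.sum_apply]
        rfl
      rw [hR]
      change dirDeriv X (fun r => (χ : M → ℂ) r * (planeWave (s • ζ) : E → ℂ) (chartAt E p r)) q = _
      by_cases hq : q ∈ tsupport (χ : M → ℂ)
      · have hqs := hχs hq
        have hpw : DifferentiableAt ℝ (planeWave (s • ζ) : E → ℂ) (chartAt E p q) :=
          (SmoothFn.contDiff (planeWave (s • ζ))).differentiable (by simp) _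
        have hdw : HasFDerivAt (planeWave (s • ζ) : E → ℂ)
            ((Complex.exp (-Complex.I * (((s • ζ) (chartAt E p q) : ℝ) : ℂ)) * -Complex.I) •
              (Complex.ofRealCLM.comp (s • ζ))) (chartAt E p q) := by
          have h1 : HasFDerivAt (fun v : E => -Complex.I * (((s • ζ) v : ℝ) : ℂ))
              (-Complex.I • (Complex.ofRealCLM.comp (s • ζ))) (chartAt E p q) :=
            ((Complex.ofRealCLM.comp (s • ζ)).hasFDerivAt).const_mul (-Complex.I)
          have h2 := h1.cexp
          rw [smul_smul] at h2
          exact h2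
        have hpm : MDifferentiableAt 𝓘(ℝ, E) 𝓘(ℝ, ℂ)
            (fun r => (planeWave (s • ζ) : E → ℂ) (chartAt E p r)) q :=
          hpw.mdifferentiableAt.comp q (mdifferentiableAt_chart hqs)
        rw [dirDeriv_mul X (χ.2.1.mdifferentiableAt (by simp)) hpm]
        have h2 : dirDeriv X (fun r => (planeWave (s • ζ) : E → ℂ) (chartAt E p r)) q =
            -(Complex.I * (planeWave (s • ζ) : E → ℂ) (chartAt E p q) *
              ((s * ζ (fieldCoord p X q) : ℝ) : ℂ)) := by
          have h5 : dirDeriv X (fun r => (planeWave (s • ζ) : E → ℂ) (chartAt E p r)) q =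
              fderiv ℝ (planeWave (s • ζ) : E → ℂ) (chartAt E p q) (fieldCoord p X q) :=
            mfderiv_apply_eq_fderiv_comp_chart p hqs hpw EventuallyEq.rfl (X q)
          rw [h5, hdw.fderiv]
          change (Complex.exp (-Complex.I * (((s • ζ) (chartAt E p q) : ℝ) : ℂ)) * -Complex.I) *
            (((s • ζ) (fieldCoord p X q) : ℝ) : ℂ) = -(Complex.I * Complex.exp
              (-Complex.I * (((s • ζ) (chartAt E p q) : ℝ) : ℂ)) *
                ((s * ζ (fieldCoord p X q) : ℝ) : ℂ))
          have h6 : (s • ζ) (fieldCoord p X q) = s * ζ (fieldCoord p X q) := rfl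
          rw [h6]
          ring
        have h3 : ζ (fieldCoord p X q) = ∑ i, b.repr (fieldCoord p X q) i * ζ (b i) := by
          conv_lhs => rw [← b.sum_repr (fieldCoord p X q)]
          rw [map_sum]
          simp
        rw [h2, h3, Finset.mul_sum, Complex.ofReal_sum, Finset.mul_sum, ← Finset.sum_neg_distrib,
          Finset.mul_sum, add_comm, sub_eq_add_neg, ← Finset.sum_neg_distrib, mul_comm]
        congr 1
        refine Finset.sum_congr rfl fun i _ => ?_
        push_cast
        ring
      · have h0 : dirDeriv X (fun r => (χ : M → ℂ) r * (planeWave (s • ζ) : E → ℂ)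
            (chartAt E p r)) q = 0 :=
          image_eq_zero_of_notMem_tsupport fun h => hq (tsupport_mul_subset_left
            (tsupport_dirDeriv_subset X _ h))
        have h1 : dirDeriv X χ q = 0 :=
          image_eq_zero_of_notMem_tsupport fun h => hq (tsupport_dirDeriv_subset X _ h)
        rw [h0, h1, TestSpace.eq_zero_of_notMem χ hq]
        simp
    change -(T.toLin (derivTest hW X hX (oscTest p χ hχs ζ s))) = _
    rw [h1, map_sub, map_sum, neg_sub, sub_eq_neg_add]
    congr 1
    refine Finset.sum_congr rfl fun i _ => ?_
    rw [map_smul, smul_eq_mul]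
  set ζ₀ := coordCovector E x
  refine ⟨χ, hχs, ?_, Z ∩ Metric.ball ζ₀ 1, inter_mem hZ (Metric.ball_mem_nhds _ one_pos),
    fun K => ?_⟩
  · rw [hχ1.self_of_nhdsSet p rfl]
    exact one_ne_zero
  obtain ⟨C₀, hC₀⟩ := hdec g₀ hg₀ K
  choose C hC using fun i => hdec (g i) (hg i) (K + 1)
  refine ⟨C₀ + ∑ i, (‖ζ₀‖ + 1) * ‖b i‖ * C i, fun ζ hζ s hs => ?_⟩
  have hs0 : 0 ≤ s := by linarith
  change s ^ K * ‖(T.deriv hW hX).toLin (oscTest p χ hχs ζ s)‖ ≤ _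
  rw [hform]
  refine (mul_le_mul_of_nonneg_left ((norm_add_le _ _).trans (add_le_add_right
    (norm_sum_le _ _) _)) (pow_nonneg hs0 K)).trans ?_
  rw [mul_add, norm_neg, Finset.mul_sum]
  refine add_le_add (hC₀ ζ hζ.1 s hs) (Finset.sum_le_sum fun i _ => ?_)
  have hζn : ‖ζ‖ ≤ ‖ζ₀‖ + 1 := by
    have h1 := norm_sub_norm_le ζ ζ₀
    have h2 : ‖ζ - ζ₀‖ < 1 := by simpa [dist_eq_norm] using hζ.2
    linarith
  rw [norm_mul, norm_mul, Complex.norm_I, one_mul, Complex.norm_real, norm_mul,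
    Real.norm_of_nonneg hs0]
  have h3 := hC i ζ hζ.1 s hs
  have h4 : ‖ζ (b i)‖ ≤ (‖ζ₀‖ + 1) * ‖b i‖ := (ζ.le_opNorm _).trans (by gcongr)
  calc _ = ‖ζ (b i)‖ * (s ^ (K + 1) * ‖T.toLin (pullFn (g i) (chartAt E p).open_source
        ((hg i).trans hNs) (contMDiffOn_chart (I := 𝓘(ℝ, E))) (planeWave (s • ζ)))‖) := by ring
    _ ≤ _ := mul_le_mul h4 h3 (by positivity) (by positivity)

end DistrDerivative

/-! ### Iterated transverse derivatives -/

section Iterated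

variable {E : Type*} [NormedAddCommGroup E] [NormedSpace ℝ E]
variable {M : Type*} [TopologicalSpace M] [ChartedSpace E M] [IsManifold 𝓘(ℝ, E) ∞ M]

theorem contMDiffOn_dirDeriv {O : Set M} (hO : IsOpen O) {X : ∀ p : M, TangentSpace 𝓘(ℝ, E) p}
    (hX : SmoothField O X) {f : M → ℂ} (hf : ContMDiffOn 𝓘(ℝ, E) 𝓘(ℝ, ℂ) ∞ f O) :
    ContMDiffOn 𝓘(ℝ, E) 𝓘(ℝ, ℂ) ∞ (dirDeriv X f) O :=
  contMDiffOn_mfderiv_apply hO hf hX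

theorem dirDeriv_eqOn {O : Set M} (hO : IsOpen O) (X : ∀ p : M, TangentSpace 𝓘(ℝ, E) p)
    {f g : M → ℂ} (h : EqOn f g O) : EqOn (dirDeriv X f) (dirDeriv X g) O := fun q hq =>
  dirDeriv_congr (by filter_upwards [hO.mem_nhds hq] with r hr using h hr)

theorem dirDeriv_add_apply (X : ∀ p : M, TangentSpace 𝓘(ℝ, E) p) {f g : M → ℂ} {q : M}
    (hf : MDifferentiableAt 𝓘(ℝ, E) 𝓘(ℝ, ℂ) f q) (hg : MDifferentiableAt 𝓘(ℝ, E) 𝓘(ℝ, ℂ) g q) :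
    dirDeriv X (f + g) q = dirDeriv X f q + dirDeriv X g q := by
  have := mfderiv_add hf hg
  rw [dirDeriv, this]
  rfl

theorem dirDeriv_smul_apply (X : ∀ p : M, TangentSpace 𝓘(ℝ, E) p) (c : ℂ) {f : M → ℂ} {q : M}
    (hf : MDifferentiableAt 𝓘(ℝ, E) 𝓘(ℝ, ℂ) f q) :
    dirDeriv X (c • f) q = c * dirDeriv X f q := by
  have h1 : c • f = fun r => (fun _ => c) r * f r := rfl
  have h2 : dirDeriv X (fun _ : M => c) q = 0 := by
    rw [dirDeriv, mfderiv_const]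
    rfl
  rw [h1, dirDeriv_mul X mdifferentiableAt_const hf, h2, mul_zero, add_zero]

theorem mfderiv_chart_symm_inverse (p : M) {v : E} (hv : v ∈ (chartAt E p).target) :
    (mfderivWithin 𝓘(ℝ, E) 𝓘(ℝ, E) (extChartAt 𝓘(ℝ, E) p).symm (range 𝓘(ℝ, E)) v).inverse =
      mfderiv 𝓘(ℝ, E) 𝓘(ℝ, E) (extChartAt 𝓘(ℝ, E) p) ((extChartAt 𝓘(ℝ, E) p).symm v) := by
  have hv' : v ∈ (extChartAt 𝓘(ℝ, E) p).target := by simpa using hv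
  apply ContinuousLinearMap.inverse_eq
  · exact mfderivWithin_extChartAt_symm_comp_mfderiv_extChartAt hv'
  · exact mfderiv_extChartAt_comp_mfderivWithin_extChartAt_symm hv'

/-- Vector fields with vanishing Lie bracket commute as differential operators. -/
theorem dirDeriv_comm [FiniteDimensional ℝ E] [T2Space M] [SigmaCompactSpace M] {O : Set M}
    (hO : IsOpen O)
    {V W : ∀ p : M, TangentSpace 𝓘(ℝ, E) p} (hV : SmoothField O V) (hW : SmoothField O W) {q : M}
    (hq : q ∈ O) (hVW : VectorField.mlieBracket 𝓘(ℝ, E) V W q = 0) {f : M → ℂ}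
    (hf : ContMDiffOn 𝓘(ℝ, E) 𝓘(ℝ, ℂ) ∞ f O) :
    dirDeriv V (dirDeriv W f) q = dirDeriv W (dirDeriv V f) q := by
  set x := chartAt E q with hx
  have hqs : q ∈ x.source := mem_chart_source E q
  have hqt : x q ∈ x.target := x.map_source hqs
  have hOt : IsOpen (x.target ∩ x.symm ⁻¹' O) := isOpen_chart_target_inter hO q
  have hqO : x q ∈ x.target ∩ x.symm ⁻¹' O := ⟨hqt, by rw [mem_preimage, x.left_inv hqs]; exact hq⟩
  let c : (∀ p : M, TangentSpace 𝓘(ℝ, E) p) → E → E := fun X v => fieldCoord q X (x.symm v)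
  have hc : ∀ {X : ∀ p : M, TangentSpace 𝓘(ℝ, E) p}, SmoothField O X →
      DifferentiableAt ℝ (c X) (x q) := by
    intro X hX
    have h1 := contDiffOn_comp_chart_symm (contMDiffOn_fieldCoord q hO hX) q
    have h2 : IsOpen (x.target ∩ x.symm ⁻¹' (x.source ∩ O)) :=
      isOpen_chart_target_inter (x.open_source.inter hO) q
    exact (h1.contDiffAt (h2.mem_nhds ⟨hqt, by
      rw [mem_preimage, x.left_inv hqs]; exact ⟨hqs, hq⟩⟩)).differentiableAt (by simp)
  have hu : ContDiffOn ℝ ∞ (f ∘ x.symm) (x.target ∩ x.symm ⁻¹' O) := contDiffOn_comp_chart_symm hf q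
  have hstep : ∀ {X : ∀ p : M, TangentSpace 𝓘(ℝ, E) p} {g : M → ℂ},
      ContMDiffOn 𝓘(ℝ, E) 𝓘(ℝ, ℂ) ∞ g O → ∀ v ∈ x.target ∩ x.symm ⁻¹' O,
        dirDeriv X g (x.symm v) = fderiv ℝ (g ∘ x.symm) v (c X v) := by
    intro X g hg v hv
    have h1 : DifferentiableAt ℝ (g ∘ x.symm) (x (x.symm v)) := by
      rw [x.right_inv hv.1]
      exact ((contDiffOn_comp_chart_symm hg q).contDiffAt (hOt.mem_nhds hv)).differentiableAt
        (by simp)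
    have h2 := mfderiv_apply_eq_fderiv_comp_chart q (x.map_target hv.1) h1 (G := g) (by
      filter_upwards [x.open_source.mem_nhds (x.map_target hv.1)] with r hr
      rw [Function.comp_apply, Function.comp_apply, x.left_inv hr]) (X (x.symm v))
    have h3 : dirDeriv X g (x.symm v) = fderiv ℝ (g ∘ x.symm) (x (x.symm v)) (c X v) := h2
    rw [h3, x.right_inv hv.1]
  have hiter : ∀ {X Z : ∀ p : M, TangentSpace 𝓘(ℝ, E) p}, SmoothField O Z →
      dirDeriv X (dirDeriv Z f) q =
        fderiv ℝ (fun v => fderiv ℝ (f ∘ x.symm) v (c Z v)) (x q) (c X (x q)) := by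
    intro X Z hZ
    have h1 := hstep (X := X) (contMDiffOn_dirDeriv hO hZ hf) (x q) hqO
    rw [x.left_inv hqs] at h1
    rw [h1]
    congr 1
    refine Filter.EventuallyEq.fderiv_eq ?_
    filter_upwards [hOt.mem_nhds hqO] with v hv
    exact hstep hf v hv
  have hbr : VectorField.lieBracket ℝ (c V) (c W) (x q) = 0 := by
    let c' : (∀ p : M, TangentSpace 𝓘(ℝ, E) p) → E → E := fun X =>
      VectorField.mpullbackWithin 𝓘(ℝ, E) 𝓘(ℝ, E) (extChartAt 𝓘(ℝ, E) q).symm X (range 𝓘(ℝ, E))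
    let L : E →L[ℝ] E := mfderiv 𝓘(ℝ, E) 𝓘(ℝ, E) (extChartAt 𝓘(ℝ, E) q) q
    have h1 : L.inverse (VectorField.lieBracketWithin ℝ (c' V) (c' W)
        ((extChartAt 𝓘(ℝ, E) q).symm ⁻¹' univ ∩ range 𝓘(ℝ, E)) (x q)) = 0 := hVW
    have hinv : L.IsInvertible := isInvertible_mfderiv_extChartAt (by simp)
    have hs : (extChartAt 𝓘(ℝ, E) q).symm ⁻¹' univ ∩ range 𝓘(ℝ, E) = univ := by simp
    rw [hinv.inverse_apply_eq, map_zero, hs, VectorField.lieBracketWithin_univ] at h1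
    have hloc : ∀ X : ∀ p : M, TangentSpace 𝓘(ℝ, E) p, c' X =ᶠ[𝓝 (x q)] c X := by
      intro X
      filter_upwards [x.open_target.mem_nhds hqt] with v hv
      have h2 := mfderiv_chart_symm_inverse (E := E) q hv
      exact congrArg (fun A : E →L[ℝ] E => A (X (x.symm v))) h2
    exact ((hloc V).lieBracket_vectorField_eq (hloc W)).symm.trans h1
  have hfin := VectorField.fderiv_apply_lieBracket
    (hu.contDiffAt (hOt.mem_nhds hqO)) (n := ∞) (by
      rw [minSmoothness_of_isRCLikeNormedField]; exact ENat.LEInfty.out) (hc hW) (hc hV)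
  rw [hbr, map_zero] at hfin
  rw [hiter hW, hiter hV]
  exact (sub_eq_zero.1 hfin.symm)

variable {d : ℕ}

theorem multiIter_eq_foldr {A : Type*} (D : Fin d → A → A) (α : Fin d → ℕ) (a : A) :
    multiIter D α a = ((List.finRange d).flatMap fun j => List.replicate (α j) j).foldr D a := by
  rw [multiIter]
  induction List.finRange d with
  | nil => rfl
  | cons j l ih =>
    rw [List.flatMap_cons, List.foldr_append, ← ih, List.foldr_cons]
    generalize List.foldr (fun j b => (D j)^[α j] b) a l = b
    induction α j with
    | zero => rfl
    | succ k ihk => rw [Function.iterate_succ_apply', ihk, List.replicate_succ, List.foldr_cons]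

theorem length_multiIter_word (α : Fin d → ℕ) :
    ((List.finRange d).flatMap fun j => List.replicate (α j) j).length = ∑ j, α j := by
  rw [List.length_flatMap, ← List.sum_ofFn, List.ofFn_eq_map]
  simp

theorem count_multiIter_word (α : Fin d → ℕ) (j : Fin d) :
    ((List.finRange d).flatMap fun j => List.replicate (α j) j).count j = α j := by
  rw [List.count_flatMap, ← List.ofFn_eq_map, List.sum_ofFn]
  simp [List.count_replicate]

variable {O : Set M} {X : Fin d → ∀ p : M, TangentSpace 𝓘(ℝ, E) p}

theorem contMDiffOn_foldr_dirDeriv (hO : IsOpen O) (hX : ∀ j, SmoothField O (X j)) {f : M → ℂ}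
    (hf : ContMDiffOn 𝓘(ℝ, E) 𝓘(ℝ, ℂ) ∞ f O) (w : List (Fin d)) :
    ContMDiffOn 𝓘(ℝ, E) 𝓘(ℝ, ℂ) ∞ (w.foldr (fun j => dirDeriv (X j)) f) O := by
  induction w with
  | nil => exact hf
  | cons j w ih => exact contMDiffOn_dirDeriv hO (hX j) ih

theorem foldr_dirDeriv_eqOn (hO : IsOpen O) {f g : M → ℂ} (h : EqOn f g O) (w : List (Fin d)) :
    EqOn (w.foldr (fun j => dirDeriv (X j)) f) (w.foldr (fun j => dirDeriv (X j)) g) O := by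
  induction w with
  | nil => exact h
  | cons j w ih => exact dirDeriv_eqOn hO (X j) ih

theorem tsupport_foldr_dirDeriv_subset (f : M → ℂ) (w : List (Fin d)) :
    tsupport (w.foldr (fun j => dirDeriv (X j)) f) ⊆ tsupport f := by
  induction w with
  | nil => exact subset_rfl
  | cons j w ih => exact (tsupport_dirDeriv_subset _ _).trans ih

theorem foldr_dirDeriv_add (hO : IsOpen O) (hX : ∀ j, SmoothField O (X j)) {f g : M → ℂ}
    (hf : ContMDiffOn 𝓘(ℝ, E) 𝓘(ℝ, ℂ) ∞ f O) (hg : ContMDiffOn 𝓘(ℝ, E) 𝓘(ℝ, ℂ) ∞ g O)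
    (w : List (Fin d)) : EqOn (w.foldr (fun j => dirDeriv (X j)) (f + g))
      (w.foldr (fun j => dirDeriv (X j)) f + w.foldr (fun j => dirDeriv (X j)) g) O := by
  induction w with
  | nil => exact fun _ _ => rfl
  | cons j w ih =>
    intro q hq
    refine (dirDeriv_eqOn hO (X j) ih hq).trans (dirDeriv_add_apply _ ?_ ?_)
    · exact ((contMDiffOn_foldr_dirDeriv hO hX hf w).contMDiffAt
        (hO.mem_nhds hq)).mdifferentiableAt (by simp)
    · exact ((contMDiffOn_foldr_dirDeriv hO hX hg w).contMDiffAt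
        (hO.mem_nhds hq)).mdifferentiableAt (by simp)

theorem foldr_dirDeriv_smul (hO : IsOpen O) (hX : ∀ j, SmoothField O (X j)) {f : M → ℂ}
    (hf : ContMDiffOn 𝓘(ℝ, E) 𝓘(ℝ, ℂ) ∞ f O) (c : ℂ) (w : List (Fin d)) :
    EqOn (w.foldr (fun j => dirDeriv (X j)) (c • f))
      (c • w.foldr (fun j => dirDeriv (X j)) f) O := by
  induction w with
  | nil => exact fun _ _ => rfl
  | cons j w ih =>
    intro q hq
    refine (dirDeriv_eqOn hO (X j) ih hq).trans (dirDeriv_smul_apply _ _ ?_)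
    exact ((contMDiffOn_foldr_dirDeriv hO hX hf w).contMDiffAt
        (hO.mem_nhds hq)).mdifferentiableAt (by simp)

end Iterated

section Taylor

variable {E : Type*} [NormedAddCommGroup E] [NormedSpace ℝ E]
variable {M : Type*} [TopologicalSpace M] [ChartedSpace E M] [IsManifold 𝓘(ℝ, E) ∞ M]
variable {I W : Set M} {d : ℕ}

/-- The function `h^γ g`. -/
def TransverseSystem.monomialMul (H : TransverseSystem E I W d) (γ : Fin d → ℕ) (g : M → ℂ) :
    M → ℂ := fun q => (∏ j, ((H.h j q : ℝ) : ℂ) ^ γ j) * g q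

theorem TransverseSystem.contMDiffOn_monomial (H : TransverseSystem E I W d) (γ : Fin d → ℕ) :
    ContMDiffOn 𝓘(ℝ, E) 𝓘(ℝ, ℂ) ∞ (fun q => ∏ j, ((H.h j q : ℝ) : ℂ) ^ γ j) W := by
  have h1 : ContDiff ℝ ∞ (fun v : Fin d → ℝ => ∏ j, ((v j : ℝ) : ℂ) ^ γ j) :=
    contDiff_prod fun j _ => (Complex.ofRealCLM.contDiff.comp (contDiff_apply ℝ ℝ j)).pow _
  have h2 : ContMDiffOn 𝓘(ℝ, E) 𝓘(ℝ, Fin d → ℝ) ∞ (fun q j => H.h j q) W :=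
    contMDiffOn_pi_space.2 fun j => (H.h_mem j).1
  exact h1.contMDiff.comp_contMDiffOn h2

theorem TransverseSystem.contMDiffOn_monomialMul (H : TransverseSystem E I W d) (γ : Fin d → ℕ)
    {g : M → ℂ} (hg : ContMDiffOn 𝓘(ℝ, E) 𝓘(ℝ, ℂ) ∞ g W) :
    ContMDiffOn 𝓘(ℝ, E) 𝓘(ℝ, ℂ) ∞ (H.monomialMul γ g) W := fun _ hq =>
  (contMDiffAt_mul ((H.contMDiffOn_monomial γ).contMDiffAt (H.isOpen.mem_nhds hq))
    (hg.contMDiffAt (H.isOpen.mem_nhds hq))).contMDiffWithinAt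

theorem TransverseSystem.dirDeriv_monomial (H : TransverseSystem E I W d) (γ : Fin d → ℕ)
    (j : Fin d) {q : M} (hq : q ∈ W) :
    dirDeriv (H.field j) (fun q => ∏ j, ((H.h j q : ℝ) : ℂ) ^ γ j) q =
      γ j * ∏ i, ((H.h i q : ℝ) : ℂ) ^ Function.update γ j (γ j - 1) i := by
  classical
  have hh : ∀ i, MDifferentiableAt 𝓘(ℝ, E) 𝓘(ℝ, ℝ) (H.h i) q := fun i =>
    ((H.h_mem i).1.contMDiffAt (H.isOpen.mem_nhds hq)).mdifferentiableAt (by simp)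
  have hpow : ∀ i, HasMFDerivAt 𝓘(ℝ, E) 𝓘(ℝ, ℂ) (fun q => ((H.h i q : ℝ) : ℂ) ^ γ i) q
      (((γ i * ((H.h i q : ℝ) : ℂ) ^ (γ i - 1)) • Complex.ofRealCLM : ℝ →L[ℝ] ℂ).comp
        (mfderiv 𝓘(ℝ, E) 𝓘(ℝ, ℝ) (H.h i) q : E →L[ℝ] ℝ) : E →L[ℝ] ℂ) := by
    intro i
    have h1 : HasFDerivAt (fun s : ℝ => (s : ℂ) ^ γ i)
        ((γ i * ((H.h i q : ℝ) : ℂ) ^ (γ i - 1)) • Complex.ofRealCLM : ℝ →L[ℝ] ℂ) (H.h i q) := by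
      have h2 := (Complex.ofRealCLM.hasFDerivAt (x := H.h i q)).pow (γ i)
      refine (show HasFDerivAt (fun s : ℝ => (s : ℂ) ^ γ i) _ _ from h2).congr_fderiv ?_
      ext
      simp
    exact h1.hasMFDerivAt.comp q (hh i).hasMFDerivAt
  have h3 := (HasMFDerivAt.prod (t := Finset.univ) fun i _ => hpow i).mfderiv
  have h4 : dirDeriv (H.field j) (fun q => ∏ j, ((H.h j q : ℝ) : ℂ) ^ γ j) q =
      ∑ i, (∏ k ∈ Finset.univ.erase i, ((H.h k q : ℝ) : ℂ) ^ γ k) *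
        ((γ i * ((H.h i q : ℝ) : ℂ) ^ (γ i - 1)) *
          ((realDeriv (H.field j) (H.h i) q : ℝ) : ℂ)) := by
    have h5 : (fun q => ∏ j, ((H.h j q : ℝ) : ℂ) ^ γ j) =
        ∏ i, fun q => ((H.h i q : ℝ) : ℂ) ^ γ i := by
      ext q
      rw [Finset.prod_apply]
    rw [dirDeriv, h5, h3]
    have hsum : ∀ (A : Fin d → E →L[ℝ] ℂ) (v : E), (∑ i, A i) v = ∑ i, A i v := fun A v => by simp
    exact hsum _ _
  rw [h4, Finset.sum_eq_single j]
  · rw [H.dual q hq, if_pos rfl, ← Finset.mul_prod_erase Finset.univ _ (Finset.mem_univ j),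
      Function.update_self]
    have h6 : ∏ i ∈ Finset.univ.erase j, ((H.h i q : ℝ) : ℂ) ^ Function.update γ j (γ j - 1) i =
        ∏ k ∈ Finset.univ.erase j, ((H.h k q : ℝ) : ℂ) ^ γ k :=
      Finset.prod_congr rfl fun k hk => by
        rw [Function.update_of_ne (Finset.ne_of_mem_erase hk)]
    rw [h6, Complex.ofReal_one]
    ring
  · intro i _ hij
    rw [H.dual q hq, if_neg (Ne.symm hij)]
    simp
  · simp

/-- On `I`, the derivatives of order at most `|γ|` of `h^γ g` vanish, except for
`∂_h^γ (h^γ g) = γ! g`. -/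
theorem TransverseSystem.foldr_dirDeriv_monomialMul (H : TransverseSystem E I W d) {q : M}
    (hqI : q ∈ I) (hqW : q ∈ W) (w : List (Fin d)) :
    ∀ (γ : Fin d → ℕ) {g : M → ℂ}, ContMDiffOn 𝓘(ℝ, E) 𝓘(ℝ, ℂ) ∞ g W → w.length ≤ ∑ j, γ j →
      w.foldr (fun j => dirDeriv (H.field j)) (H.monomialMul γ g) q =
        if ∀ j, w.count j = γ j then (∏ j, ((γ j).factorial : ℂ)) * g q else 0 := by
  induction w using List.reverseRecOn with
  | nil =>
    intro γ g _ _
    rw [List.foldr_nil, monomialMul]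
    by_cases h0 : ∀ j, ([] : List (Fin d)).count j = γ j
    · have h1 : ∀ j, γ j = 0 := fun j => by rw [← h0 j, List.count_nil]
      rw [if_pos h0]
      simp [h1]
    · rw [if_neg h0]
      push Not at h0
      obtain ⟨j, hj⟩ := h0
      rw [List.count_nil] at hj
      rw [Finset.prod_eq_zero (Finset.mem_univ j), zero_mul]
      rw [(H.h_mem j).2 q ⟨hqI, hqW⟩, Complex.ofReal_zero, zero_pow hj.symm]
  | append_singleton w j ih =>
    intro γ g hg hlen
    rw [List.length_append, List.length_singleton] at hlen
    have hO := H.isOpen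
    have hdg := contMDiffOn_dirDeriv hO (H.field_smooth j) hg
    have hsm : ContMDiffOn 𝓘(ℝ, E) 𝓘(ℝ, ℂ) ∞
        ((γ j : ℂ) • H.monomialMul (Function.update γ j (γ j - 1)) g) W := fun r hr =>
      (contMDiffAt_mul contMDiffAt_const ((H.contMDiffOn_monomialMul _ hg).contMDiffAt
        (hO.mem_nhds hr))).contMDiffWithinAt
    have hsplit : EqOn (dirDeriv (H.field j) (H.monomialMul γ g))
        (H.monomialMul γ (dirDeriv (H.field j) g) +
          (γ j : ℂ) • H.monomialMul (Function.update γ j (γ j - 1)) g) W := by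
      intro r hr
      have h1 := dirDeriv_mul (H.field j)
        (((H.contMDiffOn_monomial γ).contMDiffAt (hO.mem_nhds hr)).mdifferentiableAt (by simp))
        ((hg.contMDiffAt (hO.mem_nhds hr)).mdifferentiableAt (by simp))
      refine h1.trans ?_
      rw [H.dirDeriv_monomial γ j hr, Pi.add_apply, Pi.smul_apply, smul_eq_mul]
      simp only [monomialMul]
      ring
    rw [List.foldr_append, List.foldr_cons, List.foldr_nil,
      foldr_dirDeriv_eqOn hO hsplit w hqW,
      foldr_dirDeriv_add hO H.field_smooth (H.contMDiffOn_monomialMul γ hdg) hsm w hqW,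
      Pi.add_apply,
      foldr_dirDeriv_smul hO H.field_smooth (H.contMDiffOn_monomialMul _ hg) _ w hqW,
      Pi.smul_apply, smul_eq_mul, ih γ hdg (by omega)]
    have hne : ¬ ∀ i, w.count i = γ i := fun h => by
      have : w.length = ∑ i, γ i := by
        rw [← Finset.sum_congr rfl fun i _ => h i]
        simpa using (Multiset.sum_count_eq_card (s := Finset.univ) (m := (w : Multiset (Fin d)))
          fun a _ => Finset.mem_univ a).symm
      omega
    rw [if_neg hne, zero_add]
    rcases Nat.eq_zero_or_pos (γ j) with h0 | hpos
    · rw [h0, Nat.cast_zero, zero_mul, if_neg]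
      intro h
      have := h j
      simp [h0] at this
    · have hsum : ∑ i, γ i = ∑ i, Function.update γ j (γ j - 1) i + 1 := by
        rw [Finset.sum_update_of_mem (Finset.mem_univ j),
          ← Finset.add_sum_erase Finset.univ _ (Finset.mem_univ j), Finset.sdiff_singleton_eq_erase]
        omega
      rw [ih _ hg (by omega)]
      have hiff : (∀ i, w.count i = Function.update γ j (γ j - 1) i) ↔
          ∀ i, (w ++ [j]).count i = γ i := by
        refine forall_congr' fun i => ?_
        rw [List.count_append]
        by_cases hij : i = j
        · subst hij
          rw [Function.update_self, List.count_singleton_self]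
          omega
        · rw [Function.update_of_ne hij, List.count_singleton, if_neg (by simpa using Ne.symm hij),
            add_zero]
      simp only [hiff]
      split_ifs
      · rw [← mul_assoc]
        congr 1
        rw [← Finset.mul_prod_erase Finset.univ _ (Finset.mem_univ j),
          ← Finset.mul_prod_erase Finset.univ (fun i => ((γ i).factorial : ℂ)) (Finset.mem_univ j),
          Function.update_self, ← mul_assoc]
        congr 1
        · exact_mod_cast Nat.mul_factorial_pred hpos.ne'
        · exact Finset.prod_congr rfl fun k hk => by
            rw [Function.update_of_ne (Finset.ne_of_mem_erase hk)]
      · rw [mul_zero]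

end Taylor

/-! ### Smooth densities on the submanifold and their wave front sets -/

section SubmanifoldDensity

variable {E : Type} [NormedAddCommGroup E] [InnerProductSpace ℝ E] [FiniteDimensional ℝ E]
  [MeasurableSpace E] [BorelSpace E]
variable {M : Type*} [TopologicalSpace M] [T2Space M] [SigmaCompactSpace M] [ChartedSpace E M]
  [IsManifold 𝓘(ℝ, E) ∞ M]
variable {n : ℕ} {Y : Type*} [TopologicalSpace Y] [T2Space Y] [SigmaCompactSpace Y]
  [ChartedSpace (EuclideanSpace ℝ (Fin n)) Y] [IsManifold 𝓘(ℝ, EuclideanSpace ℝ (Fin n)) ∞ Y]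
  [MeasurableSpace Y] [BorelSpace Y]

theorem norm_integral_mul_le {μ : Measure Y} [IsLocallyFiniteMeasure μ] {f θ : Y → ℂ}
    (hf : Continuous f) {K : Set Y} (hK : IsCompact K) (hθ : ∀ y ∉ K, θ y = 0)
    {B : ℝ} (hB : ∀ y ∈ K, ‖θ y‖ ≤ B) :
    ‖∫ y, f y * θ y ∂μ‖ ≤ (∫ y in K, ‖f y‖ ∂μ) * B := by
  rw [← setIntegral_eq_integral_of_forall_compl_eq_zero (s := K) fun y hy => by
    rw [hθ y hy, mul_zero], ← integral_mul_const]
  refine norm_integral_le_of_norm_le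
    ((hf.norm.continuousOn.integrableOn_compact hK).mul_const B) ?_
  filter_upwards [ae_restrict_mem hK.measurableSet] with y hy
  rw [norm_mul]
  exact mul_le_mul_of_nonneg_left (hB y hy) (norm_nonneg _)

theorem TestSpace.integrable_mul {μ : Measure Y} [IsLocallyFiniteMeasure μ] {Ω : Set Y} {f : Y → ℂ}
    (hf : Continuous f) (θ : TestSpace (EuclideanSpace ℝ (Fin n)) Ω) :
    Integrable (fun y => f y * (θ : Y → ℂ) y) μ :=
  (hf.mul θ.2.1.continuous).integrable_of_hasCompactSupport θ.2.2.1.mul_left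

/-- The distribution `θ ↦ ∫ f θ dμ`. -/
def densityDistr (μ : Measure Y) [IsLocallyFiniteMeasure μ] {f : Y → ℂ} (hf : Continuous f)
    (Ω : Set Y) : Distr (EuclideanSpace ℝ (Fin n)) Ω where
  toLin :=
    { toFun := fun θ => ∫ y, f y * (θ : Y → ℂ) y ∂μ
      map_add' := fun θ θ' => by
        rw [← integral_add (TestSpace.integrable_mul hf θ) (TestSpace.integrable_mul hf θ')]
        exact integral_congr_ae (ae_of_all _ fun y => mul_add _ _ _)
      map_smul' := fun c θ => by
        rw [RingHom.id_apply, smul_eq_mul, ← integral_const_mul]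
        exact integral_congr_ae (ae_of_all _ fun y => mul_left_comm _ _ _) }
  isDistribution := by
    intro p K hK hKs
    refine ⟨0, ∫ y in K, ‖f y‖ ∂μ, fun θ B hθ hB => ?_⟩
    refine norm_integral_mul_le hf hK
      (fun y hy => TestSpace.eq_zero_of_notMem θ fun h => hy (hθ h)) fun y hy => ?_
    have h1 := hB 0 le_rfl y hy
    rwa [norm_iteratedFDeriv_zero, Function.comp_apply,
      (chartAt (EuclideanSpace ℝ (Fin n)) p).left_inv (hKs hy).1] at h1

variable {ι : Y → M} (hι : IsClosedSubmanifold (E := E) (E' := EuclideanSpace ℝ (Fin n)) ι)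

theorem IsClosedSubmanifold.isClosedEmbedding
    (hι : IsClosedSubmanifold (E := E) (E' := EuclideanSpace ℝ (Fin n)) ι) :
    IsClosedEmbedding ι := ⟨hι.embedding.isEmbedding, hι.closed⟩

/-- The distribution `φ ↦ ∫ f (φ ∘ ι) dμ` carried by the submanifold. -/
def pushDensity (μ : Measure Y) [IsLocallyFiniteMeasure μ] {f : Y → ℂ} (hf : Continuous f)
    (W : Set M) : Distr E W where
  toLin := pushDistr hι W (densityDistr μ hf (ι ⁻¹' W))
  isDistribution := by
    intro p K hK hKs
    refine ⟨0, ∫ y in ι ⁻¹' K, ‖f y‖ ∂μ, fun φ B hφ hB => ?_⟩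
    refine norm_integral_mul_le hf (hι.isClosedEmbedding.isCompact_preimage hK)
      (fun y hy => TestSpace.eq_zero_of_notMem φ fun h => hy (hφ h)) fun y hy => ?_
    have h1 := hB 0 le_rfl (ι y) hy
    rwa [norm_iteratedFDeriv_zero, Function.comp_apply,
      (chartAt E p).left_inv (hKs hy).1] at h1

/-- A smooth density on `I` is microlocally smooth away from the conormal bundle of `I`: in the
other directions its Fourier transform is an oscillatory integral without stationary points. -/
theorem microlocallySmoothAt_pushDensity {μ : Measure Y} [IsLocallyFiniteMeasure μ]
    (hμ : IsSmoothPositiveDensity n μ) {f : Y → ℂ}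
    (hf : ContMDiff 𝓘(ℝ, EuclideanSpace ℝ (Fin n)) 𝓘(ℝ, ℂ) ∞ f) {W : Set M} (hW : IsOpen W)
    {x : Cotangent E M} (hxW : x.proj ∈ W) (hx0 : x.2 ≠ 0)
    (hx : x ∉ conormal (E' := EuclideanSpace ℝ (Fin n)) ι) :
    MicrolocallySmoothAt (pushDensity hι μ hf.continuous W) x := by
  obtain ⟨p, η⟩ := x
  change p ∈ W at hxW
  change η ≠ 0 at hx0
  by_cases hp : p ∈ range ι
  swap
  · obtain ⟨χ, hχ, hχ1⟩ := exists_testSpace_cutoff (E := E) (isCompact_singleton (x := p))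
      ((hW.inter hι.closed.isOpen_compl).inter (chartAt E p).open_source)
      (singleton_subset_iff.2 ⟨⟨hxW, hp⟩, mem_chart_source E p⟩)
      (inter_subset_left.trans (inter_subset_left (s := W)))
    refine ⟨χ, hχ.trans inter_subset_right, ?_, univ, univ_mem, fun N => ⟨0, fun ζ _ s _ => ?_⟩⟩
    · rw [hχ1.self_of_nhdsSet p rfl]
      exact one_ne_zero
    · have h0 : (pushDensity hι μ hf.continuous W).toLin
          (oscTest p χ (hχ.trans inter_subset_right) ζ s) = 0 := by
        change ∫ y, f y * ((χ : M → ℂ) (ι y) * _) ∂μ = 0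
        rw [← integral_zero Y ℂ (μ := μ)]
        refine integral_congr_ae (ae_of_all _ fun y => ?_)
        change f y * ((χ : M → ℂ) (ι y) * _) = 0
        rw [TestSpace.eq_zero_of_notMem χ fun h => (hχ h).1.2 (mem_range_self y), zero_mul,
          mul_zero]
      change s ^ N * ‖(pushDensity hι μ hf.continuous W).toLin (oscTest p χ _ ζ s)‖ ≤ 0
      rw [h0, norm_zero, mul_zero]
  obtain ⟨y, rfl⟩ := hp
  have hv : ∃ v : TangentSpace 𝓘(ℝ, EuclideanSpace ℝ (Fin n)) y,
      η (mfderiv 𝓘(ℝ, EuclideanSpace ℝ (Fin n)) 𝓘(ℝ, E) ι y v) ≠ 0 := by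
    by_contra! h
    exact hx ⟨y, η, hx0, h, rfl⟩
  obtain ⟨v, hv⟩ := hv
  set ζ₀ := coordCovector E (⟨ι y, η⟩ : Cotangent E M) with hζ₀
  set xM := chartAt E (ι y) with hxM
  set xY := chartAt (EuclideanSpace ℝ (Fin n)) y with hxY
  have hys : y ∈ xY.source := mem_chart_source _ y
  have hyt := xY.map_source hys
  have hps : ι y ∈ xM.source := mem_chart_source E (ι y)
  have hιc := hι.embedding.contMDiff.continuous
  have hO : IsOpen (ι ⁻¹' xM.source) := xM.open_source.preimage hιc
  have hG : ContMDiffOn 𝓘(ℝ, EuclideanSpace ℝ (Fin n)) 𝓘(ℝ, E) ∞ (fun q => xM (ι q))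
      (ι ⁻¹' xM.source) :=
    (contMDiffOn_chart (I := 𝓘(ℝ, E))).comp hι.embedding.contMDiff.contMDiffOn fun q hq => hq
  -- The embedding in coordinates.
  obtain ⟨G, hGs, hGe⟩ := exists_contDiff_extension (isCompact_singleton (x := xY y))
    (isOpen_chart_target_inter hO y) (singleton_subset_iff.2
      ⟨hyt, by rw [mem_preimage, xY.left_inv hys]; exact hps⟩) (contDiffOn_comp_chart_symm hG y)
  rw [nhdsSet_singleton] at hGe
  have hnz : ζ₀ (fderiv ℝ G (xY y)
      (mfderiv 𝓘(ℝ, EuclideanSpace ℝ (Fin n)) 𝓘(ℝ, EuclideanSpace ℝ (Fin n)) xY y v)) ≠ 0 := by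
    have h1 : (fun q => xM (ι q)) =ᶠ[𝓝 y] G ∘ xY := by
      filter_upwards [xY.continuousAt hys hGe, xY.open_source.mem_nhds hys] with q hq hqs
      have hq' : G (xY q) = _ := hq
      rw [Function.comp_apply, hq', Function.comp_apply, xY.left_inv hqs]
    have h2 := mfderiv_apply_eq_fderiv_comp_chart y hys (hGs.differentiable (by simp) _) h1 v
    have h3 : mfderiv 𝓘(ℝ, EuclideanSpace ℝ (Fin n)) 𝓘(ℝ, E) (fun q => xM (ι q)) y v =
        mfderiv 𝓘(ℝ, E) 𝓘(ℝ, E) xM (ι y)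
          (mfderiv 𝓘(ℝ, EuclideanSpace ℝ (Fin n)) 𝓘(ℝ, E) ι y v) := by
      have := ((mdifferentiableAt_chart hps).hasMFDerivAt.comp y
        (hι.embedding.contMDiff.mdifferentiableAt (by simp) (x := y)).hasMFDerivAt).mfderiv
      exact congrArg (fun A : EuclideanSpace ℝ (Fin n) →L[ℝ] E => A v) this
    have h4 : ((η : E →L[ℝ] ℝ)) (mfderiv 𝓘(ℝ, EuclideanSpace ℝ (Fin n)) 𝓘(ℝ, E) ι y v) =
        ζ₀ (mfderiv 𝓘(ℝ, E) 𝓘(ℝ, E) xM (ι y)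
          (mfderiv 𝓘(ℝ, EuclideanSpace ℝ (Fin n)) 𝓘(ℝ, E) ι y v)) := by
      have h5 := pullCovector_chart (⟨ι y, η⟩ : Cotangent E M)
      have h6 : (ζ₀.comp (mfderiv 𝓘(ℝ, E) 𝓘(ℝ, E) xM (ι y) : E →L[ℝ] E) : E →L[ℝ] ℝ) = η := by
        have h7 := (Bundle.TotalSpace.mk.injEq _ _ _ _).mp h5
        exact eq_of_heq h7.2
      exact (congrArg (fun A : E →L[ℝ] ℝ =>
        A (mfderiv 𝓘(ℝ, EuclideanSpace ℝ (Fin n)) 𝓘(ℝ, E) ι y v)) h6).symm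
    intro h0
    apply hv
    refine h4.trans ?_
    rw [← h0]
    exact congrArg ζ₀ (h3.symm.trans h2)
  set e : EuclideanSpace ℝ (Fin n) :=
    mfderiv 𝓘(ℝ, EuclideanSpace ℝ (Fin n)) 𝓘(ℝ, EuclideanSpace ℝ (Fin n)) xY y v with he
  have hcont : Continuous fun z : (E →L[ℝ] ℝ) × EuclideanSpace ℝ (Fin n) =>
      z.1 (fderiv ℝ G z.2 e) :=
    continuous_fst.clm_apply (((hGs.continuous_fderiv (by simp)).comp continuous_snd).clm_apply
      continuous_const)
  have hev := hcont.continuousAt (x := (ζ₀, xY y)) |>.eventually_ne hnz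
  rw [nhds_prod_eq] at hev
  obtain ⟨Z, hZ, N, hN, hZN⟩ := Filter.eventually_prod_iff.1 hev
  obtain ⟨ε, hε, hεZ⟩ := Metric.nhds_basis_closedBall.eventually_iff.1 hZ
  have hnb : ∀ᶠ q in 𝓝 y, q ∈ xY.source ∧ ι q ∈ xM.source ∧ N (xY q) ∧ G (xY q) = xM (ι q) := by
    filter_upwards [xY.open_source.mem_nhds hys, hO.mem_nhds hps, xY.continuousAt hys hN,
      xY.continuousAt hys hGe] with q h1 h2 h3 h4
    have h4' : G (xY q) = _ := h4
    refine ⟨h1, h2, h3, ?_⟩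
    rw [h4', Function.comp_apply, xY.left_inv h1]
  rw [hι.isClosedEmbedding.isInducing.nhds_eq_comap] at hnb
  obtain ⟨A, hA, hAs⟩ := Filter.mem_comap.1 hnb
  obtain ⟨χ, hχ, hχ1⟩ := exists_testSpace_cutoff (E := E) (isCompact_singleton (x := ι y))
    ((isOpen_interior.inter xM.open_source).inter hW)
    (singleton_subset_iff.2 ⟨⟨mem_interior_iff_mem_nhds.2 hA, hps⟩, hxW⟩)
    (inter_subset_right (s := interior A ∩ xM.source))
  have hχA : ∀ q, ι q ∈ tsupport (χ : M → ℂ) →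
      q ∈ xY.source ∧ ι q ∈ xM.source ∧ N (xY q) ∧ G (xY q) = xM (ι q) := fun q hq =>
    hAs (show q ∈ ι ⁻¹' A from interior_subset (s := A) (hχ hq).1.1)
  have hχs : tsupport (χ : M → ℂ) ⊆ xM.source :=
    hχ.trans (inter_subset_left.trans inter_subset_right)
  obtain ⟨w, hw, hpos, hmap⟩ := hμ y
  let χY := pullTest hι W χ
  have hχYs : tsupport (χY : Y → ℂ) ⊆ ι ⁻¹' tsupport (χ : M → ℂ) :=
    tsupport_comp_subset_preimage _ hιc
  have hfw : ContMDiffOn 𝓘(ℝ, EuclideanSpace ℝ (Fin n)) 𝓘(ℝ, ℂ) ∞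
      (fun q => f q * ((w (xY q) : ℝ) : ℂ)) xY.source := by
    have h1 : ContMDiffOn 𝓘(ℝ, EuclideanSpace ℝ (Fin n)) 𝓘(ℝ, ℂ) ∞
        (fun q => ((w (xY q) : ℝ) : ℂ)) xY.source :=
      (Complex.ofRealCLM.contDiff.comp_contDiffOn hw).contMDiffOn.comp
        (contMDiffOn_chart (I := 𝓘(ℝ, EuclideanSpace ℝ (Fin n)))) fun q hq => xY.map_source hq
    exact fun q hq => (contMDiffAt_mul (hf q) (h1.contMDiffAt
      (xY.open_source.mem_nhds hq))).contMDiffWithinAt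
  let g := mulOn χY xY.open_source (fun q hq => (hχA q (hχYs hq)).1) _ hfw
  have hgs : tsupport (g : Y → ℂ) ⊆ tsupport (χY : Y → ℂ) := tsupport_mul_subset_left
  have hgs' : tsupport (g : Y → ℂ) ⊆ xY.source := fun q hq => (hχA q (hχYs (hgs hq))).1
  let a : (E →L[ℝ] ℝ) × EuclideanSpace ℝ (Fin n) → ℂ := fun z => chartFn y (g : Y → ℂ) z.2
  have ha : ContDiff ℝ ∞ a := (contDiff_chartFn g.2.1 g.2.2.1 hgs').comp contDiff_snd
  let F : (E →L[ℝ] ℝ) × EuclideanSpace ℝ (Fin n) → ℝ := fun z => z.1 (G z.2)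
  have hF : ContDiff ℝ ∞ F := contDiff_fst.clm_apply (hGs.comp contDiff_snd)
  have hFd : ∀ (ζ : E →L[ℝ] ℝ) u, fderiv ℝ F (ζ, u) (0, e) = ζ (fderiv ℝ G u e) := fun ζ u => by
    have h1 := (hasFDerivAt_slice hF ζ u).unique
      (ζ.hasFDerivAt.comp u (hGs.differentiable (by simp) u).hasFDerivAt)
    exact congrArg (fun A : EuclideanSpace ℝ (Fin n) →L[ℝ] ℝ => A e) h1
  refine ⟨χ, hχs, ?_, Metric.closedBall ζ₀ ε, Metric.closedBall_mem_nhds _ hε, fun K => ?_⟩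
  · change (χ : M → ℂ) (ι y) ≠ 0
    rw [hχ1.self_of_nhdsSet (ι y) rfl]
    exact one_ne_zero
  obtain ⟨C, hC⟩ := nonstationary_phase (volume : Measure (EuclideanSpace ℝ (Fin n))) hF
    (isCompact_closedBall ζ₀ ε) (isCompact_chart_image g.2.2.1 hgs')
    (fun ζ hζ u hu => by
      obtain ⟨q, hq, rfl⟩ := hu
      refine ⟨e, ?_⟩
      rw [hFd]
      exact hZN (hεZ hζ) (hχA q (hχYs (hgs hq))).2.2.1) K a ha (fun ζ u hu => by
      by_contra h0
      exact hu (tsupport_chartFn_subset g.2.2.1 hgs' (subset_tsupport _ h0)))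
  refine ⟨C, fun ζ hζ s hs => ?_⟩
  refine le_trans (le_of_eq ?_) (hC ζ hζ s (by linarith))
  congr 2
  change ∫ q, f q * ((χ : M → ℂ) (ι q) * Complex.exp (-Complex.I *
    ((s * ζ (xM (ι q)) : ℝ) : ℂ))) ∂μ = ∫ u, chartFn y (g : Y → ℂ) u *
      Complex.exp (-Complex.I * ((s * ζ (G u) : ℝ) : ℂ))
  have hχ0 : ∀ q, q ∉ xY.source → (χ : M → ℂ) (ι q) = 0 := fun q hq =>
    TestSpace.eq_zero_of_notMem χ fun h => hq (hχA q h).1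
  rw [← setIntegral_eq_integral_of_forall_compl_eq_zero (s := xY.source) fun q hq => by
      rw [hχ0 q hq, zero_mul, mul_zero],
    ← setIntegral_eq_integral_of_forall_compl_eq_zero (s := xY.target) (f := fun u =>
      chartFn y (g : Y → ℂ) u * _) fun u hu => by
        rw [chartFn, indicator_of_notMem hu, zero_mul]]
  have hexp : Continuous fun u => Complex.exp (-Complex.I * ((s * ζ (G u) : ℝ) : ℂ)) := by
    have := hGs.continuous
    fun_prop
  have hH : ContinuousOn (fun u => ((w u : ℝ) : ℂ)⁻¹ * (chartFn y (g : Y → ℂ) u *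
      Complex.exp (-Complex.I * ((s * ζ (G u) : ℝ) : ℂ)))) xY.target := by
    refine ContinuousOn.mul (ContinuousOn.inv₀ ?_ fun v hv => ?_)
      ((contDiff_chartFn g.2.1 g.2.2.1 hgs').continuous.mul hexp).continuousOn
    · exact Complex.continuous_ofReal.comp_continuousOn hw.continuousOn
    · simpa using (hpos v hv).ne'
  have h3 := setIntegral_chart_source hw.continuousOn hpos hmap hH
  have hw0 : ∀ v ∈ xY.target, ((w v : ℝ) : ℂ) ≠ 0 := fun v hv => by simpa using (hpos v hv).ne'
  calc _ = _ := setIntegral_congr_fun xY.open_source.measurableSet fun q hq => ?_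
    _ = _ := h3
    _ = _ := setIntegral_congr_fun xY.open_target.measurableSet fun u hu => ?_
  · change _ = ((w (xY q) : ℝ) : ℂ)⁻¹ * (chartFn y (g : Y → ℂ) (xY q) *
      Complex.exp (-Complex.I * ((s * ζ (G (xY q)) : ℝ) : ℂ)))
    rw [chartFn_apply _ hq]
    change _ = ((w (xY q) : ℝ) : ℂ)⁻¹ * (((χ : M → ℂ) (ι q) * (f q * ((w (xY q) : ℝ) : ℂ))) *
      Complex.exp (-Complex.I * ((s * ζ (G (xY q)) : ℝ) : ℂ)))
    have h1 := hw0 _ (xY.map_source hq)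
    by_cases hq2 : ι q ∈ tsupport (χ : M → ℂ)
    · rw [(hχA q hq2).2.2.2]
      field_simp
    · rw [TestSpace.eq_zero_of_notMem χ hq2]
      simp
  · rw [← mul_assoc, mul_inv_cancel₀ (hw0 u hu), one_mul]

end SubmanifoldDensity

/-! ### Transverse expansions -/

section WordDistr

variable {E : Type} [NormedAddCommGroup E] [InnerProductSpace ℝ E] [FiniteDimensional ℝ E]
  [MeasurableSpace E] [BorelSpace E]
variable {M : Type*} [TopologicalSpace M] [T2Space M] [SigmaCompactSpace M] [ChartedSpace E M]
  [IsManifold 𝓘(ℝ, E) ∞ M]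
variable {I W : Set M} {d : ℕ}

theorem TransverseSystem.coe_foldr_derivTest (H : TransverseSystem E I W d) (φ : TestSpace E W)
    (w : List (Fin d)) :
    ((w.foldr (fun j φ => derivTest H.isOpen (H.field j) (H.field_smooth j) φ) φ :
      TestSpace E W) : M → ℂ) = w.foldr (fun j => dirDeriv (H.field j)) (φ : M → ℂ) := by
  induction w with
  | nil => rfl
  | cons j w ih =>
    rw [List.foldr_cons, List.foldr_cons, ← ih]
    rfl

theorem TransverseSystem.foldr_derivTest_perm (H : TransverseSystem E I W d) (φ : TestSpace E W)
    {w w' : List (Fin d)} (h : w.Perm w') :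
    w.foldr (fun j φ => derivTest H.isOpen (H.field j) (H.field_smooth j) φ) φ =
      w'.foldr (fun j φ => derivTest H.isOpen (H.field j) (H.field_smooth j) φ) φ := by
  have : LeftCommutative fun (j : Fin d) (φ : TestSpace E W) =>
      derivTest H.isOpen (H.field j) (H.field_smooth j) φ := by
    refine ⟨fun j k φ => TestSpace.ext fun q => ?_⟩
    change dirDeriv (H.field j) (dirDeriv (H.field k) (φ : M → ℂ)) q =
      dirDeriv (H.field k) (dirDeriv (H.field j) (φ : M → ℂ)) q
    by_cases hq : q ∈ W
    · exact dirDeriv_comm H.isOpen (H.field_smooth j) (H.field_smooth k) hq (H.comm q hq j k)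
        φ.2.1.contMDiffOn
    · have h1 : ∀ j k, dirDeriv (H.field j) (dirDeriv (H.field k) (φ : M → ℂ)) q = 0 := fun j k =>
        image_eq_zero_of_notMem_tsupport fun h => hq (φ.2.2.2 (tsupport_dirDeriv_subset _ _
          (tsupport_dirDeriv_subset _ _ h)))
      rw [h1, h1]
  exact h.foldr_eq φ

theorem TransverseSystem.foldr_derivDistr_apply (H : TransverseSystem E I W d)
    (T : TestSpace E W →ₗ[ℂ] ℂ) (w : List (Fin d)) : ∀ φ : TestSpace E W,
    w.foldr H.derivDistr T φ = (-1) ^ w.length * T (w.reverse.foldr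
      (fun j φ => derivTest H.isOpen (H.field j) (H.field_smooth j) φ) φ) := by
  induction w with
  | nil => simp
  | cons j w ih =>
    intro φ
    rw [List.foldr_cons, List.reverse_cons, List.foldr_append, List.foldr_cons, List.foldr_nil,
      List.length_cons, pow_succ, mul_assoc, neg_one_mul, mul_neg, ← ih]
    rfl

/-- Iterated transverse derivative of a distribution. -/
theorem TransverseSystem.exists_distr_foldr (H : TransverseSystem E I W d) (T : Distr E W)
    (w : List (Fin d)) : ∃ T' : Distr E W, T'.toLin = w.foldr H.derivDistr T.toLin ∧
      ∀ x : Cotangent E M, x.proj ∈ W → MicrolocallySmoothAt T x → MicrolocallySmoothAt T' x := by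
  induction w with
  | nil => exact ⟨T, rfl, fun _ _ h => h⟩
  | cons j w ih =>
    obtain ⟨T', hT', h⟩ := ih
    refine ⟨T'.deriv H.isOpen (H.field_smooth j), ?_, fun x hx hT =>
      (h x hx hT).deriv H.isOpen (H.field_smooth j) hx⟩
    rw [List.foldr_cons, ← hT']
    rfl

theorem isDistribution_of_restrict {T : TestSpace E (univ : Set M) →ₗ[ℂ] ℂ} (hW : IsOpen W)
    {A : Set M} (hA : IsClosed A) (hAW : A ⊆ W) (T' : Distr E W)
    (hT : ∀ φ : TestSpace E W, T (TestSpace.incl (subset_univ W) φ) = T'.toLin φ)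
    (hsupp : ∀ φ : TestSpace E (univ : Set M), (∀ q ∈ A, (φ : M → ℂ) =ᶠ[𝓝 q] 0) → T φ = 0) :
    IsDistribution E T := by
  intro p K hK hKs
  have hKs1 : K ⊆ (chartAt E p).source := hKs.trans inter_subset_left
  obtain ⟨χ, -, hχ1⟩ := exists_testSpace_cutoff (E := E) (hK.inter_right hA) hW
    (inter_subset_right.trans hAW) subset_rfl
  have hK' : IsCompact (K ∩ tsupport (χ : M → ℂ)) := hK.inter_right (isClosed_tsupport _)
  obtain ⟨k, C, hC⟩ := T'.isDistribution p _ hK'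
    fun q hq => ⟨hKs1 hq.1, χ.2.2.2 hq.2⟩
  have hxK := isCompact_chart_image hK hKs1
  obtain ⟨a, ha, hea⟩ := exists_contDiff_extension hxK (isOpen_chart_target_inter isOpen_univ p) (by
      rintro _ ⟨q, hq, rfl⟩
      exact ⟨(chartAt E p).map_source (hKs1 hq), trivial⟩)
    (contDiffOn_comp_chart_symm χ.2.1.contMDiffOn p)
  obtain ⟨C', hC'⟩ := exists_bound_iteratedFDeriv_mul_comp ha (contDiff_id (𝕜 := ℝ) (E := E)) hxK k
  refine ⟨k, C * C', fun φ B hφ hB => ?_⟩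
  let φ' : TestSpace E W := mulOn χ isOpen_univ (subset_univ _) (φ : M → ℂ) φ.2.1.contMDiffOn
  have h1 : T φ = T'.toLin φ' := by
    rw [← hT, ← sub_eq_zero, ← map_sub]
    refine hsupp _ fun q hq => ?_
    by_cases hqK : q ∈ K
    · filter_upwards [nhds_le_nhdsSet (show q ∈ K ∩ A from ⟨hqK, hq⟩) hχ1] with r hr
      change (φ : M → ℂ) r - (χ : M → ℂ) r * (φ : M → ℂ) r = 0
      rw [hr, one_mul, sub_self]
    · filter_upwards [notMem_tsupport_iff_eventuallyEq.1 fun h => hqK (hφ h)] with r hr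
      change (φ : M → ℂ) r - (χ : M → ℂ) r * (φ : M → ℂ) r = 0
      rw [hr]
      simp
  rw [h1, mul_assoc]
  have hsub : tsupport (φ' : M → ℂ) ⊆ K ∩ tsupport (χ : M → ℂ) := fun q hq =>
    ⟨hφ (tsupport_mul_subset_right hq), tsupport_mul_subset_left hq⟩
  refine hC φ' _ hsub fun j hj q hq => ?_
  have hqs := hKs1 hq.1
  have hqt := (chartAt E p).map_source hqs
  have hcd : ContDiff ℝ ∞ (chartFn (E := E) p (φ : M → ℂ)) :=
    contDiff_chartFn φ.2.1 φ.2.2.1 (hφ.trans hKs1)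
  have heq : chartFn (E := E) p (φ : M → ℂ) =ᶠ[𝓝 (chartAt E p q)]
      (φ : M → ℂ) ∘ (chartAt E p).symm := by
    filter_upwards [(chartAt E p).open_target.mem_nhds hqt] with w hw
    exact indicator_of_mem hw _
  refine hC' _ (chartFn p (φ : M → ℂ)) B hcd _ (mem_image_of_mem _ hq.1) ?_ (fun j hj => ?_) j hj
  · filter_upwards [nhds_le_nhdsSet (mem_image_of_mem _ hq.1) hea, heq] with v hv hv'
    rw [hv, id, hv']
    rfl
  · rw [id, (Filter.EventuallyEq.iteratedFDeriv ℝ heq j).self_of_nhds]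
    exact hB j hj q hq.1

theorem MicrolocallySmoothAt.of_restrict {T : Distr E (univ : Set M)} {T' : Distr E W}
    (hT : ∀ φ : TestSpace E W, T.toLin (TestSpace.incl (subset_univ W) φ) = T'.toLin φ)
    {x : Cotangent E M} (h : MicrolocallySmoothAt T' x) : MicrolocallySmoothAt T x := by
  obtain ⟨χ, hχ, hχx, Z, hZ, hdec⟩ := h
  refine ⟨TestSpace.incl (subset_univ W) χ, hχ, hχx, Z, hZ, fun N => ?_⟩
  obtain ⟨C, hC⟩ := hdec N
  refine ⟨C, fun ζ hζ s hs => ?_⟩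
  have h1 : T.toLin (oscTest x.proj (TestSpace.incl (subset_univ W) χ) hχ ζ s) =
      T'.toLin (oscTest x.proj χ hχ ζ s) := by
    rw [← hT]
    rfl
  rw [h1]
  exact hC ζ hζ s hs

theorem microlocallySmoothAt_of_notMem {T : Distr E (univ : Set M)} {A : Set M} (hA : IsClosed A)
    (hsupp : ∀ φ : TestSpace E (univ : Set M), (∀ q ∈ A, (φ : M → ℂ) =ᶠ[𝓝 q] 0) → T.toLin φ = 0)
    {x : Cotangent E M} (hx : x.proj ∉ A) : MicrolocallySmoothAt T x := by
  obtain ⟨χ, hχ, hχ1⟩ := exists_testSpace_cutoff (E := E) (isCompact_singleton (x := x.proj))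
    (hA.isOpen_compl.inter (chartAt E x.proj).open_source)
    (singleton_subset_iff.2 ⟨hx, mem_chart_source E x.proj⟩) (subset_univ _)
  refine ⟨χ, hχ.trans inter_subset_right, ?_, univ, univ_mem, fun N => ⟨0, fun ζ _ s _ => ?_⟩⟩
  · rw [hχ1.self_of_nhdsSet _ rfl]
    exact one_ne_zero
  · rw [hsupp _ fun q hq => ?_, norm_zero, mul_zero]
    filter_upwards [notMem_tsupport_iff_eventuallyEq.1 fun h => (hχ h).1 hq] with r hr
    change (χ : M → ℂ) r * _ = 0
    rw [hr]
    simp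

end WordDistr

section Expansion

variable {E : Type} [NormedAddCommGroup E] [InnerProductSpace ℝ E] [FiniteDimensional ℝ E]
  [MeasurableSpace E] [BorelSpace E]
variable {M : Type*} [TopologicalSpace M] [T2Space M] [SigmaCompactSpace M] [ChartedSpace E M]
  [IsManifold 𝓘(ℝ, E) ∞ M]
variable {n : ℕ} {Y : Type*} [TopologicalSpace Y] [T2Space Y] [SigmaCompactSpace Y]
  [ChartedSpace (EuclideanSpace ℝ (Fin n)) Y] [IsManifold 𝓘(ℝ, EuclideanSpace ℝ (Fin n)) ∞ Y]
  [MeasurableSpace Y] [BorelSpace Y]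
variable {ι : Y → M} (hι : IsClosedSubmanifold (E := E) (E' := EuclideanSpace ℝ (Fin n)) ι)
variable {W : Set M} {d : ℕ}

/-- The map `φ ↦ c · ((∂_h^α φ) ∘ ι)`, for a smooth function `c` on the submanifold that is
supported in `W`. -/
def restrictDeriv (hι : IsClosedSubmanifold (E := E) (E' := EuclideanSpace ℝ (Fin n)) ι)
    (H : TransverseSystem E (range ι) W d) (α : Fin d → ℕ) {c : Y → ℂ}
    (hc : ContMDiff 𝓘(ℝ, EuclideanSpace ℝ (Fin n)) 𝓘(ℝ, ℂ) ∞ c) (hcW : tsupport c ⊆ ι ⁻¹' W) :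
    TestSpace E (univ : Set M) →ₗ[ℂ] TestSpace (EuclideanSpace ℝ (Fin n)) (univ : Set Y) where
  toFun φ := ⟨fun y => c y * multiIter (fun j => dirDeriv (H.field j)) α (φ : M → ℂ) (ι y), by
    rw [multiIter_eq_foldr]
    have hιc := hι.embedding.contMDiff.continuous
    have hs := tsupport_foldr_dirDeriv_subset (X := H.field) (φ : M → ℂ)
      ((List.finRange d).flatMap fun j => List.replicate (α j) j)
    refine ⟨contMDiff_of_tsupport fun y hy => ?_, ?_, subset_univ _⟩
    · have hyW : ι y ∈ W := hcW (tsupport_mul_subset_left hy)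
      exact contMDiffAt_mul (hc y) (((contMDiffOn_foldr_dirDeriv H.isOpen H.field_smooth
        φ.2.1.contMDiffOn _).contMDiffAt (H.isOpen.mem_nhds hyW)).comp y
          (hι.embedding.contMDiff y))
    · refine (hι.isClosedEmbedding.isCompact_preimage φ.2.2.1).of_isClosed_subset
        (isClosed_tsupport _) ((tsupport_mul_subset_right).trans ?_)
      exact (tsupport_comp_subset_preimage _ hιc).trans (preimage_mono hs)⟩
  map_add' φ φ' := TestSpace.ext fun y => by
    change c y * multiIter (fun j => dirDeriv (H.field j)) α ((φ : M → ℂ) + (φ' : M → ℂ)) (ι y) =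
      c y * multiIter (fun j => dirDeriv (H.field j)) α (φ : M → ℂ) (ι y) +
      c y * multiIter (fun j => dirDeriv (H.field j)) α (φ' : M → ℂ) (ι y)
    by_cases hy : y ∈ tsupport c
    · rw [multiIter_eq_foldr, multiIter_eq_foldr, multiIter_eq_foldr,
        foldr_dirDeriv_add H.isOpen H.field_smooth φ.2.1.contMDiffOn φ'.2.1.contMDiffOn _ (hcW hy),
        Pi.add_apply, mul_add]
    · rw [image_eq_zero_of_notMem_tsupport hy]
      simp
  map_smul' a φ := TestSpace.ext fun y => by
    change c y * multiIter (fun j => dirDeriv (H.field j)) α (a • (φ : M → ℂ)) (ι y) =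
      a * (c y * multiIter (fun j => dirDeriv (H.field j)) α (φ : M → ℂ) (ι y))
    by_cases hy : y ∈ tsupport c
    · rw [multiIter_eq_foldr, multiIter_eq_foldr,
        foldr_dirDeriv_smul H.isOpen H.field_smooth φ.2.1.contMDiffOn _ _ (hcW hy),
        Pi.smul_apply, smul_eq_mul, mul_left_comm]
    · rw [image_eq_zero_of_notMem_tsupport hy]
      simp

/-- The coefficients of a transverse expansion are unique: they are recovered, from the top degree
downwards, by testing against functions `h^γ g`. -/
theorem IsTransverseExpansion.unique {H : TransverseSystem E (range ι) W d}
    {τ : Distr E (univ : Set M)} {V : Set M} (hV : IsOpen V) (hιV : range ι ⊆ V) {F : M → Y}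
    (hF : ContMDiffOn 𝓘(ℝ, E) 𝓘(ℝ, EuclideanSpace ℝ (Fin n)) ∞ F V) (hFι : ∀ y, F (ι y) = y)
    {S S' : (Fin d → ℕ) → Distr (EuclideanSpace ℝ (Fin n)) (ι ⁻¹' W)}
    (hS : IsTransverseExpansion hι H τ S) (hS' : IsTransverseExpansion hι H τ S') : S' = S := by
  classical
  have hιc := hι.embedding.contMDiff.continuous
  suffices h : ∀ γ θ, (S' γ).toLin θ = (S γ).toLin θ by
    funext γ
    have h1 : (S' γ).toLin = (S γ).toLin := LinearMap.ext (h γ)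
    cases hγ : S γ
    cases hγ' : S' γ
    rw [hγ, hγ'] at h1
    cases h1
    rfl
  intro γ θ
  refine TestSpace.induction_on_local θ (P := fun θ => (S' γ).toLin θ = (S γ).toLin θ)
    (by rw [map_zero, map_zero]) (fun a b ha hb => by rw [map_add, map_add, ha, hb]) fun y hy => ?_
  obtain ⟨N₁, hN₁, hfin₁⟩ := hS.1 y (θ.2.2.2 hy)
  obtain ⟨N₂, hN₂, hfin₂⟩ := hS'.1 y (θ.2.2.2 hy)
  refine ⟨N₁ ∩ N₂, inter_mem hN₁ hN₂, fun θ hθ _ => ?_⟩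
  clear hy
  by_contra hne
  set B : Finset (Fin d → ℕ) := hfin₁.toFinset ∪ hfin₂.toFinset with hB
  have hB1 : ∀ β ∉ B, ∀ θ : TestSpace (EuclideanSpace ℝ (Fin n)) (ι ⁻¹' W),
      tsupport (θ : Y → ℂ) ⊆ N₁ ∩ N₂ → (S β).toLin θ = 0 := by
    intro β hβ θ hθ
    by_contra h
    exact hβ (Finset.mem_union_left _ (hfin₁.mem_toFinset.2
      ⟨θ, hθ.trans inter_subset_left, h⟩))
  have hB2 : ∀ β ∉ B, ∀ θ : TestSpace (EuclideanSpace ℝ (Fin n)) (ι ⁻¹' W),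
      tsupport (θ : Y → ℂ) ⊆ N₁ ∩ N₂ → (S' β).toLin θ = 0 := by
    intro β hβ θ hθ
    by_contra h
    exact hβ (Finset.mem_union_right _ (hfin₂.mem_toFinset.2
      ⟨θ, hθ.trans inter_subset_right, h⟩))
  -- A multi-index of maximal order with distinct coefficients.
  obtain ⟨γ, hγ, hmax⟩ := (B.filter fun γ => ∃ θ : TestSpace (EuclideanSpace ℝ (Fin n)) (ι ⁻¹' W),
      tsupport (θ : Y → ℂ) ⊆ N₁ ∩ N₂ ∧ (S' γ).toLin θ ≠ (S γ).toLin θ).exists_max_image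
    (fun γ => ∑ j, γ j) ⟨γ, Finset.mem_filter.2 ⟨by
      by_contra hn
      exact hne (by rw [hB1 γ hn θ hθ, hB2 γ hn θ hθ]), θ, hθ, hne⟩⟩
  obtain ⟨hγB, θ, hθ, hne⟩ := Finset.mem_filter.1 hγ
  have htop : ∀ β, ∑ j, γ j < ∑ j, β j → ∀ θ : TestSpace (EuclideanSpace ℝ (Fin n)) (ι ⁻¹' W),
      tsupport (θ : Y → ℂ) ⊆ N₁ ∩ N₂ →
      (S' β).toLin θ = (S β).toLin θ := by
    intro β hβ θ hθ
    by_contra h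
    by_cases hn : β ∈ B
    · exact absurd (hmax β (Finset.mem_filter.2 ⟨hn, θ, hθ, h⟩)) (by omega)
    · exact h (by rw [hB1 β hn θ hθ, hB2 β hn θ hθ])
  -- An extension of `θ` to a neighbourhood of `I`.
  obtain ⟨χ, hχV, hχ1⟩ := exists_testSpace_cutoff (E := E) (θ.2.2.1.image hιc)
    (hV.inter H.isOpen) (by
      rintro _ ⟨y, hy, rfl⟩
      exact ⟨hιV (mem_range_self y), θ.2.2.2 hy⟩) (inter_subset_right (s := V))
  have hχV' : tsupport (χ : M → ℂ) ⊆ V := hχV.trans inter_subset_left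
  let g : TestSpace E W := mulOn χ hV hχV' (fun q => (θ : Y → ℂ) (F q))
    (θ.2.1.comp_contMDiffOn hF)
  have hgs : tsupport (g : M → ℂ) ⊆ tsupport (χ : M → ℂ) ∩ F ⁻¹' tsupport (θ : Y → ℂ) :=
    tsupport_mul_comp_subset hV hF.continuousOn hχV' (θ : Y → ℂ)
  have hgι : ∀ y, (g : M → ℂ) (ι y) = (θ : Y → ℂ) y := by
    intro y
    change (χ : M → ℂ) (ι y) * (θ : Y → ℂ) (F (ι y)) = _
    rw [hFι]
    by_cases hy : y ∈ tsupport (θ : Y → ℂ)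
    · rw [hχ1.self_of_nhdsSet _ (mem_image_of_mem ι hy), one_mul]
    · rw [TestSpace.eq_zero_of_notMem θ hy, mul_zero]
  let φ : TestSpace E W := mulOn g H.isOpen g.2.2.2 _ (H.contMDiffOn_monomial γ)
  have hφ : (φ : M → ℂ) = H.monomialMul γ (g : M → ℂ) := funext fun q => mul_comm _ _
  let D : (Fin d → ℕ) → TestSpace (EuclideanSpace ℝ (Fin n)) (ι ⁻¹' W) := fun β =>
    pullTest hι W (((List.finRange d).flatMap fun j => List.replicate (β j) j).reverse.foldr
      (fun j φ => derivTest H.isOpen (H.field j) (H.field_smooth j) φ) φ)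
  have hD : ∀ β y, ((D β : TestSpace (EuclideanSpace ℝ (Fin n)) (ι ⁻¹' W)) : Y → ℂ) y =
      ((List.finRange d).flatMap fun j => List.replicate (β j) j).reverse.foldr
        (fun j => dirDeriv (H.field j)) (H.monomialMul γ (g : M → ℂ)) (ι y) := by
    intro β y
    change ((List.foldr _ φ _ : TestSpace E W) : M → ℂ) (ι y) = _
    rw [H.coe_foldr_derivTest, hφ]
  have hDs : ∀ β, tsupport (D β : Y → ℂ) ⊆ N₁ ∩ N₂ := by
    intro β y hy
    have h1 : ι y ∈ tsupport ((((List.finRange d).flatMap fun j =>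
        List.replicate (β j) j).reverse.foldr (fun j φ => derivTest H.isOpen (H.field j)
          (H.field_smooth j) φ) φ : TestSpace E W) : M → ℂ) :=
      tsupport_comp_subset_preimage _ hιc hy
    rw [H.coe_foldr_derivTest] at h1
    have h2 : ι y ∈ tsupport (g : M → ℂ) :=
      tsupport_mul_subset_left (tsupport_foldr_dirDeriv_subset _ _ h1)
    have h3 : F (ι y) ∈ tsupport (θ : Y → ℂ) := (hgs h2).2
    rw [hFι] at h3
    exact hθ h3
  have hterm : ∀ (T : (Fin d → ℕ) → Distr (EuclideanSpace ℝ (Fin n)) (ι ⁻¹' W)) β,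
      multiIter H.derivDistr β (pushDistr hι W (T β)) φ =
        (-1) ^ (∑ j, β j) * (T β).toLin (D β) := by
    intro T β
    rw [multiIter_eq_foldr, H.foldr_derivDistr_apply, length_multiIter_word]
    rfl
  have hlow : ∀ β, β ≠ γ → ∑ j, β j ≤ ∑ j, γ j → D β = 0 := by
    intro β hβ hle
    refine TestSpace.ext fun y => ?_
    rw [hD]
    by_cases hy : ι y ∈ W
    · rw [H.foldr_dirDeriv_monomialMul (mem_range_self y) hy _ _ g.2.1.contMDiffOn (by
        rw [List.length_reverse, length_multiIter_word]; exact hle), if_neg]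
      · rfl
      · intro h
        refine hβ (funext fun j => ?_)
        rw [← h j, List.count_reverse, count_multiIter_word]
    · have h1 := hD β y
      rw [TestSpace.eq_zero_of_notMem (D β) fun h => hy ((D β).2.2.2 h)] at h1
      exact h1.symm
  have hdiag : D γ = (∏ j, ((γ j).factorial : ℂ)) • θ := by
    refine TestSpace.ext fun y => ?_
    rw [hD]
    by_cases hy : ι y ∈ W
    · rw [H.foldr_dirDeriv_monomialMul (mem_range_self y) hy _ _ g.2.1.contMDiffOn (by
        rw [List.length_reverse, length_multiIter_word]), if_pos, hgι]
      · rfl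
      · intro j
        rw [List.count_reverse, count_multiIter_word]
    · have h1 := hD γ y
      rw [TestSpace.eq_zero_of_notMem (D γ) fun h => hy ((D γ).2.2.2 h)] at h1
      rw [← h1]
      change 0 = _ * (θ : Y → ℂ) y
      rw [TestSpace.eq_zero_of_notMem θ fun h => hy (θ.2.2.2 h), mul_zero]
  have hsum : ∀ (T : (Fin d → ℕ) → Distr (EuclideanSpace ℝ (Fin n)) (ι ⁻¹' W)),
      IsTransverseExpansion hι H τ T → (∀ β ∉ B,
      ∀ θ : TestSpace (EuclideanSpace ℝ (Fin n)) (ι ⁻¹' W), tsupport (θ : Y → ℂ) ⊆ N₁ ∩ N₂ →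
        (T β).toLin θ = 0) → τ.toLin (TestSpace.incl (subset_univ W) φ) =
          ∑ β ∈ B, (-1) ^ (∑ j, β j) * (T β).toLin (D β) := by
    intro T hT hTB
    rw [hT.2 φ]
    simp only [hterm T]
    refine finsum_eq_sum_of_support_subset _ fun β hβ => ?_
    by_contra hn
    exact hβ (by
      change (-1) ^ (∑ j, β j) * (T β).toLin (D β) = 0
      rw [hTB β hn _ (hDs β), mul_zero])
  have h1 := (hsum S' hS' hB2).symm.trans (hsum S hS hB1)
  rw [← sub_eq_zero, ← Finset.sum_sub_distrib, Finset.sum_eq_single γ] at h1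
  · rw [hdiag, map_smul, map_smul, ← mul_sub, ← smul_sub, smul_eq_mul, mul_eq_zero,
      mul_eq_zero] at h1
    rcases h1 with h1 | h1 | h1
    · exact absurd h1 (pow_ne_zero _ (by norm_num))
    · exact absurd h1 (Finset.prod_ne_zero_iff.2 fun j _ => by
        exact_mod_cast (Nat.factorial_pos _).ne')
    · exact hne (sub_eq_zero.1 h1)
  · intro β _ hβγ
    rcases le_or_gt (∑ j, β j) (∑ j, γ j) with h | h
    · rw [hlow β hβγ h, map_zero, map_zero, sub_self]
    · rw [htop β h _ (hDs β), sub_self]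
  · exact fun h => absurd hγB h

/-- The distribution `φ ↦ ∫ f ((∂_h^α φ) ∘ ι) dμ`, its wave front set and its transverse
expansion. -/
theorem exists_layer_distr {μ : Measure Y} (hμ : IsSmoothPositiveDensity n μ)
    (H : TransverseSystem E (range ι) W d) (α : Fin d → ℕ) {f : Y → ℂ}
    (hf : ContMDiff 𝓘(ℝ, EuclideanSpace ℝ (Fin n)) 𝓘(ℝ, ℂ) ∞ f) (hfW : tsupport f ⊆ ι ⁻¹' W) :
    ∃ τ : Distr E (univ : Set M),
      (∀ φ : TestSpace E (univ : Set M), τ.toLin φ =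
        ∫ y, f y * multiIter (fun j => dirDeriv (H.field j)) α (φ : M → ℂ) (ι y) ∂μ) ∧
      WF τ ⊆ conormal (E' := EuclideanSpace ℝ (Fin n)) ι ∧
      ∃ S : (Fin d → ℕ) → Distr (EuclideanSpace ℝ (Fin n)) (ι ⁻¹' W),
        IsTransverseExpansion hι H τ S ∧ ∀ β, IsSmoothDistr μ (S β) := by
  classical
  have hfin : IsLocallyFiniteMeasure μ := hμ.isLocallyFiniteMeasure
  have hιc := hι.embedding.contMDiff.continuous
  set word := (List.finRange d).flatMap fun j => List.replicate (α j) j with hword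
  let T : TestSpace E (univ : Set M) →ₗ[ℂ] ℂ :=
    (densityDistr (n := n) μ (continuous_const (y := (1 : ℂ))) (univ : Set Y)).toLin ∘ₗ
      restrictDeriv hι H α hf hfW
  have hT : ∀ φ : TestSpace E (univ : Set M), T φ =
      ∫ y, f y * multiIter (fun j => dirDeriv (H.field j)) α (φ : M → ℂ) (ι y) ∂μ := by
    intro φ
    change ∫ y, 1 * (f y * multiIter (fun j => dirDeriv (H.field j)) α (φ : M → ℂ) (ι y)) ∂μ = _
    simp only [one_mul]
  have hsgn : ((-1 : ℂ) ^ word.length) * (-1) ^ word.length = 1 := by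
    rw [← mul_pow]; simp
  have hfs : ContMDiff 𝓘(ℝ, EuclideanSpace ℝ (Fin n)) 𝓘(ℝ, ℂ) ∞
      (fun y => (-1) ^ word.length * f y) := fun y => contMDiffAt_mul contMDiffAt_const (hf y)
  obtain ⟨T', hT', hmic⟩ := H.exists_distr_foldr (pushDensity hι μ hfs.continuous W) word
  have hexp : ∀ φ : TestSpace E W, word.foldr H.derivDistr
      (pushDistr hι W (densityDistr μ hfs.continuous (ι ⁻¹' W))) φ =
      T (TestSpace.incl (subset_univ W) φ) := by
    intro φ
    rw [H.foldr_derivDistr_apply, H.foldr_derivTest_perm φ word.reverse_perm, hT]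
    change _ * ∫ y, ((-1) ^ word.length * f y) *
      ((List.foldr _ φ _ : TestSpace E W) : M → ℂ) (ι y) ∂μ = _
    rw [H.coe_foldr_derivTest, ← integral_const_mul]
    refine integral_congr_ae (ae_of_all _ fun y => ?_)
    change (-1) ^ word.length * (((-1) ^ word.length * f y) * _) = _
    rw [← mul_assoc, ← mul_assoc, hsgn, one_mul, multiIter_eq_foldr]
    rfl
  have hA : IsClosed (ι '' tsupport f) :=
    hι.isClosedEmbedding.isClosedMap _ (isClosed_tsupport f)
  have hAW : ι '' tsupport f ⊆ W := by
    rintro _ ⟨y, hy, rfl⟩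
    exact hfW hy
  have hres : ∀ φ : TestSpace E W, T (TestSpace.incl (subset_univ W) φ) = T'.toLin φ := fun φ => by
    rw [← hexp, hT']
    rfl
  have hsupp : ∀ φ : TestSpace E (univ : Set M),
      (∀ q ∈ ι '' tsupport f, (φ : M → ℂ) =ᶠ[𝓝 q] 0) → T φ = 0 := by
    intro φ hφ
    rw [hT, ← integral_zero Y ℂ (μ := μ)]
    refine integral_congr_ae (ae_of_all _ fun y => ?_)
    change f y * _ = 0
    by_cases hy : y ∈ tsupport f
    · have h1 : ι y ∉ tsupport (φ : M → ℂ) :=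
        notMem_tsupport_iff_eventuallyEq.2 (hφ _ (mem_image_of_mem ι hy))
      rw [multiIter_eq_foldr, image_eq_zero_of_notMem_tsupport fun h =>
        h1 (tsupport_foldr_dirDeriv_subset _ _ h), mul_zero]
    · rw [image_eq_zero_of_notMem_tsupport hy, zero_mul]
  let S : (Fin d → ℕ) → Distr (EuclideanSpace ℝ (Fin n)) (ι ⁻¹' W) := fun β =>
    if β = α then densityDistr μ hfs.continuous (ι ⁻¹' W)
    else densityDistr μ (continuous_const (y := (0 : ℂ))) (ι ⁻¹' W)
  have hSα : S α = densityDistr μ hfs.continuous (ι ⁻¹' W) := if_pos rfl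
  have hSβ : ∀ β, β ≠ α → S β = densityDistr μ (continuous_const (y := (0 : ℂ))) (ι ⁻¹' W) :=
    fun β hβ => if_neg hβ
  let τ : Distr E (univ : Set M) :=
    ⟨T, isDistribution_of_restrict H.isOpen hA hAW T' hres hsupp⟩
  refine ⟨τ, hT, fun x hx => ?_, S, ⟨fun y _ => ?_, fun φ => ?_⟩, fun β => ?_⟩
  · by_contra hn
    refine hx.2.2 ?_
    by_cases hxA : x.proj ∈ ι '' tsupport f
    · exact (hmic x (hAW hxA) (microlocallySmoothAt_pushDensity hι hμ hfs H.isOpen (hAW hxA)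
        hx.2.1 hn)).of_restrict (T := τ) hres
    · exact microlocallySmoothAt_of_notMem (T := τ) hA hsupp hxA
  · refine ⟨univ, univ_mem, (finite_singleton α).subset ?_⟩
    rintro β ⟨θ, -, hθ⟩
    by_contra hn
    refine hθ ?_
    rw [hSβ β hn]
    change ∫ y, 0 * (θ : Y → ℂ) y ∂μ = 0
    simp
  · rw [finsum_eq_single _ α]
    · rw [hSα, multiIter_eq_foldr]
      exact (hexp φ).symm
    · intro β hβ
      rw [hSβ β hβ, multiIter_eq_foldr, H.foldr_derivDistr_apply]
      change _ * ∫ y, 0 * _ ∂μ = 0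
      simp
  · by_cases hβ : β = α
    · rw [hβ, hSα]
      exact ⟨_, hfs.contMDiffOn, fun θ => rfl⟩
    · rw [hSβ β hβ]
      exact ⟨fun _ => 0, contMDiffOn_const, fun θ => rfl⟩

end Expansion

/-! ### Smoothness of superposition operators -/

section Superposition

variable {K : Type} [TopologicalSpace K] [CompactSpace K]
variable {E : Type} [NormedAddCommGroup E] [NormedSpace ℝ E]

/-- The bilinear map `(A, δ) ↦ (x ↦ A x (δ x))` on continuous functions. -/
def pointwiseApply (K E F : Type) [TopologicalSpace K] [CompactSpace K] [NormedAddCommGroup E]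
    [NormedSpace ℝ E] [NormedAddCommGroup F] [NormedSpace ℝ F] :
    C(K, E →L[ℝ] F) →L[ℝ] C(K, E) →L[ℝ] C(K, F) :=
  LinearMap.mkContinuous₂
    (LinearMap.mk₂ ℝ (fun (A : C(K, E →L[ℝ] F)) (δ : C(K, E)) =>
        (⟨fun x => A x (δ x), A.continuous.clm_apply δ.continuous⟩ : C(K, F)))
      (fun A A' δ => by ext x; rfl) (fun c A δ => by ext x; rfl)
      (fun A δ δ' => by ext x; exact map_add (A x) _ _)
      (fun c A δ => by ext x; exact map_smul (A x) _ _)) 1 fun A δ => by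
    rw [one_mul, ContinuousMap.norm_le _ (by positivity)]
    exact fun x => (A x).le_of_opNorm_le_of_le (A.norm_coe_le_norm x) (δ.norm_coe_le_norm x)

/-- The superposition operator `γ ↦ f ∘ γ` on continuous functions. -/
def superpose {F : Type} [TopologicalSpace F] {f : E → F} (hf : Continuous f) (γ : C(K, E)) :
    C(K, F) := ContinuousMap.comp ⟨f, hf⟩ γ

theorem hasFDerivAt_superpose {F : Type} [NormedAddCommGroup F] [NormedSpace ℝ F] {f : E → F}
    (hf : ContDiff ℝ ∞ f) (γ : C(K, E)) :
    HasFDerivAt (superpose (K := K) hf.continuous)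
      (pointwiseApply K E F (superpose (hf.continuous_fderiv (by simp)) γ)) γ := by
  have hdf : Continuous (fderiv ℝ f) := hf.continuous_fderiv (by simp)
  refine HasFDerivAt.of_isLittleO (Asymptotics.IsLittleO.of_bound fun ε hε => ?_)
  have huc := (isCompact_range γ.continuous).uniformContinuousAt_of_continuousAt (fderiv ℝ f)
    (fun x _ => hdf.continuousAt) (Metric.dist_mem_uniformity hε)
  obtain ⟨δ, hδ, hδs⟩ := Metric.mem_uniformity_dist.1 huc
  filter_upwards [Metric.ball_mem_nhds γ hδ] with γ' hγ'
  rw [ContinuousMap.norm_le _ (by positivity)]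
  intro x
  have hx : dist (γ' x) (γ x) < δ := (ContinuousMap.dist_apply_le_dist x).trans_lt hγ'
  have hle : ‖f (γ' x) - f (γ x) - fderiv ℝ f (γ x) (γ' x - γ x)‖ ≤ ε * ‖γ' x - γ x‖ := by
    refine (convex_ball (γ x) δ).norm_image_sub_le_of_norm_fderiv_le' (𝕜 := ℝ)
      (fun y _ => hf.differentiable (by simp) y) (fun y hy => ?_) (Metric.mem_ball_self hδ) hx
    have h1 : dist (fderiv ℝ f (γ x)) (fderiv ℝ f y) < ε :=
      @hδs (γ x) y (by rw [dist_comm]; exact hy) (mem_range_self x)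
    rw [dist_comm, dist_eq_norm] at h1
    exact h1.le
  exact hle.trans (mul_le_mul_of_nonneg_left ((γ' - γ).norm_coe_le_norm x) hε.le)

theorem contDiff_superpose {F : Type} [NormedAddCommGroup F] [NormedSpace ℝ F] {f : E → F}
    (hf : ContDiff ℝ ∞ f) : ContDiff ℝ ∞ (superpose (K := K) hf.continuous) := by
  rw [contDiff_infty]
  intro n
  induction n generalizing F with
  | zero =>
    rw [Nat.cast_zero, contDiff_zero]
    exact ContinuousMap.continuous_postcomp _
  | succ n ih =>
    have h := contDiff_succ_iff_hasFDerivAt (𝕜 := ℝ)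
      (f := superpose (K := K) hf.continuous) (n := n)
    rw [Nat.cast_succ, h]
    exact ⟨_, (pointwiseApply K E F).contDiff.comp (ih (hf.fderiv_right (m := ∞) (by simp))),
      hasFDerivAt_superpose hf⟩

end Superposition

/-! ### A regular initial value problem -/

section Integrals

variable {Z : Type} [NormedAddCommGroup Z] [NormedSpace ℝ Z] [CompleteSpace Z]

/-- A continuous function on `[0,1]`, extended by constants. -/
def extendIcc (φ : C(unitInterval, Z)) (s : ℝ) : Z := φ (projIcc 0 1 zero_le_one s)

theorem continuous_extendIcc (φ : C(unitInterval, Z)) : Continuous (extendIcc φ) :=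
  φ.continuous.comp continuous_projIcc

theorem norm_extendIcc_le (φ : C(unitInterval, Z)) (s : ℝ) : ‖extendIcc φ s‖ ≤ ‖φ‖ :=
  φ.norm_coe_le_norm _

theorem extendIcc_of_mem (φ : C(unitInterval, Z)) {s : ℝ} (hs : s ∈ unitInterval) :
    extendIcc φ s = φ ⟨s, hs⟩ := by
  rw [extendIcc, projIcc_of_mem]

/-- The operator `φ ↦ (s ↦ ∫_1^s φ)` on continuous functions on `[0,1]`. -/
def primitiveOp (Z : Type) [NormedAddCommGroup Z] [NormedSpace ℝ Z] [CompleteSpace Z] :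
    C(unitInterval, Z) →L[ℝ] C(unitInterval, Z) :=
  LinearMap.mkContinuous
    { toFun := fun φ => ⟨fun s => ∫ r in (1 : ℝ)..s, extendIcc φ r,
        (intervalIntegral.continuous_primitive (fun _ _ =>
          (continuous_extendIcc φ).intervalIntegrable _ _) 1).comp continuous_subtype_val⟩
      map_add' := fun φ φ' => by
        ext s
        exact intervalIntegral.integral_add ((continuous_extendIcc φ).intervalIntegrable _ _)
          ((continuous_extendIcc φ').intervalIntegrable _ _)
      map_smul' := fun c φ => by
        ext s
        exact intervalIntegral.integral_smul c _ } 1 fun φ => by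
    rw [one_mul, ContinuousMap.norm_le _ (norm_nonneg _)]
    intro s
    refine (intervalIntegral.norm_integral_le_of_norm_le_const
      (C := ‖φ‖) fun r _ => norm_extendIcc_le φ r).trans ?_
    have h1 : |(s : ℝ) - 1| ≤ 1 := by
      rw [abs_le]
      constructor <;> linarith [s.2.1, s.2.2]
    exact mul_le_of_le_one_right (norm_nonneg _) h1

theorem primitiveOp_apply (φ : C(unitInterval, Z)) (s : unitInterval) :
    primitiveOp Z φ s = ∫ r in (1 : ℝ)..s, extendIcc φ r := rfl

theorem hasDerivAt_extendIcc_primitiveOp (φ : C(unitInterval, Z)) {s : ℝ} (hs : s ∈ unitInterval) :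
    HasDerivWithinAt (extendIcc (primitiveOp Z φ)) (extendIcc φ s) unitInterval s := by
  have h1 : HasDerivAt (fun s => ∫ r in (1 : ℝ)..s, extendIcc φ r) (extendIcc φ s) s :=
    intervalIntegral.integral_hasDerivAt_right ((continuous_extendIcc φ).intervalIntegrable _ _)
      ((continuous_extendIcc φ).stronglyMeasurableAtFilter _ _)
      (continuous_extendIcc φ).continuousAt
  refine h1.hasDerivWithinAt.congr (fun r hr => ?_) ?_
  · rw [extendIcc_of_mem _ hr, primitiveOp_apply]
  · rw [extendIcc_of_mem _ hs, primitiveOp_apply]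

/-- Integration over `[0,1]` as a continuous linear map. -/
def integralOp (Z : Type) [NormedAddCommGroup Z] [NormedSpace ℝ Z] [CompleteSpace Z] :
    C(unitInterval, Z) →L[ℝ] Z :=
  -(ContinuousMap.evalCLM ℝ (⟨0, by simp⟩ : unitInterval)).comp (primitiveOp Z)

theorem integralOp_apply (φ : C(unitInterval, Z)) :
    integralOp Z φ = ∫ r in (0 : ℝ)..1, extendIcc φ r := by
  change -(∫ r in (1 : ℝ)..0, extendIcc φ r) = _
  rw [intervalIntegral.integral_symm, neg_neg]

/-- Hadamard's lemma: `w (x, h) - w (x, 0)` is a smooth multiple of `h`. -/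
theorem exists_hadamard {X F G : Type} [NormedAddCommGroup X] [NormedSpace ℝ X]
    [NormedAddCommGroup F] [NormedSpace ℝ F] [NormedAddCommGroup G] [NormedSpace ℝ G]
    [CompleteSpace G] {w : X × F → G} (hw : ContDiff ℝ ∞ w) :
    ∃ A : X × F → F →L[ℝ] G, ContDiff ℝ ∞ A ∧ (∀ x h, w (x, h) = w (x, 0) + A (x, h) h) ∧
      ∀ x, A (x, 0) = (fderiv ℝ w (x, 0)).comp (ContinuousLinearMap.inr ℝ X F) := by
  let D : X × F → F →L[ℝ] G := fun z => (fderiv ℝ w z).comp (ContinuousLinearMap.inr ℝ X F)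
  have hD : ContDiff ℝ ∞ D := (hw.fderiv_right (m := ∞) (by simp)).clm_comp contDiff_const
  -- The segment from `(x, 0)` to `(x, h)`, which depends linearly on `(x, h)`.
  let c : X × F →L[ℝ] C(unitInterval, X × F) := LinearMap.mkContinuous
    { toFun := fun z => ⟨fun s => (z.1, (s : ℝ) • z.2), by fun_prop⟩
      map_add' := fun z z' => by ext s <;> simp
      map_smul' := fun a z => by ext s <;> simp [smul_comm a] } 1 fun z => by
    rw [one_mul, ContinuousMap.norm_le _ (norm_nonneg _)]
    intro s
    refine max_le (norm_fst_le z) (le_trans ?_ (norm_snd_le z))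
    change ‖(s : ℝ) • z.2‖ ≤ _
    rw [norm_smul, Real.norm_of_nonneg s.2.1]
    exact mul_le_of_le_one_left (norm_nonneg _) s.2.2
  refine ⟨fun z => integralOp _ (superpose hD.continuous (c z)),
    (integralOp (F →L[ℝ] G)).contDiff.comp ((contDiff_superpose hD).comp c.contDiff), fun x h => ?_,
    fun x => ?_⟩
  · have h1 : ∀ s ∈ uIcc (0 : ℝ) 1, HasDerivAt (fun s : ℝ => w (x, s • h)) (D (x, s • h) h) s := by
      intro s _
      have h2 : HasDerivAt (fun s : ℝ => (x, s • h)) ((0 : X), h) s := by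
        refine (hasDerivAt_const s x).prodMk ?_
        simpa using (hasDerivAt_id s).smul_const h
      exact ((hw.differentiable (by simp) (x, s • h)).hasFDerivAt).comp_hasDerivAt s h2
    have hcont : Continuous fun s : ℝ => D (x, s • h) h := by
      have := hD.continuous
      fun_prop
    have h3 := intervalIntegral.integral_eq_sub_of_hasDerivAt h1 (hcont.intervalIntegrable _ _)
    have h4 : integralOp _ (superpose hD.continuous (c (x, h))) h =
        ∫ s in (0 : ℝ)..1, D (x, s • h) h := by
      rw [integralOp_apply, ContinuousLinearMap.intervalIntegral_apply
        ((continuous_extendIcc _).intervalIntegrable _ _)]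
      refine intervalIntegral.integral_congr fun s hs => ?_
      rw [uIcc_of_le zero_le_one] at hs
      change (extendIcc (superpose hD.continuous (c (x, h))) s : F →L[ℝ] G) h = _
      rw [extendIcc_of_mem _ hs]
      rfl
    simp only [h4, h3]
    rw [one_smul, zero_smul]
    abel
  · change integralOp _ (superpose hD.continuous (c (x, 0))) = _
    rw [integralOp_apply]
    have h1 : ∀ s, extendIcc (superpose hD.continuous (c (x, 0))) s = D (x, 0) := by
      intro s
      change D (x, _ • 0) = _
      rw [smul_zero]
    simp only [h1]
    simp [D]

/-- Smooth dependence on the initial value at time `1` of the solutions on `[0,1]` of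
`z' = g (s, z)` near a constant solution `z₀` whose linearized equation is nilpotent. -/
theorem exists_smooth_solutions {g : ℝ × Z → Z} (hg : ContDiff ℝ ∞ g) {z₀ : Z}
    (hg0 : ∀ s, g (s, z₀) = 0) {N : Z →L[ℝ] Z} (hN : N.comp N = 0)
    (hdg : ∀ s, (fderiv ℝ g (s, z₀)).comp (ContinuousLinearMap.inr ℝ ℝ Z) = N) :
    ∃ (O : Set Z) (Γ : Z → C(unitInterval, Z)), IsOpen O ∧ z₀ ∈ O ∧ ContDiffOn ℝ ∞ Γ O ∧
      Γ z₀ = ContinuousMap.const _ z₀ ∧ ∀ z ∈ O, Γ z ⟨1, by simp⟩ = z ∧ ∀ s ∈ unitInterval,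
        HasDerivWithinAt (extendIcc (Γ z)) (g (s, extendIcc (Γ z) s)) unitInterval s := by
  -- Solutions are the zeros of `γ ↦ γ - z - ∫_1 g (s, γ s) ds`.
  let incl : C(unitInterval, Z) → C(unitInterval, ℝ × Z) := fun γ =>
    ⟨fun s => ((s : ℝ), γ s), by fun_prop⟩
  let tm : C(unitInterval, ℝ × Z) := ⟨fun s => ((s : ℝ), 0), by fun_prop⟩
  let inr : C(unitInterval, Z) →L[ℝ] C(unitInterval, ℝ × Z) :=
    (ContinuousLinearMap.inr ℝ ℝ Z).compLeftContinuous ℝ unitInterval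
  have hincl : incl = fun γ => tm + inr γ := by
    ext γ s
    · change (s : ℝ) = s + 0
      rw [add_zero]
    · change γ s = 0 + γ s
      rw [zero_add]
  have hincl' : ∀ γ, HasFDerivAt incl inr γ := fun γ => by
    rw [hincl]
    exact inr.hasFDerivAt.const_add tm
  have hincls : ContDiff ℝ ∞ incl := by
    rw [hincl]
    exact contDiff_const.add inr.contDiff
  let Ψ : C(unitInterval, Z) → C(unitInterval, Z) := fun γ =>
    γ - primitiveOp Z (superpose hg.continuous (incl γ))
  have hΨ : ContDiff ℝ ∞ Ψ :=
    contDiff_id.sub ((primitiveOp Z).contDiff.comp ((contDiff_superpose hg).comp hincls))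
  set γ₀ : C(unitInterval, Z) := ContinuousMap.const _ z₀ with hγ₀
  let L : C(unitInterval, Z) →L[ℝ] C(unitInterval, Z) :=
    (primitiveOp Z).comp (N.compLeftContinuous ℝ unitInterval)
  have hΨ' : HasFDerivAt Ψ (ContinuousLinearMap.id ℝ _ - L) γ₀ := by
    have h1 := (hasFDerivAt_id γ₀).sub ((primitiveOp Z).hasFDerivAt.comp γ₀
      ((hasFDerivAt_superpose hg (incl γ₀)).comp γ₀ (hincl' γ₀)))
    refine h1.congr_fderiv ?_
    congr 1
    change (primitiveOp Z).comp _ = (primitiveOp Z).comp _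
    congr 1
    ext δ s
    change fderiv ℝ g ((s : ℝ), z₀) (0, δ s) = N (δ s)
    rw [← hdg s]
    rfl
  have hLL : L.comp L = 0 := by
    ext δ s
    change ∫ r in (1 : ℝ)..s, extendIcc ((N.compLeftContinuous ℝ unitInterval) (L δ)) r = 0
    have h1 : ∀ r, extendIcc ((N.compLeftContinuous ℝ unitInterval) (L δ)) r = 0 := by
      intro r
      change N (∫ q in (1 : ℝ)..(projIcc 0 1 zero_le_one r : unitInterval),
        extendIcc ((N.compLeftContinuous ℝ unitInterval) δ) q) = 0
      rw [← ContinuousLinearMap.intervalIntegral_comp_comm _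
        ((continuous_extendIcc _).intervalIntegrable _ _)]
      have h2 : ∀ q, N (extendIcc ((N.compLeftContinuous ℝ unitInterval) δ) q) = 0 := fun q =>
        congrArg (fun A : Z →L[ℝ] Z => A (δ (projIcc 0 1 zero_le_one q))) hN
      simp only [h2, intervalIntegral.integral_zero]
    simp only [h1, intervalIntegral.integral_zero]
  let e : C(unitInterval, Z) ≃L[ℝ] C(unitInterval, Z) := ContinuousLinearEquiv.equivOfInverse
    (ContinuousLinearMap.id ℝ _ - L) (ContinuousLinearMap.id ℝ _ + L)
    (fun δ => by
      have h1 : L (L δ) = 0 :=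
        congrArg (fun A : C(unitInterval, Z) →L[ℝ] C(unitInterval, Z) => A δ) hLL
      change (δ - L δ) + L (δ - L δ) = δ
      rw [map_sub, h1]
      abel)
    (fun δ => by
      have h1 : L (L δ) = 0 :=
        congrArg (fun A : C(unitInterval, Z) →L[ℝ] C(unitInterval, Z) => A δ) hLL
      change (δ + L δ) - L (δ + L δ) = δ
      rw [map_add, h1]
      abel)
  have hΨe : HasFDerivAt Ψ (e : C(unitInterval, Z) →L[ℝ] C(unitInterval, Z)) γ₀ := hΨ'
  have hΨat : ContDiffAt ℝ ∞ Ψ γ₀ := hΨ.contDiffAt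
  let Θ := hΨat.toOpenPartialHomeomorph Ψ hΨe (by simp)
  have hΘ : ∀ γ, Θ γ = Ψ γ := fun γ => rfl
  have hγ₀s : γ₀ ∈ Θ.source := hΨat.mem_toOpenPartialHomeomorph_source hΨe (by simp)
  have hΨγ₀ : Ψ γ₀ = γ₀ := by
    ext s
    change γ₀ s - ∫ r in (1 : ℝ)..s, extendIcc (superpose hg.continuous (incl γ₀)) r = γ₀ s
    have h1 : ∀ r, extendIcc (superpose hg.continuous (incl γ₀)) r = 0 := fun r => hg0 _
    simp only [h1, intervalIntegral.integral_zero, sub_zero]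
  have hγ₀t : γ₀ ∈ Θ.target := by
    have := Θ.map_source hγ₀s
    rwa [hΘ, hΨγ₀] at this
  have hsymm : Θ.symm γ₀ = γ₀ := by
    have := Θ.left_inv hγ₀s
    rwa [hΘ, hΨγ₀] at this
  -- The inverse of `Ψ` is smooth where the derivative of `Ψ` is invertible.
  have hinv : IsOpen {γ | ∃ e' : C(unitInterval, Z) ≃L[ℝ] C(unitInterval, Z),
      (e' : C(unitInterval, Z) →L[ℝ] C(unitInterval, Z)) =
      fderiv ℝ Ψ γ} :=
    (ContinuousLinearEquiv.isOpen (𝕜 := ℝ) (E := C(unitInterval, Z))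
      (F := C(unitInterval, Z))).preimage
      (hΨ.continuous_fderiv (by simp))
  have hT : IsOpen (Θ.target ∩ Θ.symm ⁻¹' {γ | ∃ e' : C(unitInterval, Z) ≃L[ℝ] C(unitInterval, Z),
      (e' : C(unitInterval, Z) →L[ℝ] C(unitInterval, Z)) = fderiv ℝ Ψ γ}) :=
    Θ.isOpen_inter_preimage_symm hinv
  let const : Z →L[ℝ] C(unitInterval, Z) := ContinuousLinearMap.const ℝ unitInterval
  refine ⟨const ⁻¹' _, fun z => Θ.symm (const z), hT.preimage const.continuous, ⟨hγ₀t, ?_⟩, ?_,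
    hsymm, fun z hz => ?_⟩
  · refine ⟨e, ?_⟩
    change _ = fderiv ℝ Ψ (Θ.symm γ₀)
    rw [hsymm, hΨe.fderiv]
  · intro z hz
    obtain ⟨hzt, e', he'⟩ := hz
    have h1 : HasFDerivAt Θ (e' : C(unitInterval, Z) →L[ℝ] C(unitInterval, Z))
        (Θ.symm (const z)) := by
      rw [he']
      exact (hΨ.differentiable (by simp) _).hasFDerivAt
    exact ((Θ.contDiffAt_symm hzt h1 hΨ.contDiffAt).comp z
      const.contDiff.contDiffAt).contDiffWithinAt
  · set γ := Θ.symm (const z) with hγ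
    have h1 : γ - primitiveOp Z (superpose hg.continuous (incl γ)) = const z := Θ.right_inv hz.1
    have h2 : γ = const z + primitiveOp Z (superpose hg.continuous (incl γ)) :=
      sub_eq_iff_eq_add.1 h1
    refine ⟨?_, fun s hs => ?_⟩
    · have h3 := congrArg (fun φ : C(unitInterval, Z) => φ ⟨1, by simp⟩) h2
      refine h3.trans ?_
      change z + ∫ r in (1 : ℝ)..1, _ = z
      rw [intervalIntegral.integral_same, add_zero]
    · have h4 :=
        (hasDerivAt_extendIcc_primitiveOp (superpose hg.continuous (incl γ)) hs).const_add z
      have h5 : extendIcc (superpose hg.continuous (incl γ)) s = g (s, extendIcc γ s) := by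
        rw [extendIcc_of_mem _ hs, extendIcc_of_mem _ hs]
        rfl
      rw [h5] at h4
      refine h4.congr_of_mem (fun r _ => ?_) hs
      exact congrArg (fun φ : C(unitInterval, Z) => φ (projIcc 0 1 zero_le_one r)) h2

end Integrals

/-! ### Slice charts -/

section Slice

variable {E : Type} [NormedAddCommGroup E] [NormedSpace ℝ E]
variable {M : Type*} [TopologicalSpace M] [ChartedSpace E M] [IsManifold 𝓘(ℝ, E) ∞ M]
variable {E' : Type} [NormedAddCommGroup E'] [NormedSpace ℝ E']
variable {Y : Type*} [TopologicalSpace Y] [ChartedSpace E' Y] [IsManifold 𝓘(ℝ, E') ∞ Y]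

/-- Coordinates `(x, h)` on an open subset of `M` in which the submanifold `range ι` is `{h = 0}`,
together with the inverse `param` of the coordinates `x` on the submanifold. -/
structure SliceChart (ι : Y → M) (E : Type) [NormedAddCommGroup E] [NormedSpace ℝ E]
    [ChartedSpace E M] (E' : Type) [NormedAddCommGroup E'] [NormedSpace ℝ E'] [ChartedSpace E' Y]
    (F : Type) [NormedAddCommGroup F] [NormedSpace ℝ F] where
  coord : OpenPartialHomeomorph M (E' × F)
  param : E' → Y
  contMDiffOn_coord : ContMDiffOn 𝓘(ℝ, E) 𝓘(ℝ, E' × F) ∞ coord coord.source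
  contMDiffOn_symm : ContMDiffOn 𝓘(ℝ, E' × F) 𝓘(ℝ, E) ∞ coord.symm coord.target
  mem_range_iff : ∀ p ∈ coord.source, p ∈ range ι ↔ (coord p).2 = 0
  ι_param : ∀ x, (x, 0) ∈ coord.target → ι (param x) = coord.symm (x, 0)
  contMDiffOn_param : ContMDiffOn 𝓘(ℝ, E') 𝓘(ℝ, E') ∞ param {x | (x, 0) ∈ coord.target}

theorem IsClosedSubmanifold.exists_sliceChart {ι : Y → M}
    (hι : IsClosedSubmanifold (E := E) (E' := E') ι) (y : Y) :
    ∃ (F : Type) (_ : NormedAddCommGroup F) (_ : NormedSpace ℝ F) (_ : (E' × F) ≃L[ℝ] E)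
      (S : SliceChart ι E E' F), ι y ∈ S.coord.source := by
  obtain ⟨F, _, _, h⟩ := hι.embedding.isImmersion.isImmersionAt y
  set a := h.domChart
  set b := h.codChart
  have ha := h.domChart_mem_maximalAtlas
  have hb := h.codChart_mem_maximalAtlas
  have hw : ∀ x ∈ a.target, b (ι (a.symm x)) = h.equiv (x, 0) := fun x hx => by
    have := h.writtenInCharts (show x ∈ (h.domChart.extend 𝓘(ℝ, E')).target by simpa using hx)
    simpa using this
  have hab : ∀ q ∈ a.source, ι q ∈ b.source := h.source_subset_preimage_source
  obtain ⟨O, hO, hOa⟩ := hι.embedding.isEmbedding.isInducing.isOpen_iff.1 a.open_source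
  let Φ₀ : OpenPartialHomeomorph M (E' × F) := b.transHomeomorph h.equiv.symm.toHomeomorph
  have hΦ₀ : ∀ p, Φ₀ p = h.equiv.symm (b p) := fun p => rfl
  have hΦ₀s : Φ₀.source = b.source := rfl
  have hΦ₀ι : ∀ x ∈ a.target, Φ₀ (ι (a.symm x)) = (x, 0) := fun x hx => by
    rw [hΦ₀, hw x hx, ContinuousLinearEquiv.symm_apply_apply]
  -- Shrinking the domain so that `h = 0` only on the submanifold.
  have hO' : IsOpen (Φ₀.source ∩ Φ₀ ⁻¹' (a.target ×ˢ univ)) :=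
    Φ₀.isOpen_inter_preimage (a.open_target.prod isOpen_univ)
  let Φ : OpenPartialHomeomorph M (E' × F) :=
    Φ₀.restrOpen (O ∩ (Φ₀.source ∩ Φ₀ ⁻¹' (a.target ×ˢ univ))) (hO.inter hO')
  have hΦs : ∀ p, p ∈ Φ.source ↔ p ∈ b.source ∧ p ∈ O ∧ (Φ₀ p).1 ∈ a.target := fun p => by
    rw [OpenPartialHomeomorph.restrOpen_source]
    simp only [mem_inter_iff, mem_preimage, mem_prod, mem_univ, and_true, hΦ₀s]
    tauto
  have hΦt : Φ.target ⊆ Φ₀.target := fun z hz => by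
    have := Φ.map_target hz
    rw [hΦs] at this
    have h2 := Φ₀.map_source (x := Φ.symm z) this.1
    have h3 : Φ₀ (Φ.symm z) = z := Φ.right_inv hz
    rwa [h3] at h2
  have hparam : ∀ x, (x, 0) ∈ Φ.target → x ∈ a.target := fun x hx => by
    have := ((hΦs _).1 (Φ.map_target hx)).2.2
    have h3 : Φ₀ (Φ.symm (x, 0)) = (x, 0) := Φ.right_inv hx
    rwa [h3] at this
  refine ⟨F, _, _, h.equiv, ⟨Φ, a.symm, ?_, ?_, fun p hp => ?_, fun x hx => ?_, ?_⟩, ?_⟩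
  · have h1 : ContMDiffOn 𝓘(ℝ, E) 𝓘(ℝ, E' × F) ∞ Φ₀ b.source :=
      h.equiv.symm.contDiff.contMDiff.comp_contMDiffOn (contMDiffOn_of_mem_maximalAtlas hb)
    exact h1.mono fun p hp => ((hΦs p).1 hp).1
  · have h1 : ContMDiffOn 𝓘(ℝ, E' × F) 𝓘(ℝ, E) ∞ Φ₀.symm Φ₀.target :=
      (contMDiffOn_symm_of_mem_maximalAtlas hb).comp (h.equiv.contDiff.contMDiff.contMDiffOn)
        fun z hz => hz
    exact h1.mono hΦt
  · obtain ⟨hpb, hpO, hpa⟩ := (hΦs p).1 hp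
    change _ ↔ (Φ₀ p).2 = 0
    constructor
    · rintro ⟨q, rfl⟩
      have hq : q ∈ a.source := by
        rw [← hOa]
        exact hpO
      have := hΦ₀ι (a q) (a.map_source hq)
      rw [a.left_inv hq] at this
      rw [this]
    · intro h0
      refine ⟨a.symm (Φ₀ p).1, Φ₀.injOn (hab _ (a.map_target hpa)) hpb ?_⟩
      rw [hΦ₀ι _ hpa]
      exact Prod.ext rfl h0.symm
  · have hxa := hparam x hx
    refine Φ₀.injOn (hab _ (a.map_target hxa)) ((hΦs _).1 (Φ.map_target hx)).1 ?_
    rw [hΦ₀ι _ hxa]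
    exact (Φ.right_inv hx).symm
  · exact (contMDiffOn_symm_of_mem_maximalAtlas ha).mono hparam
  · have hy : y ∈ a.source := h.mem_domChart_source
    refine (hΦs _).2 ⟨h.mem_codChart_source, ?_, ?_⟩
    · rw [← hOa] at hy
      exact hy
    · have := hΦ₀ι (a y) (a.map_source hy)
      rw [a.left_inv hy] at this
      rw [this]
      exact a.map_source hy

end Slice

/-! ### Euler vector fields in slice charts -/

section Euler

variable {E : Type} [NormedAddCommGroup E] [NormedSpace ℝ E]
variable {M : Type*} [TopologicalSpace M] [ChartedSpace E M] [IsManifold 𝓘(ℝ, E) ∞ M]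
variable {E' : Type} [NormedAddCommGroup E'] [NormedSpace ℝ E']
variable {Y : Type*} [TopologicalSpace Y] [ChartedSpace E' Y]
variable {F : Type} [NormedAddCommGroup F] [NormedSpace ℝ F]
variable {ι : Y → M} (S : SliceChart ι E E' F)

namespace SliceChart

/-- A vector field in the coordinates of a slice chart. -/
def field (X : ∀ p : M, TangentSpace 𝓘(ℝ, E) p) (z : E' × F) : E' × F :=
  mfderiv 𝓘(ℝ, E) 𝓘(ℝ, E' × F) S.coord (S.coord.symm z) (X (S.coord.symm z))

/-- The coordinate image of the part of the chart domain in `U`. -/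
def region (U : Set M) : Set (E' × F) := S.coord.target ∩ S.coord.symm ⁻¹' U

theorem isOpen_region {U : Set M} (hU : IsOpen U) : IsOpen (S.region U) :=
  S.coord.isOpen_inter_preimage_symm hU

theorem contDiffOn_comp_symm {G : Type*} [NormedAddCommGroup G] [NormedSpace ℝ G] {U : Set M}
    {f : M → G} (hf : ContMDiffOn 𝓘(ℝ, E) 𝓘(ℝ, G) ∞ f (S.coord.source ∩ U)) :
    ContDiffOn ℝ ∞ (fun z => f (S.coord.symm z)) (S.region U) := by
  rw [← contMDiffOn_iff_contDiffOn]
  exact hf.comp (S.contMDiffOn_symm.mono inter_subset_left) fun z hz =>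
    ⟨S.coord.map_target hz.1, hz.2⟩

theorem contDiffOn_field {U : Set M} (hU : IsOpen U) {X : ∀ p : M, TangentSpace 𝓘(ℝ, E) p}
    (hX : SmoothField U X) : ContDiffOn ℝ ∞ (S.field X) (S.region U) :=
  S.contDiffOn_comp_symm (contMDiffOn_mfderiv_apply (S.coord.open_source.inter hU)
    (S.contMDiffOn_coord.mono inter_subset_left) (hX.mono inter_subset_right))

theorem mdifferentiableAt_coord {p : M} (hp : p ∈ S.coord.source) :
    MDifferentiableAt 𝓘(ℝ, E) 𝓘(ℝ, E' × F) S.coord p :=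
  (S.contMDiffOn_coord.contMDiffAt (S.coord.open_source.mem_nhds hp)).mdifferentiableAt (by simp)

theorem mdifferentiableAt_symm {z : E' × F} (hz : z ∈ S.coord.target) :
    MDifferentiableAt 𝓘(ℝ, E' × F) 𝓘(ℝ, E) S.coord.symm z :=
  (S.contMDiffOn_symm.contMDiffAt (S.coord.open_target.mem_nhds hz)).mdifferentiableAt (by simp)

/-- A vector field is recovered from its coordinates. -/
theorem mfderiv_symm_field (X : ∀ p : M, TangentSpace 𝓘(ℝ, E) p) {z : E' × F}
    (hz : z ∈ S.coord.target) :
    mfderiv 𝓘(ℝ, E' × F) 𝓘(ℝ, E) S.coord.symm z (S.field X z) = X (S.coord.symm z) := by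
  have hp := S.coord.map_target hz
  have h1 := S.mdifferentiableAt_coord hp
  have h2 : MDifferentiableAt 𝓘(ℝ, E' × F) 𝓘(ℝ, E) S.coord.symm (S.coord (S.coord.symm z)) := by
    rw [S.coord.right_inv hz]
    exact S.mdifferentiableAt_symm hz
  have h3 := mfderiv_comp (S.coord.symm z) h2 h1
  have h4 : S.coord.symm ∘ S.coord =ᶠ[𝓝 (S.coord.symm z)] id :=
    (S.coord.eventually_left_inverse hp).mono fun q hq => hq
  rw [h4.mfderiv_eq, mfderiv_id, S.coord.right_inv hz] at h3
  exact (congrArg (fun A : E →L[ℝ] E => A (X (S.coord.symm z))) h3).symm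

theorem realDeriv_eq (X : ∀ p : M, TangentSpace 𝓘(ℝ, E) p) {z : E' × F} (hz : z ∈ S.coord.target)
    {u : E' × F → ℝ} (hu : DifferentiableAt ℝ u z) {f : M → ℝ}
    (hf : ∀ᶠ q in 𝓝 (S.coord.symm z), f q = u (S.coord q)) :
    realDeriv X f (S.coord.symm z) = fderiv ℝ u z (S.field X z) := by
  have hp := S.coord.map_target hz
  have h1 := S.mdifferentiableAt_coord hp
  have h2 : MDifferentiableAt 𝓘(ℝ, E' × F) 𝓘(ℝ, ℝ) u (S.coord (S.coord.symm z)) := by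
    rw [S.coord.right_inv hz]
    exact hu.mdifferentiableAt
  have h3 := mfderiv_comp (S.coord.symm z) h2 h1
  have h4 : f =ᶠ[𝓝 (S.coord.symm z)] u ∘ S.coord := hf
  rw [realDeriv, h4.mfderiv_eq, h3, S.coord.right_inv hz, mfderiv_eq_fderiv]
  rfl

end SliceChart

variable [FiniteDimensional ℝ E'] [FiniteDimensional ℝ F] [T2Space M]
variable {U : Set M} {ρ : ∀ p : M, TangentSpace 𝓘(ℝ, E) p}

/-- The Euler condition for a function compactly supported in the chart. -/
theorem IsEuler.second_order (hU : IsOpen U) (hρ : IsEuler (range ι) U ρ) {u : E' × F → ℝ}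
    (hu : ContDiff ℝ ∞ u) (hus : HasCompactSupport u) (huU : tsupport u ⊆ S.region U)
    (hu0 : ∀ x, u (x, 0) = 0) {x : E'} (hx : (x, (0 : F)) ∈ S.region U) :
    fderiv ℝ u (x, 0) (S.field ρ (x, 0)) = 0 ∧
      HasFDerivAt (fun z : E' × F => fderiv ℝ u z (S.field ρ z) - u z)
        (0 : E' × F →L[ℝ] ℝ) (x, (0 : F)) := by
  classical
  let f : M → ℝ := fun p => if p ∈ S.coord.source then u (S.coord p) else 0
  have hK : IsCompact (S.coord.symm '' tsupport u) :=
    hus.isCompact.image_of_continuousOn (S.coord.continuousOn_symm.mono fun z hz => (huU hz).1)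
  have hf0 : ∀ p ∉ S.coord.symm '' tsupport u, f p = 0 := fun p hp => by
    by_cases h : p ∈ S.coord.source
    · simp only [f, if_pos h]
      by_contra h0
      exact hp ⟨S.coord p, subset_tsupport _ h0, S.coord.left_inv h⟩
    · simp only [f, if_neg h]
  have hfs : tsupport f ⊆ S.coord.source := by
    refine (closure_minimal (fun p hp => ?_) hK.isClosed).trans ?_
    · by_contra h
      exact hp (hf0 p h)
    · rintro _ ⟨z, hz, rfl⟩
      exact S.coord.map_target (huU hz).1
  have hfe : ∀ p ∈ S.coord.source, ∀ᶠ q in 𝓝 p, f q = u (S.coord q) := fun p hp => by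
    filter_upwards [S.coord.open_source.mem_nhds hp] with q hq
    simp only [f, if_pos hq]
  have hfd : ContMDiff 𝓘(ℝ, E) 𝓘(ℝ, ℝ) ∞ f := by
    refine contMDiff_of_tsupport fun p hp => ?_
    have hp' := hfs hp
    exact ((hu.contMDiff.contMDiffAt).comp p
      (S.contMDiffOn_coord.contMDiffAt (S.coord.open_source.mem_nhds hp'))).congr_of_eventuallyEq
      (hfe p hp')
  have hfv : VanishesOn E (range ι) U f := by
    refine ⟨hfd.contMDiffOn, fun p hp => ?_⟩
    by_cases h : p ∈ S.coord.source
    · simp only [f, if_pos h]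
      rw [← Prod.mk.eta (p := S.coord p), (S.mem_range_iff p h).1 hp.1]
      exact hu0 _
    · simp only [f, if_neg h]
  obtain ⟨N, a, b, ha, hb, hab⟩ := hρ.2 f hfv
  have hzero : ∀ {c : M → ℝ}, VanishesOn E (range ι) U c → ∀ {x : E'}, (x, (0 : F)) ∈ S.region U →
      c (S.coord.symm (x, 0)) = 0 := fun hc x hx => by
    refine hc.2 _ ⟨?_, hx.2⟩
    rw [S.mem_range_iff _ (S.coord.map_target hx.1), S.coord.right_inv hx.1]
  have hdiff : ∀ {c : M → ℝ}, VanishesOn E (range ι) U c →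
      DifferentiableAt ℝ (fun z => c (S.coord.symm z)) (x, 0) := fun hc =>
    ((S.contDiffOn_comp_symm (hc.1.mono inter_subset_right)).contDiffAt
      ((S.isOpen_region hU).mem_nhds hx)).differentiableAt (by simp)
  have heq : ∀ z ∈ S.region U, fderiv ℝ u z (S.field ρ z) - u z =
      ∑ i, a i (S.coord.symm z) * b i (S.coord.symm z) := fun z hz => by
    have h1 := S.realDeriv_eq ρ hz.1 (hu.differentiable (by simp) z)
      (hfe _ (S.coord.map_target hz.1))
    have h2 : realDeriv ρ f (S.coord.symm z) - f (S.coord.symm z) = _ := hab _ hz.2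
    rw [h1] at h2
    rw [← h2]
    simp only [f, if_pos (S.coord.map_target hz.1), S.coord.right_inv hz.1]
  refine ⟨?_, ?_⟩
  · have h1 := heq _ hx
    rw [hu0, sub_zero] at h1
    rw [h1]
    exact Finset.sum_eq_zero fun i _ => by rw [hzero (ha i) hx, zero_mul]
  · have h1 : HasFDerivAt (fun z => ∑ i, a i (S.coord.symm z) * b i (S.coord.symm z))
        (0 : E' × F →L[ℝ] ℝ) (x, (0 : F)) := by
      have h2 := HasFDerivAt.fun_sum (u := Finset.univ) fun i _ =>
        (hdiff (ha i)).hasFDerivAt.mul (hdiff (hb i)).hasFDerivAt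
      refine h2.congr_fderiv (Finset.sum_eq_zero fun i _ => ?_)
      rw [hzero (ha i) hx, hzero (hb i) hx, zero_smul, zero_smul, add_zero]
    refine h1.congr_of_eventuallyEq ?_
    filter_upwards [(S.isOpen_region hU).mem_nhds hx] with z hz using heq z hz

/-- In slice coordinates `(x, h)` an Euler vector field is `h ∂_h` up to an error whose
`h`-component vanishes to second order and whose `x`-component vanishes on `h = 0`. The latter
needs a nonzero `h`, as it comes from the Euler condition for the functions `x^i h^j`. -/
theorem IsEuler.field_eq [Nontrivial F] (hU : IsOpen U) (hρ : IsEuler (range ι) U ρ) {x : E'}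
    (hx : (x, (0 : F)) ∈ S.region U) :
    S.field ρ (x, 0) = 0 ∧
      HasFDerivAt (fun z => (S.field ρ z).2) (ContinuousLinearMap.snd ℝ E' F) (x, (0 : F)) := by
  obtain ⟨χ, hχ, hχc, hχU, hχ1⟩ := exists_contDiff_cutoff (isCompact_singleton (x := (x, (0 : F))))
    (S.isOpen_region hU) (singleton_subset_iff.2 hx)
  rw [nhdsSet_singleton] at hχ1
  have hX : DifferentiableAt ℝ (S.field ρ) (x, 0) :=
    ((S.contDiffOn_field hU hρ.1).contDiffAt ((S.isOpen_region hU).mem_nhds hx)).differentiableAt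
      (by simp)
  have hX2 := hX.hasFDerivAt.snd
  -- The Euler condition for `χ u`, where `u` is smooth near the point.
  have key : ∀ u : E' × F → ℝ, ContDiff ℝ ∞ u → (∀ y, u (y, 0) = 0) →
      fderiv ℝ u (x, 0) (S.field ρ (x, 0)) = 0 ∧
        HasFDerivAt (fun z : E' × F => fderiv ℝ u z (S.field ρ z) - u z)
        (0 : E' × F →L[ℝ] ℝ) (x, (0 : F)) := by
    intro u hu hu0
    have he : (fun z => χ z * u z) =ᶠ[𝓝 (x, 0)] u := by
      filter_upwards [hχ1] with z hz
      rw [hz, one_mul]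
    have h1 := hρ.second_order S hU (u := fun z => χ z * u z) (hχ.mul hu) hχc.mul_right
      ((tsupport_mul_subset_left (f := χ) (g := u)).trans hχU)
      (fun y => by rw [hu0, mul_zero]) hx
    refine ⟨?_, h1.2.congr_of_eventuallyEq ?_⟩
    · rw [← he.fderiv_eq]
      exact h1.1
    · filter_upwards [he.eventuallyEq_nhds] with z hz
      have h2 : χ z * u z = u z := hz.eq_of_nhds
      rw [← hz.fderiv_eq, h2]
  have hh : ∀ ℓ : F →L[ℝ] ℝ, ℓ (S.field ρ (x, 0)).2 = 0 ∧
      ℓ.comp ((ContinuousLinearMap.snd ℝ E' F).comp (fderiv ℝ (S.field ρ) (x, 0))) =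
        ℓ.comp (ContinuousLinearMap.snd ℝ E' F) := by
    intro ℓ
    set L := ℓ.comp (ContinuousLinearMap.snd ℝ E' F)
    have h1 := key L L.contDiff (fun y => map_zero ℓ)
    have h2 : ∀ z, fderiv ℝ L z = L := fun z => L.fderiv
    simp only [h2] at h1
    refine ⟨h1.1, ?_⟩
    have h3 := (L.hasFDerivAt.comp (x, (0 : F)) hX.hasFDerivAt).sub (L.hasFDerivAt (x := (x, 0)))
    have h4 := h3.unique h1.2
    rw [sub_eq_zero] at h4
    exact h4
  have hv2 : (S.field ρ (x, 0)).2 = 0 :=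
    SeparatingDual.eq_zero_of_forall_dual_eq_zero (R := ℝ) fun ℓ => (hh ℓ).1
  have hd2 : (ContinuousLinearMap.snd ℝ E' F).comp (fderiv ℝ (S.field ρ) (x, 0)) =
      ContinuousLinearMap.snd ℝ E' F := by
    refine ContinuousLinearMap.ext fun v => ?_
    rw [← sub_eq_zero]
    refine SeparatingDual.eq_zero_of_forall_dual_eq_zero (R := ℝ) fun ℓ => ?_
    rw [map_sub, sub_eq_zero]
    exact congrArg (fun A : E' × F →L[ℝ] ℝ => A v) (hh ℓ).2
  have hv1 : (S.field ρ (x, 0)).1 = 0 := by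
    refine SeparatingDual.eq_zero_of_forall_dual_eq_zero (R := ℝ) fun m => ?_
    obtain ⟨κ, hκ⟩ := exists_ne (0 : F)
    obtain ⟨ℓ, hℓ⟩ := SeparatingDual.exists_ne_zero (R := ℝ) hκ
    set A := m.comp (ContinuousLinearMap.fst ℝ E' F)
    set L := ℓ.comp (ContinuousLinearMap.snd ℝ E' F)
    have hu : ∀ z, HasFDerivAt (fun z => A z * L z) (A z • L + L z • A) z := fun z =>
      A.hasFDerivAt.mul L.hasFDerivAt
    have h1 := (key (fun z => A z * L z) (A.contDiff.mul L.contDiff)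
      (fun y => by simp [L])).2
    have h2 : (fun z => fderiv ℝ (fun z => A z * L z) z (S.field ρ z) - A z * L z) = fun z =>
        A z * (L (S.field ρ z) - L z) + L z * A (S.field ρ z) := by
      funext z
      rw [(hu z).fderiv]
      change A z * L (S.field ρ z) + L z * A (S.field ρ z) - _ = _
      ring
    rw [h2] at h1
    have h3 := ((A.hasFDerivAt (x := (x, (0 : F)))).mul ((L.hasFDerivAt.comp (x, (0 : F))
      hX.hasFDerivAt).sub (L.hasFDerivAt (x := (x, 0))))).add
      ((L.hasFDerivAt (x := (x, (0 : F)))).mul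
      (A.hasFDerivAt.comp (x, (0 : F)) hX.hasFDerivAt))
    have h4 := congrArg (fun B : E' × F →L[ℝ] ℝ => B (0, κ)) (h3.unique h1)
    have h5 : L.comp (fderiv ℝ (S.field ρ) (x, 0)) = L := by
      rw [show L = ℓ.comp (ContinuousLinearMap.snd ℝ E' F) from rfl,
        ContinuousLinearMap.comp_assoc, hd2]
    have h6 : L (x, 0) = 0 := map_zero ℓ
    have h7 : L (S.field ρ (x, 0)) = 0 := by
      change ℓ (S.field ρ (x, 0)).2 = 0
      rw [hv2, map_zero]
    have h8 : A (S.field ρ (x, 0)) * ℓ κ = 0 := by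
      simpa [h5, h6, h7, Function.comp_def, L, A, hv2] using h4
    exact (mul_eq_zero.1 h8).resolve_right hℓ
  refine ⟨Prod.ext hv1 hv2, hX2.congr_fderiv hd2⟩

end Euler

/-! ### The backward flow of an Euler vector field near the submanifold -/

section Flow

variable {E : Type} [NormedAddCommGroup E] [NormedSpace ℝ E]
variable {M : Type*} [TopologicalSpace M] [T2Space M] [ChartedSpace E M] [IsManifold 𝓘(ℝ, E) ∞ M]
variable {E' : Type} [NormedAddCommGroup E'] [NormedSpace ℝ E'] [FiniteDimensional ℝ E']
variable {Y : Type*} [TopologicalSpace Y] [ChartedSpace E' Y]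
variable {F : Type} [NormedAddCommGroup F] [NormedSpace ℝ F] [FiniteDimensional ℝ F] [Nontrivial F]
variable {ι : Y → M} (S : SliceChart ι E E' F)
variable {U : Set M} {ρ : ∀ p : M, TangentSpace 𝓘(ℝ, E) p}

/-- Local form of an Euler vector field in slice coordinates: `A(x,h)h ∂_x + (h + B(x,h)hh) ∂_h`. -/
theorem IsEuler.exists_normal_form (hU : IsOpen U) (hρ : IsEuler (range ι) U ρ) {x₀ : E'}
    (hx₀ : (x₀, (0 : F)) ∈ S.region U) :
    ∃ (A : E' × F → F →L[ℝ] E') (B : E' × F → F →L[ℝ] F →L[ℝ] F), ContDiff ℝ ∞ A ∧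
      ContDiff ℝ ∞ B ∧ ∀ᶠ z in 𝓝 (x₀, (0 : F)), S.field ρ z = (A z z.2, z.2 + B z z.2 z.2) := by
  have := FiniteDimensional.complete ℝ E'
  have := FiniteDimensional.complete ℝ F
  obtain ⟨χ, hχ, hχc, hχU, hχ1⟩ := exists_contDiff_cutoff
    (isCompact_singleton (x := (x₀, (0 : F)))) (S.isOpen_region hU) (singleton_subset_iff.2 hx₀)
  rw [nhdsSet_singleton] at hχ1
  have hX := S.contDiffOn_field hU hρ.1
  have hw₁ : ContDiff ℝ ∞ fun z : E' × F => χ z • (S.field ρ z).1 :=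
    contDiff_smul_of_tsupport (S.isOpen_region hU) hχ hχU hX.fst
  have hw₂ : ContDiff ℝ ∞ fun z : E' × F => χ z • ((S.field ρ z).2 - z.2) :=
    contDiff_smul_of_tsupport (S.isOpen_region hU) hχ hχU (hX.snd.sub contDiff_snd.contDiffOn)
  have h₁ : ∀ x : E', χ (x, 0) • (S.field ρ (x, 0)).1 = 0 := fun x => by
    by_cases hx : (x, (0 : F)) ∈ tsupport χ
    · rw [(hρ.field_eq S hU (hχU hx)).1, Prod.fst_zero, smul_zero]
    · rw [image_eq_zero_of_notMem_tsupport hx, zero_smul]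
  have h₂ : ∀ x : E', χ (x, 0) • ((S.field ρ (x, 0)).2 - 0) = 0 := fun x => by
    by_cases hx : (x, (0 : F)) ∈ tsupport χ
    · rw [(hρ.field_eq S hU (hχU hx)).1, Prod.snd_zero, sub_zero, smul_zero]
    · rw [image_eq_zero_of_notMem_tsupport hx, zero_smul]
  have h₂' : ∀ x : E', HasFDerivAt (fun z : E' × F => χ z • ((S.field ρ z).2 - z.2))
      (0 : E' × F →L[ℝ] F) (x, 0) := fun x => by
    by_cases hx : (x, (0 : F)) ∈ tsupport χ
    · have h1 := hρ.field_eq S hU (hχU hx)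
      have h2 := (hχ.differentiable (by simp) (x, (0 : F))).hasFDerivAt.smul
        (h1.2.sub (hasFDerivAt_snd (p := (x, (0 : F)))))
      refine h2.congr_fderiv ?_
      have h3 : ((fun z : E' × F => (S.field ρ z).2) - Prod.snd : E' × F → F) (x, (0 : F)) = 0 := by
        change (S.field ρ (x, 0)).2 - 0 = 0
        rw [h1.1, Prod.snd_zero, sub_zero]
      rw [h3, sub_self, smul_zero, zero_add]
      exact ContinuousLinearMap.ext fun v => smul_zero _
    · refine (hasFDerivAt_const (0 : F) _).congr_of_eventuallyEq ?_
      filter_upwards [notMem_tsupport_iff_eventuallyEq.1 hx] with z hz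
      rw [hz, Pi.zero_apply, zero_smul]
  obtain ⟨A, hA, hAe, -⟩ := exists_hadamard hw₁
  obtain ⟨A₂, hA₂, hA₂e, hA₂0⟩ := exists_hadamard hw₂
  obtain ⟨B, hB, hBe, -⟩ := exists_hadamard hA₂
  refine ⟨A, B, hA, hB, ?_⟩
  filter_upwards [hχ1] with z hz
  obtain ⟨x, h⟩ := z
  have h3 := hAe x h
  have h4 := hA₂e x h
  rw [hz, one_smul, h₁, zero_add] at h3
  rw [hz, one_smul, h₂, zero_add, hBe, hA₂0, (h₂' x).fderiv, ContinuousLinearMap.zero_comp,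
    zero_add, sub_eq_iff_eq_add'] at h4
  exact Prod.ext h3 h4

/-- Blowing up the submanifold, i.e. writing `h = λ k` with `λ = e^{-s}`, turns the backward flow of
an Euler vector field into a regular equation in the variable `λ`, which is solved from `λ = 1`
down to `λ = 0`, that is `s = ∞`. -/
theorem IsEuler.exists_local_flow (hU : IsOpen U) (hρ : IsEuler (range ι) U ρ) {p₀ : M}
    (hp₀ : p₀ ∈ S.coord.source) (hp₀ι : p₀ ∈ range ι) (hp₀U : p₀ ∈ U) :
    ∃ (N : Set M) (P : M → Y), IsOpen N ∧ p₀ ∈ N ∧ ContMDiffOn 𝓘(ℝ, E) 𝓘(ℝ, E') ∞ P N ∧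
      ∀ p ∈ N, FlowsTo U ρ p (ι (P p)) := by
  have := FiniteDimensional.complete ℝ E'
  have := FiniteDimensional.complete ℝ F
  obtain ⟨x₀, hx₀⟩ : ∃ x₀ : E', S.coord p₀ = (x₀, 0) :=
    ⟨_, Prod.ext rfl ((S.mem_range_iff _ hp₀).1 hp₀ι)⟩
  set z₀ : E' × F := (x₀, 0) with hz₀
  have hreg : z₀ ∈ S.region U := by
    rw [← hx₀]
    exact ⟨S.coord.map_source hp₀, by rwa [mem_preimage, S.coord.left_inv hp₀]⟩
  obtain ⟨A, B, hA, hB, hAB⟩ := hρ.exists_normal_form S hU hreg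
  obtain ⟨ε, hε, hball⟩ := Metric.mem_nhds_iff.1 (hAB.and ((S.isOpen_region hU).mem_nhds hreg))
  let g : ℝ × (E' × F) → E' × F := fun q =>
    (A (q.2.1, q.1 • q.2.2) q.2.2, B (q.2.1, q.1 • q.2.2) q.2.2 q.2.2)
  have hg : ContDiff ℝ ∞ g := by
    have h1 : ContDiff ℝ ∞ fun q : ℝ × (E' × F) => (q.2.1, q.1 • q.2.2) := by fun_prop
    have h2 : ContDiff ℝ ∞ fun q : ℝ × (E' × F) => q.2.2 := by fun_prop
    exact ((hA.comp h1).clm_apply h2).prodMk (((hB.comp h1).clm_apply h2).clm_apply h2)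
  have hg0 : ∀ s, g (s, z₀) = 0 := fun s => by simp [g, hz₀]
  let N : E' × F →L[ℝ] E' × F := ((A z₀).comp (ContinuousLinearMap.snd ℝ E' F)).prod 0
  have hN : N.comp N = 0 := by
    ext v <;> simp [N]
  have hdg : ∀ s, (fderiv ℝ g (s, z₀)).comp (ContinuousLinearMap.inr ℝ ℝ (E' × F)) = N := by
    intro s
    refine ((hg.differentiable (by simp) (s, z₀)).hasFDerivAt.comp z₀
      (hasFDerivAt_prodMk_right s z₀)).unique ?_
    have h1 : ContDiff ℝ ∞ fun z : E' × F => (z.1, s • z.2) := by fun_prop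
    have h2 := ((hA.comp h1).differentiable (by simp) z₀).hasFDerivAt
    have h3 := ((hB.comp h1).differentiable (by simp) z₀).hasFDerivAt
    have h4 : HasFDerivAt (fun z : E' × F => z.2) (ContinuousLinearMap.snd ℝ E' F) z₀ :=
      hasFDerivAt_snd
    refine ((h2.clm_apply h4).prodMk ((h3.clm_apply h4).clm_apply h4)).congr_fderiv ?_
    refine ContinuousLinearMap.ext fun v => Prod.ext ?_ ?_ <;> simp [N, hz₀]
  obtain ⟨O, Γ, hO, hz₀O, hΓ, hΓ0, hΓO⟩ := exists_smooth_solutions hg hg0 hN hdg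
  set O' := O ∩ Γ ⁻¹' Metric.ball (ContinuousMap.const _ z₀) ε
  have hO' : IsOpen O' := hΓ.continuousOn.isOpen_inter_preimage hO Metric.isOpen_ball
  have hz₀O' : z₀ ∈ O' := ⟨hz₀O, by rw [mem_preimage, hΓ0]; exact Metric.mem_ball_self hε⟩
  -- The solution in the coordinates `(x, h)`, as a function of `λ`.
  let c : E' × F → ℝ → E' × F := fun z l => ((extendIcc (Γ z) l).1, l • (extendIcc (Γ z) l).2)
  have hc : ∀ z ∈ O', ∀ l ∈ unitInterval, c z l ∈ Metric.ball z₀ ε := by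
    intro z hz l hl
    have h1 : ‖extendIcc (Γ z) l - z₀‖ < ε := by
      rw [extendIcc_of_mem _ hl]
      exact ((Γ z - ContinuousMap.const _ z₀).norm_coe_le_norm ⟨l, hl⟩).trans_lt
        (mem_ball_iff_norm.1 hz.2)
    rw [mem_ball_iff_norm]
    refine lt_of_le_of_lt ?_ h1
    refine max_le (norm_fst_le (extendIcc (Γ z) l - z₀)) (le_trans ?_
      (norm_snd_le (extendIcc (Γ z) l - z₀)))
    change ‖l • (extendIcc (Γ z) l).2 - 0‖ ≤ ‖(extendIcc (Γ z) l).2 - 0‖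
    rw [sub_zero, sub_zero, norm_smul, Real.norm_of_nonneg hl.1]
    exact mul_le_of_le_one_left (norm_nonneg _) hl.2
  have hcc : ∀ z, Continuous (c z) := fun z => by
    have := continuous_extendIcc (Γ z)
    fun_prop
  have hc' : ∀ z ∈ O', ∀ l ∈ unitInterval, HasDerivWithinAt (c z)
      (A (c z l) (extendIcc (Γ z) l).2, (extendIcc (Γ z) l).2 +
        l • B (c z l) (extendIcc (Γ z) l).2 (extendIcc (Γ z) l).2) unitInterval l := by
    intro z hz l hl
    have h1 := (hΓO z hz.1).2 l hl
    have h3 : HasDerivWithinAt (fun l => (extendIcc (Γ z) l).1) _ unitInterval l :=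
      (ContinuousLinearMap.fst ℝ E' F).hasFDerivAt.comp_hasDerivWithinAt l h1
    have h4 : HasDerivWithinAt (fun l => (extendIcc (Γ z) l).2) _ unitInterval l :=
      (ContinuousLinearMap.snd ℝ E' F).hasFDerivAt.comp_hasDerivWithinAt l h1
    have h2 : HasDerivWithinAt (c z) _ unitInterval l :=
      h3.prodMk ((hasDerivWithinAt_id l _).smul h4)
    refine h2.congr_deriv (Prod.ext rfl ?_)
    simp only [id, one_smul, g, c]
    exact add_comm _ _
  have hexp : ∀ s : ℝ, 0 ≤ s → Real.exp (-s) ∈ unitInterval := fun s hs =>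
    ⟨(Real.exp_pos _).le, Real.exp_le_one_iff.2 (by linarith)⟩
  have hcurve : ∀ z ∈ O', ∀ s ∈ Ici (0 : ℝ), HasDerivWithinAt (fun s => c z (Real.exp (-s)))
      (-S.field ρ (c z (Real.exp (-s)))) (Ici 0) s := by
    intro z hz s hs
    have h1 : HasDerivWithinAt (fun s => Real.exp (-s)) (-Real.exp (-s)) (Ici 0) s := by
      simpa using (hasDerivAt_neg s).exp.hasDerivWithinAt
    have h2 := (hc' z hz _ (hexp s hs)).scomp s h1 fun r hr => hexp r hr
    refine h2.congr_deriv ?_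
    have h3 : S.field ρ (c z (Real.exp (-s))) = _ := (hball (hc z hz _ (hexp s hs))).1
    rw [h3]
    refine Prod.ext ?_ ?_
    · simp [c]
    · simp [c, smul_smul]
  refine ⟨S.coord.source ∩ S.coord ⁻¹' O', fun p => S.param (extendIcc (Γ (S.coord p)) 0).1,
    S.coord.isOpen_inter_preimage hO', ⟨hp₀, by rw [mem_preimage, hx₀]; exact hz₀O'⟩, ?_,
    fun p hp => ?_⟩
  · have h0 : (0 : ℝ) ∈ unitInterval := by simp
    have h1 : ContDiffOn ℝ ∞ (fun z => (extendIcc (Γ z) 0).1) O' := by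
      have h2 : ContDiff ℝ ∞ fun φ : C(unitInterval, E' × F) => (φ ⟨0, h0⟩).1 :=
        ((ContinuousLinearMap.fst ℝ E' F).comp (ContinuousMap.evalCLM ℝ
          (⟨0, h0⟩ : unitInterval))).contDiff
      refine (h2.comp_contDiffOn (hΓ.mono inter_subset_left)).congr fun z hz => ?_
      rw [extendIcc_of_mem _ h0]
      rfl
    have h2 : MapsTo (fun z => (extendIcc (Γ z) 0).1) O' {x | (x, (0 : F)) ∈ S.coord.target} := by
      intro z hz
      have h3 := (hball (hc z hz 0 h0)).2.1
      have h4 : c z 0 = ((extendIcc (Γ z) 0).1, 0) := Prod.ext rfl (zero_smul _ _)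
      rwa [h4] at h3
    exact (S.contMDiffOn_param.comp (contMDiffOn_iff_contDiffOn.2 h1) h2).comp
      (S.contMDiffOn_coord.mono inter_subset_left) fun p hp => hp.2
  · set z := S.coord p with hz
    have h0 : (0 : ℝ) ∈ unitInterval := by simp
    have hreg' : ∀ l ∈ unitInterval, c z l ∈ S.region U := fun l hl => (hball (hc z hp.2 l hl)).2
    have hc0 : c z 0 = ((extendIcc (Γ z) 0).1, 0) := Prod.ext rfl (zero_smul _ _)
    refine ⟨fun s => S.coord.symm (c z (Real.exp (-s))), ?_, fun s hs => (hreg' _ (hexp s hs)).2,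
      fun s hs => ?_, ?_⟩
    · have h1 : c z 1 = z := by
        have h2 := (hΓO z hp.2.1).1
        simp only [c, one_smul]
        rw [extendIcc_of_mem _ (by simp : (1 : ℝ) ∈ unitInterval)]
        exact h2
      simp only [neg_zero, Real.exp_zero, h1]
      exact S.coord.left_inv hp.1
    · have h1 := (S.mdifferentiableAt_symm (hreg' _ (hexp s hs)).1).hasMFDerivAt
      have h2 := h1.comp_hasMFDerivWithinAt s
        (hcurve z hp.2 s hs).hasFDerivWithinAt.hasMFDerivWithinAt
      refine h2.congr_mfderiv ?_
      have h3 := S.mfderiv_symm_field ρ (hreg' _ (hexp s hs)).1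
      refine ContinuousLinearMap.ext fun (a : ℝ) => ?_
      refine (map_smul (mfderiv 𝓘(ℝ, E' × F) 𝓘(ℝ, E) S.coord.symm (c z (Real.exp (-s)))) a
        (-S.field ρ (c z (Real.exp (-s))))).trans (congrArg (fun v : E => a • v) ?_)
      exact (map_neg _ _).trans (congrArg (fun v : E => -v) h3)
    · rw [S.ι_param _ (hc0 ▸ (hreg' 0 h0).1), ← hc0]
      have h1 : Tendsto (fun s : ℝ => c z (Real.exp (-s))) atTop (𝓝 (c z 0)) :=
        ((hcc z).tendsto 0).comp (Real.tendsto_exp_neg_atTop_nhds_zero)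
      exact (S.coord.symm.continuousAt (hreg' 0 h0).1).tendsto.comp h1

end Flow

/-! ### The projection onto the submanifold along an Euler vector field -/

section Uniqueness

variable {E : Type} [NormedAddCommGroup E] [NormedSpace ℝ E] [FiniteDimensional ℝ E]
variable {M : Type*} [TopologicalSpace M] [T2Space M] [SigmaCompactSpace M] [ChartedSpace E M]
  [IsManifold 𝓘(ℝ, E) ∞ M]
variable {U : Set M} {ρ : ∀ p : M, TangentSpace 𝓘(ℝ, E) p}

/-- Flow lines of a smooth vector field are determined in forward time by their initial value, also
at the endpoint `0` of their interval of definition. -/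
theorem eqOn_Ici_of_isMIntegralCurveOn (hU : IsOpen U) (hρ : SmoothField U ρ) {γ γ' : ℝ → M}
    (h : IsMIntegralCurveOn γ (fun q => -ρ q) (Ici 0))
    (h' : IsMIntegralCurveOn γ' (fun q => -ρ q) (Ici 0)) (hγ : ∀ s, 0 ≤ s → γ s ∈ U)
    (h0 : γ 0 = γ' 0) : EqOn γ γ' (Ici 0) := by
  have hc : ContinuousOn γ (Ici 0) := fun s hs => (h s hs).continuousWithinAt
  have hc' : ContinuousOn γ' (Ici 0) := fun s hs => (h' s hs).continuousWithinAt
  intro b hb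
  have hcl : IsClosed ({s | γ s = γ' s} ∩ Icc 0 b) := by
    rw [inter_comm]
    exact ((hc.prodMk hc').mono Icc_subset_Ici_self).preimage_isClosed_of_isClosed isClosed_Icc
      isClosed_diagonal
  refine hcl.Icc_subset_of_forall_mem_nhdsWithin h0 ?_ ⟨hb, le_rfl⟩
  rintro a ⟨ha, ha0, -⟩
  have ha : γ a = γ' a := ha
  set q := γ a with hq
  have hqs : q ∈ (chartAt E q).source := mem_chart_source E q
  let v : E → E := fun z => -fieldCoord q ρ ((chartAt E q).symm z)
  have hv : ContDiffAt ℝ 1 v (chartAt E q q) := by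
    have h1 := (contDiffOn_comp_chart_symm (contMDiffOn_fieldCoord q hU hρ) q).contDiffAt
      ((isOpen_chart_target_inter ((chartAt E q).open_source.inter hU) q).mem_nhds
        ⟨(chartAt E q).map_source hqs, by
          rw [mem_preimage, (chartAt E q).left_inv hqs]
          exact ⟨hqs, hγ a ha0⟩⟩)
    exact (h1.of_le (by simp)).neg
  obtain ⟨K, t, ht, hK⟩ := hv.exists_lipschitzOnWith
  have hnear : ∀ {γ : ℝ → M}, ContinuousOn γ (Ici 0) → γ a = q →
      ∀ᶠ s in 𝓝[≥] a, γ s ∈ (chartAt E q).source ∧ chartAt E q (γ s) ∈ t := by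
    intro γ hγc hγa
    have h1 : ContinuousWithinAt γ (Ici a) a :=
      (hγc a ha0).mono (Ici_subset_Ici.2 ha0)
    have h2 : ∀ᶠ r in 𝓝 (γ a), r ∈ (chartAt E q).source ∧ chartAt E q r ∈ t := by
      rw [hγa]
      exact inter_mem ((chartAt E q).open_source.mem_nhds hqs)
        (((chartAt E q).continuousAt hqs).preimage_mem_nhds ht)
    exact h1.tendsto.eventually h2
  obtain ⟨e, he, hes⟩ := mem_nhdsGE_iff_exists_Icc_subset.1
    ((hnear hc hq.symm).and (hnear hc' ha.symm))
  have hder : ∀ {γ : ℝ → M}, IsMIntegralCurveOn γ (fun q => -ρ q) (Ici 0) → ∀ s, 0 ≤ s →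
      γ s ∈ (chartAt E q).source → HasDerivWithinAt (fun s => chartAt E q (γ s))
        (v (chartAt E q (γ s))) (Ici s) s := by
    intro γ hγi s hs hγs
    have h1 := (mdifferentiableAt_chart hγs).hasMFDerivAt.comp_hasMFDerivWithinAt s
      ((hγi s hs).mono (Ici_subset_Ici.2 hs))
    let A : E →L[ℝ] E := mfderiv 𝓘(ℝ, E) 𝓘(ℝ, E) (chartAt E q) (γ s)
    let w : E := -ρ (γ s)
    have h2 : HasFDerivWithinAt (fun s => chartAt E q (γ s))
      (A.comp ((1 : ℝ →L[ℝ] ℝ).smulRight w)) (Ici s) s := h1.hasFDerivWithinAt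
    refine h2.hasDerivWithinAt.congr_deriv ?_
    have h3 : v (chartAt E q (γ s)) = -fieldCoord q ρ (γ s) := by
      simp only [v]
      rw [(chartAt E q).left_inv hγs]
    rw [h3]
    exact (congrArg A (one_smul ℝ w)).trans (map_neg A (ρ (γ s) : E))
  have hIci : Icc a e ⊆ Ici 0 := fun s hs => ha0.trans hs.1
  have heq := ODE_solution_unique_of_mem_Icc_right (v := fun _ => v) (s := fun _ => t) (K := K)
    (f := fun s => chartAt E q (γ s)) (g := fun s => chartAt E q (γ' s)) (a := a) (b := e)
    (fun _ _ => hK)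
    ((chartAt E q).continuousOn.comp (hc.mono hIci) fun s hs => (hes hs).1.1)
    (fun s hs => hder h s (hIci (Ico_subset_Icc_self hs)) (hes (Ico_subset_Icc_self hs)).1.1)
    (fun s hs => (hes (Ico_subset_Icc_self hs)).1.2)
    ((chartAt E q).continuousOn.comp (hc'.mono hIci) fun s hs => (hes hs).2.1)
    (fun s hs => hder h' s (hIci (Ico_subset_Icc_self hs)) (hes (Ico_subset_Icc_self hs)).2.1)
    (fun s hs => (hes (Ico_subset_Icc_self hs)).2.2) (by simp only [← ha, ← hq])
  refine mem_of_superset (Ioc_mem_nhdsGT he) fun s hs => ?_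
  exact (chartAt E q).injOn (hes (Ioc_subset_Icc_self hs)).1.1 (hes (Ioc_subset_Icc_self hs)).2.1
    (heq (Ioc_subset_Icc_self hs))

theorem FlowsTo.unique (hU : IsOpen U) (hρ : SmoothField U ρ) {p z z' : M}
    (h : FlowsTo U ρ p z) (h' : FlowsTo U ρ p z') : z = z' := by
  obtain ⟨γ, h0, hγU, hγ, hz⟩ := h
  obtain ⟨γ', h0', -, hγ', hz'⟩ := h'
  have h1 := eqOn_Ici_of_isMIntegralCurveOn hU hρ hγ hγ' hγU (h0.trans h0'.symm)
  refine tendsto_nhds_unique hz (hz'.congr' ?_)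
  filter_upwards [eventually_ge_atTop 0] with s hs using (h1 hs).symm

theorem eulerProj_eq {I : Set M} (hU : IsOpen U) (hρ : SmoothField U ρ) {p z : M} (hz : z ∈ I)
    (h : FlowsTo U ρ p z) : eulerProj I U ρ p = z := by
  have h1 : ∃ z ∈ I, FlowsTo U ρ p z := ⟨z, hz, h⟩
  rw [eulerProj, dif_pos h1]
  exact h1.choose_spec.2.unique hU hρ h

variable {E' : Type} [NormedAddCommGroup E'] [NormedSpace ℝ E'] [FiniteDimensional ℝ E']
variable {Y : Type*} [TopologicalSpace Y] [ChartedSpace E' Y] [IsManifold 𝓘(ℝ, E') ∞ Y]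
variable {ι : Y → M}

/-- Near the submanifold the projection along the flow lines of an Euler vector field is defined
and smooth. -/
theorem IsEuler.exists_smooth_projection [Nonempty Y]
    (hι : IsClosedSubmanifold (E := E) (E' := E') ι)
    (hdim : Module.finrank ℝ E' < Module.finrank ℝ E) (hU : IsOpen U) (hIU : range ι ⊆ U)
    (hρ : IsEuler (range ι) U ρ) :
    ∃ (V : Set M) (P : M → Y), IsOpen V ∧ range ι ⊆ V ∧ V ⊆ basin (range ι) U ρ ∧
      ContMDiffOn 𝓘(ℝ, E) 𝓘(ℝ, E') ∞ P V ∧ (∀ y, P (ι y) = y) ∧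
      ∀ p ∈ V, ι (P p) = eulerProj (range ι) U ρ p := by
  have hinj : Function.Injective ι := hι.embedding.isEmbedding.injective
  have hloc : ∀ y : Y, ∃ (N : Set M) (P : M → Y), IsOpen N ∧ ι y ∈ N ∧
      ContMDiffOn 𝓘(ℝ, E) 𝓘(ℝ, E') ∞ P N ∧ (∀ p ∈ N, FlowsTo U ρ p (ι (P p))) ∧
      ρ (ι y) = 0 := by
    intro y
    obtain ⟨F, _, _, e, S, hS⟩ := hι.exists_sliceChart y
    have : FiniteDimensional ℝ (E' × F) := e.symm.toLinearEquiv.finiteDimensional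
    have : FiniteDimensional ℝ F :=
      FiniteDimensional.of_surjective (LinearMap.snd ℝ E' F) LinearMap.snd_surjective
    have : Nontrivial F := by
      refine Module.finrank_pos_iff (R := ℝ).1 ?_
      have h1 := e.toLinearEquiv.finrank_eq
      rw [Module.finrank_prod] at h1
      omega
    have hyU : ι y ∈ U := hIU (mem_range_self y)
    obtain ⟨N, P, h1, h2, h3, h4⟩ := hρ.exists_local_flow S hU hS (mem_range_self y) hyU
    refine ⟨N, P, h1, h2, h3, h4, ?_⟩
    have h5 : S.coord (ι y) = ((S.coord (ι y)).1, 0) :=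
      Prod.ext rfl ((S.mem_range_iff _ hS).1 (mem_range_self y))
    have h6 : S.coord (ι y) ∈ S.region U :=
      ⟨S.coord.map_source hS, by rwa [mem_preimage, S.coord.left_inv hS]⟩
    have h7 : S.field ρ (S.coord (ι y)) = 0 := by
      rw [h5] at h6 ⊢
      exact (hρ.field_eq S hU h6).1
    have h8 := S.mfderiv_symm_field ρ (S.coord.map_source hS)
    rw [S.coord.left_inv hS] at h8
    rw [← h8, h7]
    exact map_zero (mfderiv 𝓘(ℝ, E' × F) 𝓘(ℝ, E) S.coord.symm (S.coord (ι y)))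
  choose N P hN hyN hP hflow hzero using hloc
  have heq : ∀ y, ∀ p ∈ N y, eulerProj (range ι) U ρ p = ι (P y p) := fun y p hp =>
    eulerProj_eq hU hρ.1 (mem_range_self _) (hflow y p hp)
  have heq' : ∀ y, ∀ p ∈ N y, Function.invFun ι (eulerProj (range ι) U ρ p) = P y p :=
    fun y p hp => by rw [heq y p hp, Function.leftInverse_invFun hinj]
  refine ⟨⋃ y, N y, fun p => Function.invFun ι (eulerProj (range ι) U ρ p), isOpen_iUnion hN,
    ?_, ?_, ?_, fun y => ?_, ?_⟩
  · rintro _ ⟨y, rfl⟩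
    exact mem_iUnion.2 ⟨y, hyN y⟩
  · intro p hp
    obtain ⟨y, hy⟩ := mem_iUnion.1 hp
    exact ⟨_, mem_range_self _, hflow y p hy⟩
  · intro p hp
    obtain ⟨y, hy⟩ := mem_iUnion.1 hp
    refine (((hP y).contMDiffAt ((hN y).mem_nhds hy)).congr_of_eventuallyEq ?_).contMDiffWithinAt
    filter_upwards [(hN y).mem_nhds hy] with q hq using heq' y q hq
  · -- The flow line through a point of the submanifold is constant.
    have h1 : FlowsTo U ρ (ι y) (ι y) := by
      refine ⟨fun _ => ι y, rfl, fun _ _ => hIU (mem_range_self y), fun s _ => ?_,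
        tendsto_const_nhds⟩
      refine (hasMFDerivAt_const (ι y) s).hasMFDerivWithinAt.congr_mfderiv ?_
      refine ContinuousLinearMap.ext fun (a : ℝ) => ?_
      change (0 : E) = a • (-ρ (ι y) : E)
      rw [hzero y]
      exact (smul_eq_zero_of_right a neg_zero).symm
    simp only []
    rw [eulerProj_eq hU hρ.1 (mem_range_self y) h1, Function.leftInverse_invFun hinj]
  · intro p hp
    obtain ⟨y, hy⟩ := mem_iUnion.1 hp
    simp only []
    rw [heq' y p hy, heq y p hy]

end Uniqueness

/-! ### Covectors pulled back from the submanifold -/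

section Pull

variable {E : Type*} [NormedAddCommGroup E] [NormedSpace ℝ E]
variable {M : Type*} [TopologicalSpace M] [ChartedSpace E M] [IsManifold 𝓘(ℝ, E) ∞ M]
variable {H : Type*} [NormedAddCommGroup H] [NormedSpace ℝ H]

/-- A covector `ζ ∘ dG_p` in the trivialization of the cotangent bundle at `x₀`. -/
theorem inCoordinates_pullCovector {G : M → H} {O : Set M} (hO : IsOpen O)
    (hG : ContMDiffOn 𝓘(ℝ, E) 𝓘(ℝ, H) ∞ G O) (x₀ : M) {p : M} (hp : p ∈ O)
    (hps : p ∈ (chartAt E x₀).source) (ζ : H →L[ℝ] ℝ) :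
    ContinuousLinearMap.inCoordinates E (fun p : M => TangentSpace 𝓘(ℝ, E) p) ℝ
      (fun p : M => Bundle.Trivial M ℝ p) x₀ p x₀ p (pullCovector E G p ζ).2 =
      ζ.comp (fderiv ℝ (G ∘ (chartAt E x₀).symm) (chartAt E x₀ p)) := by
  have hinv := (chartAt E x₀).left_inv hps
  have h1 : MDifferentiableAt 𝓘(ℝ, E) 𝓘(ℝ, E) (chartAt E x₀).symm (chartAt E x₀ p) :=
    ((contMDiffOn_chart_symm (n := ∞) (I := 𝓘(ℝ, E)) (x := x₀)).contMDiffAt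
      ((chartAt E x₀).open_target.mem_nhds ((chartAt E x₀).map_source hps))).mdifferentiableAt
      (by simp)
  have h2 : MDifferentiableAt 𝓘(ℝ, E) 𝓘(ℝ, H) G ((chartAt E x₀).symm (chartAt E x₀ p)) := by
    rw [hinv]
    exact (hG.contMDiffAt (hO.mem_nhds hp)).mdifferentiableAt (by simp)
  have h3 := mfderiv_comp (chartAt E x₀ p) h2 h1
  rw [mfderiv_eq_fderiv, hinv] at h3
  have h4 : (trivializationAt E (fun p : M => TangentSpace 𝓘(ℝ, E) p) x₀).symmL ℝ p =
      (mfderiv 𝓘(ℝ, E) 𝓘(ℝ, E) (chartAt E x₀).symm (chartAt E x₀ p) : E →L[ℝ] E) := by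
    refine (TangentBundle.symmL_trivializationAt hps).trans ?_
    rw [ModelWithCorners.range_eq_univ, mfderivWithin_univ]
    rfl
  have h5 : ∀ r : ℝ, (trivializationAt ℝ (fun p : M => Bundle.Trivial M ℝ p)
      x₀).continuousLinearMapAt ℝ p r = r := fun r =>
    congrArg (fun A : ℝ →L[ℝ] ℝ => A r)
      (Bundle.Trivial.continuousLinearMapAt_trivialization ℝ M ℝ p)
  refine ContinuousLinearMap.ext fun v => (h5 _).trans ?_
  have e1 := congrArg (fun A : E →L[ℝ] H => A v) h3
  have e2 := congrArg (fun A : E →L[ℝ] E => A v) h4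
  exact (congrArg (fun w : E => ζ ((mfderiv 𝓘(ℝ, E) 𝓘(ℝ, H) G p : E →L[ℝ] H) w)) e2).trans
    (congrArg ζ e1).symm

theorem continuousAt_pullCovector {G : M → H} {O : Set M} (hO : IsOpen O)
    (hG : ContMDiffOn 𝓘(ℝ, E) 𝓘(ℝ, H) ∞ G O) {p₀ : M} (hp₀ : p₀ ∈ O) (ζ₀ : H →L[ℝ] ℝ) :
    ContinuousAt (fun z : M × (H →L[ℝ] ℝ) => z.2.comp
        (fderiv ℝ (G ∘ (chartAt E p₀).symm) (chartAt E p₀ z.1))) (p₀, ζ₀) ∧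
      ContinuousAt (fun z : M × (H →L[ℝ] ℝ) => pullCovector E G z.1 z.2) (p₀, ζ₀) := by
  have hs := mem_chart_source E p₀
  have hdiff : ContDiffOn ℝ ∞ (G ∘ (chartAt E p₀).symm)
      ((chartAt E p₀).target ∩ (chartAt E p₀).symm ⁻¹' O) := by
    rw [← contMDiffOn_iff_contDiffOn]
    exact hG.comp ((contMDiffOn_chart_symm (x := p₀)).mono inter_subset_left) fun x hx => hx.2
  have hc : ContinuousAt (fderiv ℝ (G ∘ (chartAt E p₀).symm)) (chartAt E p₀ p₀) := by
    have ho := (chartAt E p₀).isOpen_inter_preimage_symm hO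
    refine (hdiff.continuousOn_fderiv_of_isOpen ho (by simp)).continuousAt (ho.mem_nhds ?_)
    exact ⟨(chartAt E p₀).map_source hs, by rwa [mem_preimage, (chartAt E p₀).left_inv hs]⟩
  have hcoord : ContinuousAt (fun z : M × (H →L[ℝ] ℝ) => z.2.comp
      (fderiv ℝ (G ∘ (chartAt E p₀).symm) (chartAt E p₀ z.1))) (p₀, ζ₀) := by
    have h1 : ContinuousAt (fun z : M × (H →L[ℝ] ℝ) => fderiv ℝ (G ∘ (chartAt E p₀).symm)
        (chartAt E p₀ z.1)) (p₀, ζ₀) :=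
      ContinuousAt.comp (x := (p₀, ζ₀)) (f := fun z : M × (H →L[ℝ] ℝ) => chartAt E p₀ z.1) hc
        (ContinuousAt.comp (x := (p₀, ζ₀)) (f := Prod.fst) ((chartAt E p₀).continuousAt hs)
          continuousAt_fst)
    exact continuousAt_snd.clm_comp h1
  refine ⟨hcoord, ?_⟩
  refine (continuousAt_hom_bundle _ _).2 ⟨continuousAt_fst, hcoord.congr_of_eventuallyEq ?_⟩
  have h1 : ∀ᶠ z : M × (H →L[ℝ] ℝ) in 𝓝 (p₀, ζ₀), z.1 ∈ O ∩ (chartAt E p₀).source :=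
    continuousAt_fst.eventually ((hO.inter (chartAt E p₀).open_source).mem_nhds ⟨hp₀, hs⟩)
  filter_upwards [h1] with z hz
  exact inCoordinates_pullCovector hO hG p₀ hz.1 hz.2 z.2

theorem eventually_pullCovector_ne_zero {G : M → H} {O : Set M} (hO : IsOpen O)
    (hG : ContMDiffOn 𝓘(ℝ, E) 𝓘(ℝ, H) ∞ G O) {p₀ : M} (hp₀ : p₀ ∈ O) {ζ₀ : H →L[ℝ] ℝ}
    (h0 : (pullCovector E G p₀ ζ₀).2 ≠ 0) :
    ∀ᶠ z : M × (H →L[ℝ] ℝ) in 𝓝 (p₀, ζ₀), (pullCovector E G z.1 z.2).2 ≠ 0 := by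
  have hs := mem_chart_source E p₀
  have h1 : ∀ᶠ z : M × (H →L[ℝ] ℝ) in 𝓝 (p₀, ζ₀), z.1 ∈ O ∩ (chartAt E p₀).source :=
    continuousAt_fst.eventually ((hO.inter (chartAt E p₀).open_source).mem_nhds ⟨hp₀, hs⟩)
  have h2 : ζ₀.comp (fderiv ℝ (G ∘ (chartAt E p₀).symm) (chartAt E p₀ p₀)) ≠ 0 := by
    intro h2
    refine h0 (ContinuousLinearMap.ext fun v => ?_)
    have h3 : DifferentiableAt ℝ (G ∘ (chartAt E p₀).symm) (chartAt E p₀ p₀) := by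
      rw [← mdifferentiableAt_iff_differentiableAt]
      refine MDifferentiableAt.comp _ (I' := 𝓘(ℝ, E)) ?_
        (((contMDiffOn_chart_symm (n := ∞) (I := 𝓘(ℝ, E)) (x := p₀)).contMDiffAt
          ((chartAt E p₀).open_target.mem_nhds ((chartAt E p₀).map_source hs))).mdifferentiableAt
          (by simp))
      rw [(chartAt E p₀).left_inv hs]
      exact (hG.contMDiffAt (hO.mem_nhds hp₀)).mdifferentiableAt (by simp)
    have h4 := mfderiv_apply_eq_fderiv_comp_chart p₀ hs h3 (G := G) (by
      filter_upwards [(chartAt E p₀).open_source.mem_nhds hs] with q hq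
      simp only [Function.comp_apply, (chartAt E p₀).left_inv hq]) v
    exact (congrArg ζ₀ h4).trans (congrArg (fun A : E →L[ℝ] ℝ =>
      A (mfderiv 𝓘(ℝ, E) 𝓘(ℝ, E) (chartAt E p₀) p₀ v)) h2)
  filter_upwards [h1, (continuousAt_pullCovector hO hG hp₀ ζ₀).1.eventually_ne h2] with z hz hne h
  refine hne ?_
  rw [← inCoordinates_pullCovector hO hG p₀ hz.1 hz.2 z.2, h]
  exact ContinuousLinearMap.ext fun v => map_zero ((trivializationAt ℝ
    (fun p : M => Bundle.Trivial M ℝ p) p₀).continuousLinearMapAt ℝ z.1)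

end Pull

section Closure

variable {E : Type*} [NormedAddCommGroup E] [InnerProductSpace ℝ E] [FiniteDimensional ℝ E]
  [MeasurableSpace E] [BorelSpace E]
variable {M : Type*} [TopologicalSpace M] [T2Space M] [SigmaCompactSpace M] [ChartedSpace E M]
  [IsManifold 𝓘(ℝ, E) ∞ M]
variable {H : Type*} [NormedAddCommGroup H] [NormedSpace ℝ H] [FiniteDimensional ℝ H]

/-- The wave front condition at one point extends to a neighbourhood, by compactness of the unit
sphere. -/
theorem eventually_forall_microlocallySmoothAt {Ω : Set M} (t : Distr E Ω) {G : M → H} {O : Set M}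
    (hO : IsOpen O) (hG : ContMDiffOn 𝓘(ℝ, E) 𝓘(ℝ, H) ∞ G O) {p₀ : M} (hp₀ : p₀ ∈ O)
    (h : ∀ ζ : H →L[ℝ] ℝ, ‖ζ‖ = 1 → pullCovector E G p₀ ζ ∉ closure (WF t) ∧
      (pullCovector E G p₀ ζ).2 ≠ 0) :
    ∀ᶠ p in 𝓝 p₀, p ∈ Ω → ∀ ζ : H →L[ℝ] ℝ, ζ ≠ 0 →
      MicrolocallySmoothAt t (pullCovector E G p ζ) := by
  have key : ∀ᶠ p in 𝓝 p₀, ∀ ζ ∈ Metric.sphere (0 : H →L[ℝ] ℝ) 1,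
      pullCovector E G p ζ ∉ closure (WF t) ∧ (pullCovector E G p ζ).2 ≠ 0 := by
    refine (isCompact_sphere (0 : H →L[ℝ] ℝ) 1).eventually_forall_of_forall_eventually
      fun ζ hζ => ?_
    rw [mem_sphere_zero_iff_norm] at hζ
    obtain ⟨h1, h2⟩ := h ζ hζ
    exact ((continuousAt_pullCovector hO hG hp₀ ζ).2.eventually
      (isClosed_closure.isOpen_compl.mem_nhds h1)).and
      (eventually_pullCovector_ne_zero hO hG hp₀ h2)
  filter_upwards [key] with p hp hpΩ ζ hζ
  have hn : 0 < ‖ζ‖ := norm_pos_iff.2 hζ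
  obtain ⟨h1, h2⟩ := hp (‖ζ‖⁻¹ • ζ) (by
    rw [mem_sphere_zero_iff_norm, norm_smul, norm_inv, norm_norm, inv_mul_cancel₀ hn.ne'])
  have h3 : MicrolocallySmoothAt t (pullCovector E G p (‖ζ‖⁻¹ • ζ)) := by
    by_contra h3
    exact h1 (subset_closure ⟨hpΩ, h2, h3⟩)
  let A : E →L[ℝ] H := mfderiv 𝓘(ℝ, E) 𝓘(ℝ, H) G p
  have h4 : MicrolocallySmoothAt t
      (⟨p, (‖ζ‖ • (‖ζ‖⁻¹ • ζ).comp A : E →L[ℝ] ℝ)⟩ : Cotangent E M) :=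
    MicrolocallySmoothAt.smul h3 hn
  have h5 : (‖ζ‖ • (‖ζ‖⁻¹ • ζ).comp A : E →L[ℝ] ℝ) = ζ.comp A := by
    rw [ContinuousLinearMap.smul_comp, smul_smul, mul_inv_cancel₀ hn.ne', one_smul]
  rw [h5] at h4
  exact h4

variable {E' : Type*} [NormedAddCommGroup E'] [NormedSpace ℝ E'] [FiniteDimensional ℝ E']
variable {Y : Type*} [TopologicalSpace Y] [ChartedSpace E' Y] [IsManifold 𝓘(ℝ, E') ∞ Y]
variable {ι : Y → M}

theorem comp_mfderiv_chart_ne_zero {y q : Y} (hq : q ∈ (chartAt E' y).source) {ζ : E' →L[ℝ] ℝ}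
    (hζ : ζ ≠ 0) :
    ζ.comp (mfderiv 𝓘(ℝ, E') 𝓘(ℝ, E') (chartAt E' y) q : E' →L[ℝ] E') ≠ 0 := by
  intro h
  obtain ⟨e, he⟩ : ∃ e : E' ≃L[ℝ] E', (e : E' →L[ℝ] E') =
      (mfderiv 𝓘(ℝ, E') 𝓘(ℝ, E') (chartAt E' y) q : E' →L[ℝ] E') :=
    isInvertible_mfderiv_extChartAt (I := 𝓘(ℝ, E')) (x := y) (y := q) (by simpa)
  refine hζ (ContinuousLinearMap.ext fun v => ?_)
  have h1 := congrArg (fun A : E' →L[ℝ] ℝ => A (e.symm v)) h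
  have h2 : (mfderiv 𝓘(ℝ, E') 𝓘(ℝ, E') (chartAt E' y) q : E' →L[ℝ] E') (e.symm v) = v := by
    rw [← he]
    exact e.apply_symm_apply v
  change ζ ((mfderiv 𝓘(ℝ, E') 𝓘(ℝ, E') (chartAt E' y) q : E' →L[ℝ] E') (e.symm v)) = 0 at h1
  rwa [h2] at h1

/-- Near the submanifold no nonzero covector in the wave front set of `t` is conormal to the fibres
of the projection `P`, since covectors pulled back by `P` are not conormal to the submanifold. -/
theorem exists_nhds_microlocallySmoothAt (hι : IsClosedSubmanifold (E := E) (E' := E') ι)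
    {Ω : Set M} (t : Distr E Ω)
    (ht : ∀ x ∈ closure (WF t), x.proj ∈ range ι → x.2 ≠ 0 → x ∈ conormal (E' := E') ι)
    {V₀ : Set M} (hV₀ : IsOpen V₀) (hιV₀ : range ι ⊆ V₀) {P : M → Y}
    (hP : ContMDiffOn 𝓘(ℝ, E) 𝓘(ℝ, E') ∞ P V₀) (hPι : ∀ y, P (ι y) = y) :
    ∃ V, IsOpen V ∧ range ι ⊆ V ∧ V ⊆ V₀ ∧ ∀ p ∈ V, p ∈ Ω → ∀ y : Y,
      P p ∈ (chartAt E' y).source → ∀ ζ : E' →L[ℝ] ℝ, ‖ζ‖ = 1 →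
        MicrolocallySmoothAt t (pullCovector E (fun q => chartAt E' y (P q)) p ζ) := by
  have hinj : Function.Injective ι := hι.embedding.isEmbedding.injective
  refine ⟨V₀ ∩ interior {p | p ∈ Ω → ∀ y : Y, P p ∈ (chartAt E' y).source → ∀ ζ : E' →L[ℝ] ℝ,
    ‖ζ‖ = 1 → MicrolocallySmoothAt t (pullCovector E (fun q => chartAt E' y (P q)) p ζ)},
    hV₀.inter isOpen_interior, subset_inter hιV₀ ?_, inter_subset_left,
    fun p hp => interior_subset hp.2⟩
  rintro _ ⟨y₀, rfl⟩
  rw [mem_interior_iff_mem_nhds]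
  have hy₀V : ι y₀ ∈ V₀ := hιV₀ (mem_range_self y₀)
  let O : Set M := V₀ ∩ P ⁻¹' (chartAt E' y₀).source
  have hO : IsOpen O := hP.continuousOn.isOpen_inter_preimage hV₀ (chartAt E' y₀).open_source
  have hy₀O : ι y₀ ∈ O := ⟨hy₀V, by rw [mem_preimage, hPι]; exact mem_chart_source E' y₀⟩
  let G : M → E' := fun q => chartAt E' y₀ (P q)
  have hG : ContMDiffOn 𝓘(ℝ, E) 𝓘(ℝ, E') ∞ G O :=
    (contMDiffOn_chart (I := 𝓘(ℝ, E'))).comp (hP.mono inter_subset_left) fun q hq => hq.2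
  have htan : ∀ ζ : E' →L[ℝ] ℝ, ‖ζ‖ = 1 → ¬ ∀ v : TangentSpace 𝓘(ℝ, E') y₀,
      (pullCovector E G (ι y₀) ζ).2 (mfderiv 𝓘(ℝ, E') 𝓘(ℝ, E) ι y₀ v) = 0 := by
    intro ζ hζ hv
    have h1 := mfderiv_comp y₀ ((hG.contMDiffAt (hO.mem_nhds hy₀O)).mdifferentiableAt (by simp))
      ((hι.embedding.contMDiff y₀).mdifferentiableAt (by simp))
    have h2 : G ∘ ι = chartAt E' y₀ := funext fun y => by simp only [G, Function.comp_apply, hPι]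
    rw [h2] at h1
    refine comp_mfderiv_chart_ne_zero (mem_chart_source E' y₀) (ζ := ζ)
      (fun h => by rw [h, norm_zero] at hζ; exact zero_ne_one hζ) ?_
    rw [h1]
    exact ContinuousLinearMap.ext hv
  have hev := eventually_forall_microlocallySmoothAt t hO hG hy₀O fun ζ hζ => by
    have h2 : (pullCovector E G (ι y₀) ζ).2 ≠ 0 := fun h => htan ζ hζ fun v => by rw [h]; rfl
    refine ⟨fun hcl => ?_, h2⟩
    obtain ⟨y, η, -, hv, hx⟩ := ht _ hcl (mem_range_self y₀) h2
    obtain rfl : y₀ = y := hinj (congrArg Bundle.TotalSpace.proj hx)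
    refine htan ζ hζ fun v => ?_
    rw [hx]
    exact hv v
  filter_upwards [hev, hO.mem_nhds hy₀O] with p hp hpO hpΩ y hy ζ hζ
  -- Transition from the chart at `y` to the chart at `y₀`.
  have hPp : MDifferentiableAt 𝓘(ℝ, E) 𝓘(ℝ, E') P p :=
    (hP.contMDiffAt (hV₀.mem_nhds hpO.1)).mdifferentiableAt (by simp)
  have h1 := mfderiv_comp p (mdifferentiableAt_chart hy) hPp
  have h2 := mfderiv_comp p (mdifferentiableAt_chart (E := E') (p := y₀) hpO.2) hPp
  have hu : DifferentiableAt ℝ (chartAt E' y ∘ (chartAt E' y₀).symm) (chartAt E' y₀ (P p)) := by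
    rw [← mdifferentiableAt_iff_differentiableAt]
    refine MDifferentiableAt.comp _ (I' := 𝓘(ℝ, E')) ?_
      (((contMDiffOn_chart_symm (n := ∞) (I := 𝓘(ℝ, E')) (x := y₀)).contMDiffAt
        ((chartAt E' y₀).open_target.mem_nhds ((chartAt E' y₀).map_source hpO.2))).mdifferentiableAt
        (by simp))
    rw [(chartAt E' y₀).left_inv hpO.2]
    exact mdifferentiableAt_chart hy
  have h3 := mfderiv_apply_eq_fderiv_comp_chart y₀ hpO.2 hu (G := chartAt E' y) (by
    filter_upwards [(chartAt E' y₀).open_source.mem_nhds hpO.2] with q hq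
    simp only [Function.comp_apply, (chartAt E' y₀).left_inv hq])
  set ζ' : E' →L[ℝ] ℝ :=
    ζ.comp (fderiv ℝ (chartAt E' y ∘ (chartAt E' y₀).symm) (chartAt E' y₀ (P p))) with hζ'
  have h4 : ζ' ≠ 0 := by
    intro h0
    refine comp_mfderiv_chart_ne_zero hy (ζ := ζ)
      (fun h => by rw [h, norm_zero] at hζ; exact zero_ne_one hζ)
      (ContinuousLinearMap.ext fun v => ?_)
    exact (congrArg ζ (h3 v)).trans (congrArg (fun A : E' →L[ℝ] ℝ =>
      A (mfderiv 𝓘(ℝ, E') 𝓘(ℝ, E') (chartAt E' y₀) (P p) v)) h0)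
  have h5 : pullCovector E (fun q => chartAt E' y (P q)) p ζ = pullCovector E G p ζ' := by
    refine congrArg (Bundle.TotalSpace.mk p) (ContinuousLinearMap.ext fun v => ?_)
    have e1 := congrArg (fun A : E →L[ℝ] E' => A v) h1
    have e2 := congrArg (fun A : E →L[ℝ] E' => A v) h2
    exact congrArg ζ (e1.trans ((h3 _).trans (congrArg (fderiv ℝ (chartAt E' y ∘
      (chartAt E' y₀).symm) (chartAt E' y₀ (P p))) e2.symm)))
  rw [h5]
  exact hp hpΩ ζ' h4

end Closure

/-! ### Local counterterms -/

section Counterterm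

variable {E : Type} [NormedAddCommGroup E] [InnerProductSpace ℝ E] [FiniteDimensional ℝ E]
  [MeasurableSpace E] [BorelSpace E]
variable {M : Type*} [TopologicalSpace M] [T2Space M] [SigmaCompactSpace M] [ChartedSpace E M]
  [IsManifold 𝓘(ℝ, E) ∞ M]
variable {n : ℕ} {Y : Type*} [TopologicalSpace Y] [T2Space Y] [SigmaCompactSpace Y]
  [ChartedSpace (EuclideanSpace ℝ (Fin n)) Y] [IsManifold 𝓘(ℝ, EuclideanSpace ℝ (Fin n)) ∞ Y]
  [MeasurableSpace Y] [BorelSpace Y]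
variable {ι : Y → M} (hι : IsClosedSubmanifold (E := E) (E' := EuclideanSpace ℝ (Fin n)) ι)
variable {W : Set M} {d : ℕ}

theorem exists_contMDiff_eq_one_of_isClosed {Z O : Set Y} (hZ : IsClosed Z) (hO : IsOpen O)
    (hZO : Z ⊆ O) : ∃ κ : Y → ℂ, ContMDiff 𝓘(ℝ, EuclideanSpace ℝ (Fin n)) 𝓘(ℝ, ℂ) ∞ κ ∧
      tsupport κ ⊆ O ∧ ∀ y ∈ Z, κ y = 1 := by
  have : LocallyCompactSpace Y := ChartedSpace.locallyCompactSpace (EuclideanSpace ℝ (Fin n)) Y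
  obtain ⟨χ, h0, h1, -⟩ := exists_contMDiffMap_zero_one_nhds_of_isClosed
    𝓘(ℝ, EuclideanSpace ℝ (Fin n)) (n := ⊤) hO.isClosed_compl hZ
    (disjoint_left.2 fun y hy hyZ => hy (hZO hyZ))
  refine ⟨fun y => (χ y : ℂ), Complex.ofRealCLM.contDiff.contMDiff.comp χ.contMDiff,
    fun y hy => ?_, fun y hy => ?_⟩
  · by_contra hyO
    refine notMem_tsupport_iff_eventuallyEq.2 ?_ hy
    filter_upwards [eventually_nhdsSet_iff_forall.1 h0 y hyO] with q hq
    rw [hq, Complex.ofReal_zero, Pi.zero_apply]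
  · exact (congrArg Complex.ofReal (h1.self_of_nhdsSet y hy)).trans Complex.ofReal_one

/-- The counterterm is the transverse derivative `∂_h^α` of a smooth density on the submanifold,
namely of the push-forward of `t ψ` under the projection. -/
theorem exists_counterterm {μ : Measure Y} (hμ : IsSmoothPositiveDensity n μ)
    (t : Distr E (range ι)ᶜ) {V : Set M} (hV : IsOpen V) {P : M → Y}
    (hP : ContMDiffOn 𝓘(ℝ, E) 𝓘(ℝ, EuclideanSpace ℝ (Fin n)) ∞ P V)
    {e : M → M} (hPe : ∀ p ∈ V, ι (P p) = e p)
    (hms : ∀ p ∈ V, p ∈ (range ι)ᶜ → ∀ y : Y,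
      P p ∈ (chartAt (EuclideanSpace ℝ (Fin n)) y).source →
      ∀ ζ : EuclideanSpace ℝ (Fin n) →L[ℝ] ℝ, ‖ζ‖ = 1 → MicrolocallySmoothAt t
        (pullCovector E (fun q => chartAt (EuclideanSpace ℝ (Fin n)) y (P q)) p ζ))
    (H : TransverseSystem E (range ι) W d) (α : Fin d → ℕ) {ψ : M → ℂ}
    (hψ : ContMDiff 𝓘(ℝ, E) 𝓘(ℝ, ℂ) ∞ ψ) (hψ0 : ∀ᶠ q in 𝓝ˢ (range ι), ψ q = 0)
    (hψV : tsupport ψ ⊆ V) (hprop : IsProperMap (fun q : tsupport ψ => e q))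
    (hψW : ∀ q ∈ tsupport ψ, e q ∈ W) :
    ∃ τ : Distr E (univ : Set M),
      (∀ φ : TestSpace E (univ : Set M), ∃ θ : TestSpace E (range ι)ᶜ,
        (∀ q, (θ : M → ℂ) q = ψ q *
          multiIter (fun j => dirDeriv (H.field j)) α (φ : M → ℂ) (e q)) ∧
        τ.toLin φ = t.toLin θ) ∧
      WF τ ⊆ conormal (E' := EuclideanSpace ℝ (Fin n)) ι ∧
      ∃ S : (Fin d → ℕ) → Distr (EuclideanSpace ℝ (Fin n)) (ι ⁻¹' W),
        IsTransverseExpansion hι H τ S ∧ ∀ β, IsSmoothDistr μ (S β) := by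
  have hιc := hι.embedding.contMDiff.continuous
  have hinj := hι.embedding.isEmbedding.injective
  have hψΩ : tsupport ψ ⊆ (range ι)ᶜ := fun q hq hqι =>
    notMem_tsupport_iff_eventuallyEq.2 (eventually_nhdsSet_iff_forall.1 hψ0 q hqι) hq
  have hcomp : ∀ K : Set Y, IsCompact K → IsCompact (tsupport ψ ∩ P ⁻¹' K) := fun K hK => by
    have h1 := (hprop.isCompact_preimage (hK.image hιc)).image continuous_subtype_val
    convert h1 using 1
    ext q
    constructor
    · rintro ⟨hq, hqK⟩
      exact ⟨⟨q, hq⟩, ⟨P q, hqK, hPe q (hψV hq)⟩, rfl⟩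
    · rintro ⟨⟨q, hq⟩, ⟨y, hy, hye⟩, rfl⟩
      refine ⟨hq, ?_⟩
      rw [mem_preimage, ← hinj (hye.trans (hPe q (hψV hq)).symm)]
      exact hy
  have hZ : IsClosed (P '' tsupport ψ) := by
    have h1 := hprop.isClosedMap.isClosed_range.preimage hιc
    convert h1 using 1
    ext y
    constructor
    · rintro ⟨q, hq, rfl⟩
      exact ⟨⟨q, hq⟩, (hPe q (hψV hq)).symm⟩
    · rintro ⟨⟨q, hq⟩, h⟩
      exact ⟨q, hq, hinj ((hPe q (hψV hq)).trans h)⟩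
  obtain ⟨κ, hκ, hκW, hκ1⟩ := exists_contMDiff_eq_one_of_isClosed (n := n) hZ
    (H.isOpen.preimage hιc) (by
      rintro _ ⟨q, hq, rfl⟩
      rw [mem_preimage, hPe q (hψV hq)]
      exact hψW q hq)
  obtain ⟨f, hf, hft⟩ := exists_smooth_density_pullMul hμ t hψ hV hP hψV hψΩ hcomp
    fun y p hp hpy ζ hζ => hms p (hψV hp) (hψΩ hp) y hpy ζ hζ
  obtain ⟨τ, hτ, hWF, S, hS, hSs⟩ := exists_layer_distr hι hμ H α (f := fun y => f y * κ y)
    (fun y => contMDiffAt_mul (hf y) (hκ y)) (tsupport_mul_subset_right.trans hκW)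
  refine ⟨τ, fun φ => ?_, hWF, S, hS, hSs⟩
  refine ⟨pullMul hψ hV hP hψV hψΩ hcomp (restrictDeriv hι H α hκ hκW φ), fun q => ?_, ?_⟩
  · change ψ q * (κ (P q) * multiIter (fun j => dirDeriv (H.field j)) α (φ : M → ℂ) (ι (P q))) = _
    by_cases hq : q ∈ tsupport ψ
    · rw [hκ1 _ (mem_image_of_mem P hq), one_mul, hPe q (hψV hq)]
    · rw [image_eq_zero_of_notMem_tsupport hq, zero_mul, zero_mul]
  · rw [hτ, hft]
    refine integral_congr_ae (Eventually.of_forall fun y => ?_)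
    exact mul_assoc (f y) (κ y) _

end Counterterm

end Counterterms

end

theorem mainTheorem9 (n d : ℕ) (hd : 0 < d)
    {M : Type*} [TopologicalSpace M] [T2Space M] [SigmaCompactSpace M]
    [ChartedSpace (EuclideanSpace ℝ (Fin (n + d))) M]
    [IsManifold 𝓘(ℝ, EuclideanSpace ℝ (Fin (n + d))) ∞ M]
    {Y : Type*} [TopologicalSpace Y] [MeasurableSpace Y] [BorelSpace Y]
    [ChartedSpace (EuclideanSpace ℝ (Fin n)) Y]
    [IsManifold 𝓘(ℝ, EuclideanSpace ℝ (Fin n)) ∞ Y]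
    (ι : Y → M)
    (hι : IsClosedSubmanifold (E := EuclideanSpace ℝ (Fin (n + d)))
      (E' := EuclideanSpace ℝ (Fin n)) ι)
    (μ : Measure Y) (hμ : IsSmoothPositiveDensity n μ)
    (U : Set M) (hU : IsOpen U) (hIU : range ι ⊆ U)
    (ρ : ∀ p : M, TangentSpace 𝓘(ℝ, EuclideanSpace ℝ (Fin (n + d))) p)
    (hρ : IsEuler (range ι) U ρ)
    (t : Distr (EuclideanSpace ℝ (Fin (n + d))) (range ι)ᶜ)
    (ht : ∀ x ∈ closure (WF t), x.proj ∈ range ι → x.2 ≠ 0 →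
      x ∈ conormal (E' := EuclideanSpace ℝ (Fin n)) ι) :
    ∃ V : Set M, IsOpen V ∧ range ι ⊆ V ∧ V ⊆ basin (range ι) U ρ ∧
      ∀ (W : Set M)
        (H : TransverseSystem (EuclideanSpace ℝ (Fin (n + d))) (range ι) W d)
        (α : Fin d → ℕ) (ψ : M → ℂ),
        ContMDiff 𝓘(ℝ, EuclideanSpace ℝ (Fin (n + d))) 𝓘(ℝ, ℂ) ∞ ψ →
        (∀ᶠ q in 𝓝ˢ (range ι), ψ q = 0) →
        tsupport ψ ⊆ V →
        IsProperMap (fun q : tsupport ψ => eulerProj (range ι) U ρ q) →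
        (∀ q ∈ tsupport ψ, eulerProj (range ι) U ρ q ∈ W) →
        ∃ τ : Distr (EuclideanSpace ℝ (Fin (n + d))) (univ : Set M),
          (∀ φ : TestSpace (EuclideanSpace ℝ (Fin (n + d))) (univ : Set M),
            ∃ θ : TestSpace (EuclideanSpace ℝ (Fin (n + d))) (range ι)ᶜ,
              (∀ q, (θ : M → ℂ) q = ψ q *
                multiIter (fun j => dirDeriv (H.field j)) α (φ : M → ℂ)
                  (eulerProj (range ι) U ρ q)) ∧
              τ.toLin φ = t.toLin θ) ∧
          WF τ ⊆ conormal (E' := EuclideanSpace ℝ (Fin n)) ι ∧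
          ∃ S : (Fin d → ℕ) → Distr (EuclideanSpace ℝ (Fin n)) (ι ⁻¹' W),
            IsTransverseExpansion hι H τ S ∧
            (∀ β, IsSmoothDistr μ (S β)) ∧
            ∀ S' : (Fin d → ℕ) → Distr (EuclideanSpace ℝ (Fin n)) (ι ⁻¹' W),
              IsTransverseExpansion hι H τ S' → S' = S := by
  have hcl : IsClosedEmbedding ι := ⟨hι.embedding.isEmbedding, hι.closed⟩
  have hT2 : T2Space Y := hι.embedding.isEmbedding.t2Space
  have hσ : SigmaCompactSpace Y := hcl.sigmaCompactSpace
  rcases isEmpty_or_nonempty Y with hY | hY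
  · have hr : range ι = ∅ := range_eq_empty ι
    refine ⟨∅, isOpen_empty, hr.subset, empty_subset _,
      fun W H α ψ hψ hψ0 hψV hprop hψW => ?_⟩
    have hψ' : ∀ q, ψ q = 0 := fun q =>
      image_eq_zero_of_notMem_tsupport fun hq => hψV hq
    obtain ⟨τ, hτ, hWF, S, hS, hSs⟩ := exists_layer_distr hι hμ H α
      (f := fun _ => 0) contMDiff_const (fun y => (hY.false y).elim)
    refine ⟨τ, fun φ => ⟨0, fun q => ?_, ?_⟩, hWF, S, hS, hSs, fun S' _ => ?_⟩
    · rw [hψ', zero_mul]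
      rfl
    · rw [hτ, map_zero]
      simp
    · -- There are no nonzero test functions on the empty submanifold.
      funext β
      have h1 : (S' β).toLin = (S β).toLin := LinearMap.ext fun θ => by
        have h0 : θ = 0 := Subtype.ext (funext fun y => (hY.false y).elim)
        rw [h0, map_zero, map_zero]
      cases hβ : S β
      cases hβ' : S' β
      rw [hβ, hβ'] at h1
      cases h1
      rfl
  obtain ⟨V₀, P, hV₀, hιV₀, hV₀b, hP, hPι, hPe⟩ := hρ.exists_smooth_projection hι
    (by rw [finrank_euclideanSpace_fin, finrank_euclideanSpace_fin]; omega) hU hIU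
  obtain ⟨V, hV, hιV, hVV₀, hms⟩ := exists_nhds_microlocallySmoothAt hι t ht hV₀ hιV₀ hP hPι
  refine ⟨V, hV, hιV, hVV₀.trans hV₀b, fun W H α ψ hψ hψ0 hψV hprop hψW => ?_⟩
  obtain ⟨τ, hτ, hWF, S, hS, hSs⟩ := exists_counterterm hι hμ t hV (hP.mono hVV₀)
    (fun p hp => hPe p (hVV₀ hp)) hms H α hψ hψ0 hψV hprop hψW
  exact ⟨τ, hτ, hWF, S, hS, hSs, fun S' hS' =>
    IsTransverseExpansion.unique hι hV₀ hιV₀ hP hPι hS hS'⟩
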